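/- Let $f:\mathbb{R}^2\to\mathbb{R}$ be a smooth function with $\nabla f(x)\neq 0$ at every zero $x$ of $f$, and suppose that its zero set $M=Z(f)=\{x: f(x)=0\}$ is contained in the square $[-L,L]^2$, where $L>0$. Let $\tau\in[0,\infty]$ be the reach of $M$, that is, the supremum of all $r\ge 0$ such that every point of $\mathbb{R}^2$ at distance less than $r$ from $M$ has a unique nearest point on $M$. Divide $[-L,L]^2$ into an $n\times n$ grid of closed square boxes of side length $\delta=2L/n$, and assume that $\delta\le\tau/2.37$. Call a box *selected* if it has vertices $v_1,v_2$ with $f(v_1)\ge 0$ and $f(v_2)\le 0$. Let $B$ be the union of all selected boxes, and let $\tilde B$ be the union of all boxes $b$ of the grid with $b\cap M\neq\emptyset$. Then $M\subset\tilde B$ and $B\subset\tilde B$, and: 1. $M$ is a deformation retract of $\tilde B$. 2. $B$ is a deformation retract of $\tilde B$. 3. $\pi_1(M)\cong\pi_1(B)\cong\pi_1(\tilde B)$ in the following sense: the inclusions of $M$ and of $B$ into $\tilde B$ induce isomorphisms of fundamental groups at every base point of $M$, respectively $B$, and equivalences of fundamental groupoids (so the fundamental groupoids of $M$, $B$ and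 $\tilde B$ are equivalent); and $\pi_1(M,x)\cong\pi_1(B,y)$ whenever $x\in M$ and $y\in B$ lie in the same path component of $\tilde B$. 4. For $i\in\{0,1\}$, the inclusions of $M$ and of $B$ into $\tilde B$ induce isomorphisms on singular cohomology with integer coefficients, so that $H^i(M;\mathbb{Z})\cong H^i(B;\mathbb{Z})\cong H^i(\tilde B;\mathbb{Z})$. Here $A\subset X$ is a deformation retract of $X$ if there is a homotopy of maps $X\to X$, fixing every point of $A$ at all times, from the identity to a map with image in $A$. -/

import Mathlib

open CategoryTheory
open scoped ContDiff

noncomputable section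

/-- The zero set `Z(f)`. -/
def zeroSet (f : EuclideanSpace ℝ (Fin 2) → ℝ) : Set (EuclideanSpace ℝ (Fin 2)) :=
  {p | f p = 0}

/-- The reach of a set `M`: the supremum of all `r` such that every point at distance less than `r`
from `M` has exactly one nearest point on `M`.  It takes values in `[0, ∞]`. -/
def reach {E : Type*} [PseudoEMetricSpace E] (M : Set E) : ENNReal :=
  sSup {r : ENNReal | ∀ p : E, Metric.infEDist p M < r →
    ∃! x : E, x ∈ M ∧ edist p x = Metric.infEDist p M}

/-- The vertex with indices `(i, j)` of the grid of mesh `δ` whose lower left vertex is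
`(-L, -L)`. -/
def gridVertex (L δ : ℝ) (i j : ℕ) : EuclideanSpace ℝ (Fin 2) :=
  !₂[-L + (i : ℝ) * δ, -L + (j : ℝ) * δ]

/-- The closed box of side length `δ` whose lower left vertex is `gridVertex L δ i j`. -/
def gridBox (L δ : ℝ) (i j : ℕ) : Set (EuclideanSpace ℝ (Fin 2)) :=
  {p | p 0 ∈ Set.Icc (-L + (i : ℝ) * δ) (-L + ((i : ℝ) + 1) * δ) ∧
       p 1 ∈ Set.Icc (-L + (j : ℝ) * δ) (-L + ((j : ℝ) + 1) * δ)}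

/-- The four vertices of `gridBox L δ i j`. -/
def boxVertices (L δ : ℝ) (i j : ℕ) : Set (EuclideanSpace ℝ (Fin 2)) :=
  {gridVertex L δ i j, gridVertex L δ (i + 1) j,
    gridVertex L δ i (j + 1), gridVertex L δ (i + 1) (j + 1)}

/-- A box is selected if it has vertices `v₁`, `v₂` with `f v₁ ≥ 0` and `f v₂ ≤ 0`. -/
def IsSelected (f : EuclideanSpace ℝ (Fin 2) → ℝ) (L δ : ℝ) (i j : ℕ) : Prop :=
  ∃ v₁ ∈ boxVertices L δ i j, ∃ v₂ ∈ boxVertices L δ i j, 0 ≤ f v₁ ∧ f v₂ ≤ 0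

/-- The union `B` of the selected boxes of the `n × n` grid. -/
def selectedUnion (f : EuclideanSpace ℝ (Fin 2) → ℝ) (L δ : ℝ) (n : ℕ) :
    Set (EuclideanSpace ℝ (Fin 2)) :=
  {p | ∃ i < n, ∃ j < n, IsSelected f L δ i j ∧ p ∈ gridBox L δ i j}

/-- The union of the boxes of the `n × n` grid that meet the set `M`. -/
def meetingUnion (M : Set (EuclideanSpace ℝ (Fin 2))) (L δ : ℝ) (n : ℕ) :
    Set (EuclideanSpace ℝ (Fin 2)) :=
  {p | ∃ i < n, ∃ j < n, (gridBox L δ i j ∩ M).Nonempty ∧ p ∈ gridBox L δ i j}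

/-- `A` is a deformation retract of `X`: there is a homotopy of maps `X → X`, fixing every point
of `A` at all times, from the identity to a map with values in `A`. -/
def IsDeformationRetract {E : Type*} [TopologicalSpace E] (A X : Set E) : Prop :=
  A ⊆ X ∧ ∃ r : C(X, X), (∀ x : X, (r x : E) ∈ A) ∧
    (ContinuousMap.id X).HomotopicRel r {x : X | (x : E) ∈ A}

/-- Singular cohomology `Hⁱ(-; ℤ)`: the `i`-th cohomology of `Hom(C_•(X; ℤ), ℤ)`, where
`C_•(X; ℤ)` is the singular chain complex. -/
def integralCohomology (i : ℕ) : TopCat.{0}ᵒᵖ ⥤ ModuleCat.{0} ℤ :=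
  ((AlgebraicTopology.singularChainComplexFunctor (ModuleCat.{0} ℤ)).obj (ModuleCat.of ℤ ℤ)).op ⋙
    HomologicalComplex.opFunctor _ _ ⋙
    ((linearYoneda ℤ (ModuleCat.{0} ℤ)).obj (ModuleCat.of ℤ ℤ)).mapHomologicalComplex _ ⋙
    HomologicalComplex.homologyFunctor _ _ i

/-- The group `Hⁱ(X; ℤ)`. -/
abbrev Hcoh (i : ℕ) (X : Type) [TopologicalSpace X] : ModuleCat.{0} ℤ :=
  (integralCohomology i).obj (Opposite.op (TopCat.of X))

/-- The map `Hⁱ(Y; ℤ) → Hⁱ(X; ℤ)` induced by a continuous map `X → Y`. -/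
abbrev Hcoh.map (i : ℕ) {X Y : Type} [TopologicalSpace X] [TopologicalSpace Y] (g : C(X, Y)) :
    Hcoh i Y ⟶ Hcoh i X :=
  (integralCohomology i).map (TopCat.ofHom g).op

/-- The inclusion map between two subsets of a space. -/
abbrev inclusionMap {E : Type*} [TopologicalSpace E] {A X : Set E} (h : A ⊆ X) : C(A, X) :=
  ⟨Set.inclusion h, continuous_inclusion h⟩

end

noncomputable section

/-! ### Deformation retracts -/

namespace IsDeformationRetract

/-- A retraction which moves every point along a segment inside `X` gives a deformation retract. -/
theorem of_segment {E : Type*} [AddCommGroup E] [Module ℝ E] [TopologicalSpace E]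
    [IsTopologicalAddGroup E] [ContinuousSMul ℝ E] {A X : Set E} (hAX : A ⊆ X) (r : E → E)
    (hr : ContinuousOn r X) (hrA : ∀ x ∈ X, r x ∈ A) (hfix : ∀ x ∈ A, r x = x)
    (hseg : ∀ x ∈ X, ∀ t ∈ Set.Icc (0 : ℝ) 1, x + t • (r x - x) ∈ X) :
    IsDeformationRetract A X := by
  have hr' : Continuous (fun x : X => r x) := continuousOn_iff_continuous_domRestrict.1 hr
  refine ⟨hAX, ⟨fun x => ⟨r x, hAX (hrA x x.2)⟩, hr'.subtype_mk _⟩, fun x => hrA x x.2, ⟨?_⟩⟩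
  refine ⟨⟨⟨fun p => ⟨(p.2 : E) + (p.1 : ℝ) • (r p.2 - p.2), hseg _ p.2.2 _ p.1.2⟩, ?_⟩, ?_, ?_⟩, ?_⟩
  · have : Continuous (fun p : unitInterval × X => r p.2) := hr'.comp continuous_snd
    have h2 : Continuous (fun p : unitInterval × X => (p.2 : E)) := by fun_prop
    have h1 : Continuous (fun p : unitInterval × X => (p.1 : ℝ)) := by fun_prop
    exact (h2.add (h1.smul (this.sub h2))).subtype_mk _
  · intro x; simp
  · intro x; simp
  · intro t x hx
    have : r x = x := hfix _ hx
    ext; simp [this]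

theorem refl {E : Type*} [TopologicalSpace E] (A : Set E) : IsDeformationRetract A A :=
  ⟨subset_rfl, ContinuousMap.id _, fun x => x.2, ContinuousMap.HomotopicRel.refl _⟩

/-- The homeomorphic image of a deformation retract. -/
theorem image {E F : Type*} [TopologicalSpace E] [TopologicalSpace F] {A X : Set E} (e : E ≃ₜ F)
    (h : IsDeformationRetract A X) : IsDeformationRetract (e '' A) (e '' X) := by
  obtain ⟨hAX, r, hr, ⟨H⟩⟩ := h
  let eX : X ≃ₜ (e '' X : Set F) := e.image X
  have hmem : ∀ y : (e '' X : Set F), (y : F) ∈ e '' A → ((eX.symm y : X) : E) ∈ A := by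
    rintro y ⟨a, ha, hay⟩
    obtain ⟨x, rfl⟩ := eX.surjective y
    have : a = x := e.injective hay
    simpa [← this] using ha
  refine ⟨Set.image_mono hAX,
    (eX : C(X, (e '' X : Set F))).comp (r.comp (eX.symm : C((e '' X : Set F), X))), ?_, ⟨?_⟩⟩
  · intro y
    exact ⟨_, hr (eX.symm y), rfl⟩
  · refine ⟨⟨⟨fun p => eX (H (p.1, eX.symm p.2)), by fun_prop⟩, ?_, ?_⟩, ?_⟩
    · intro y; simp
    · intro y; simp
    · intro t y hy
      have := H.eq_fst t (hmem y hy)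
      simp [this]

theorem trans {E : Type*} [TopologicalSpace E] {A B X : Set E} (h₁ : IsDeformationRetract A B)
    (h₂ : IsDeformationRetract B X) : IsDeformationRetract A X := by
  obtain ⟨hAB, r, hr, ⟨H⟩⟩ := h₁
  obtain ⟨hBX, s, hs, hH'⟩ := h₂
  let s' : C(X, B) := ⟨fun x => ⟨s x, hs x⟩, by fun_prop⟩
  let i : C(B, X) := inclusionMap hBX
  have his : i.comp s' = s := by ext; rfl
  refine ⟨hAB.trans hBX, i.comp (r.comp s'), fun x => hr _, ?_⟩
  have h1 : (ContinuousMap.id X).HomotopicRel s {x : X | (x : E) ∈ A} := by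
    obtain ⟨K⟩ := hH'
    exact ⟨⟨K.toHomotopy, fun t x hx => K.prop t x (hAB hx)⟩⟩
  refine h1.trans ⟨⟨⟨⟨fun p => i (H (p.1, s' p.2)), by fun_prop⟩, ?_, ?_⟩, ?_⟩⟩
  · intro x; simp [← his]
  · intro x; simp
  · intro t x hx
    have hsx : s x = x := (hH'.fst_eq_snd (show (x : E) ∈ B from hAB hx)).symm
    have hsx' : (s' x : E) ∈ A := by
      change ((s x : X) : E) ∈ A
      rw [hsx]; exact hx
    have := H.eq_fst t (x := s' x) hsx'
    simp [this, ← his]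

/-- The inclusion of a deformation retract is a homotopy equivalence. -/
theorem exists_homotopyEquiv {E : Type*} [TopologicalSpace E] {A X : Set E}
    (h : IsDeformationRetract A X) :
    ∃ e : ContinuousMap.HomotopyEquiv A X, e.toFun = inclusionMap h.1 := by
  obtain ⟨hAX, r, hr, hH⟩ := h
  let r' : C(X, A) := ⟨fun x => ⟨r x, hr x⟩, by fun_prop⟩
  refine ⟨⟨inclusionMap hAX, r', ?_, ?_⟩, rfl⟩
  · have : r'.comp (inclusionMap hAX) = ContinuousMap.id A := by
      ext x
      have := hH.fst_eq_snd (x := inclusionMap hAX x) x.2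
      exact (congrArg Subtype.val this).symm
    rw [this]
  · have : (inclusionMap hAX).comp r' = r := by ext; rfl
    rw [this]
    exact hH.homotopic.symm

end IsDeformationRetract

/-! ### Invariants of homotopy equivalences -/

section Invariants

theorem FundamentalGroupoid.map_isEquivalence {X Y : Type*} [TopologicalSpace X]
    [TopologicalSpace Y] (e : ContinuousMap.HomotopyEquiv X Y) :
    (FundamentalGroupoid.map e.toFun).IsEquivalence := by
  let E : FundamentalGroupoid X ≌ FundamentalGroupoid Y :=
    CategoryTheory.Equivalence.mk (FundamentalGroupoid.map e.toFun)
      (FundamentalGroupoid.map e.invFun)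
      (by
        simpa only [FundamentalGroupoid.map_id, FundamentalGroupoid.map_comp] using
          (asIso (FundamentalGroupoidFunctor.homotopicMapsNatIso e.left_inv.some)).symm)
      (by
        simpa only [FundamentalGroupoid.map_id, FundamentalGroupoid.map_comp] using
          asIso (FundamentalGroupoidFunctor.homotopicMapsNatIso e.right_inv.some))
  exact inferInstanceAs E.functor.IsEquivalence

theorem FundamentalGroup.map_bijective {X Y : Type*} [TopologicalSpace X]
    [TopologicalSpace Y] (e : ContinuousMap.HomotopyEquiv X Y) (x : X) :
    Function.Bijective (FundamentalGroup.map e.toFun x) := by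
  have := FundamentalGroupoid.map_isEquivalence e
  exact ⟨(FundamentalGroupoid.map e.toFun).map_injective,
    (FundamentalGroupoid.map e.toFun).map_surjective⟩

instance linearYoneda_obj_additive :
    ((linearYoneda ℤ (ModuleCat.{0} ℤ)).obj (ModuleCat.of ℤ ℤ)).Additive where

theorem integralCohomology_map_eq (i : ℕ) {X Y : TopCat.{0}} {f g : X ⟶ Y}
    (H : TopCat.Homotopy f g) :
    (integralCohomology i).map f.op = (integralCohomology i).map g.op := by
  have h := H.singularChainComplexFunctorObjMap (ModuleCat.of ℤ ℤ)
  have h' := (((linearYoneda ℤ (ModuleCat.{0} ℤ)).obj (ModuleCat.of ℤ ℤ)).mapHomotopy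
    h.op).homologyMap_eq i
  exact h'

theorem Hcoh.map_eq_of_homotopic (i : ℕ) {X Y : Type} [TopologicalSpace X] [TopologicalSpace Y]
    {f g : C(X, Y)} (h : f.Homotopic g) : Hcoh.map i f = Hcoh.map i g :=
  integralCohomology_map_eq i (f := TopCat.ofHom f) (g := TopCat.ofHom g) h.some

theorem Hcoh.map_comp (i : ℕ) {X Y Z : Type} [TopologicalSpace X] [TopologicalSpace Y]
    [TopologicalSpace Z] (g : C(Y, Z)) (f : C(X, Y)) :
    Hcoh.map i (g.comp f) = Hcoh.map i g ≫ Hcoh.map i f := by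
  unfold Hcoh.map
  rw [TopCat.ofHom_comp, op_comp, Functor.map_comp]

theorem Hcoh.map_id (i : ℕ) (X : Type) [TopologicalSpace X] :
    Hcoh.map i (ContinuousMap.id X) = 𝟙 _ := by
  unfold Hcoh.map
  rw [TopCat.ofHom_id, op_id, CategoryTheory.Functor.map_id]

theorem Hcoh.isIso_map (i : ℕ) {X Y : Type} [TopologicalSpace X] [TopologicalSpace Y]
    (e : ContinuousMap.HomotopyEquiv X Y) : IsIso (Hcoh.map i e.toFun) := by
  refine ⟨Hcoh.map i e.invFun, ?_, ?_⟩
  · rw [← Hcoh.map_comp, Hcoh.map_eq_of_homotopic i e.right_inv, Hcoh.map_id]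
  · rw [← Hcoh.map_comp, Hcoh.map_eq_of_homotopic i e.left_inv, Hcoh.map_id]

/-- The comparison of the invariants of two deformation retracts of the same space. -/
theorem deformationRetract_invariants {E : Type} [TopologicalSpace E] {M B X : Set E}
    (hM : IsDeformationRetract M X) (hB : IsDeformationRetract B X) :
    ∃ (iM : M ⊆ X) (iB : B ⊆ X),
      (∀ x : M, Function.Bijective (FundamentalGroup.map (inclusionMap iM) x)) ∧
      (∀ y : B, Function.Bijective (FundamentalGroup.map (inclusionMap iB) y)) ∧
      (∀ (x : M) (y : B), Joined (inclusionMap iM x) (inclusionMap iB y) →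
        Nonempty (FundamentalGroup M x ≃* FundamentalGroup B y)) ∧
      Nonempty (FundamentalGroupoid M ≌ FundamentalGroupoid B) ∧
      Nonempty (FundamentalGroupoid B ≌ FundamentalGroupoid X) ∧
      (FundamentalGroupoid.map (inclusionMap iM)).IsEquivalence ∧
      (FundamentalGroupoid.map (inclusionMap iB)).IsEquivalence ∧
      (∀ i : ℕ, i ≤ 1 →
        IsIso (Hcoh.map i (inclusionMap iM)) ∧ IsIso (Hcoh.map i (inclusionMap iB)) ∧
        Nonempty (Hcoh i M ≅ Hcoh i B) ∧ Nonempty (Hcoh i B ≅ Hcoh i X)) := by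
  obtain ⟨eM, heM⟩ := hM.exists_homotopyEquiv
  obtain ⟨eB, heB⟩ := hB.exists_homotopyEquiv
  have bM := FundamentalGroup.map_bijective eM
  have bB := FundamentalGroup.map_bijective eB
  have qM := FundamentalGroupoid.map_isEquivalence eM
  have qB := FundamentalGroupoid.map_isEquivalence eB
  have cM := fun i => Hcoh.isIso_map i eM
  have cB := fun i => Hcoh.isIso_map i eB
  rw [heM] at bM qM cM
  rw [heB] at bB qB cB
  refine ⟨hM.1, hB.1, bM, bB, ?_, ⟨?_⟩, ⟨?_⟩, qM, qB, fun i _ => ⟨cM i, cB i, ⟨?_⟩, ⟨?_⟩⟩⟩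
  · rintro x y ⟨p⟩
    exact ⟨(MulEquiv.ofBijective _ (bM x)).trans
      ((FundamentalGroup.fundamentalGroupMulEquivOfPath p).trans
        (MulEquiv.ofBijective _ (bB y)).symm)⟩
  · exact (FundamentalGroupoid.map (inclusionMap hM.1)).asEquivalence.trans
      (FundamentalGroupoid.map (inclusionMap hB.1)).asEquivalence.symm
  · exact (FundamentalGroupoid.map (inclusionMap hB.1)).asEquivalence
  · have := cM i
    have := cB i
    exact (asIso (Hcoh.map i (inclusionMap hM.1))).symm ≪≫ asIso (Hcoh.map i (inclusionMap hB.1))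
  · have := cB i
    exact (asIso (Hcoh.map i (inclusionMap hB.1))).symm

end Invariants

/-! ### The nearest point projection and balls tangent to the zero set -/

open Filter Topology

section Reach

/-- Every point at distance less than `R` from `M` has exactly one nearest point on `M`. -/
def UniqueNearest {E : Type*} [PseudoMetricSpace E] (M : Set E) (R : ℝ) : Prop :=
  ∀ y, Metric.infDist y M < R → ∃! x, x ∈ M ∧ dist y x = Metric.infDist y M

theorem uniqueNearest_of_le_reach {E : Type*} [PseudoMetricSpace E] {M : Set E}
    (hne : M.Nonempty) {R : ℝ}
    (h : ENNReal.ofReal R ≤ reach M) : UniqueNearest M R := by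
  intro y hy
  have hfin : Metric.infEDist y M ≠ ⊤ := Metric.infEDist_ne_top hne
  have h1 : Metric.infEDist y M < reach M := by
    refine lt_of_lt_of_le ?_ h
    rw [← ENNReal.ofReal_toReal hfin]
    exact (ENNReal.ofReal_lt_ofReal_iff_of_nonneg ENNReal.toReal_nonneg).2 hy
  obtain ⟨r, hr, hyr⟩ := lt_sSup_iff.1 h1
  obtain ⟨x, ⟨hx, hxd⟩, hu⟩ := hr y hyr
  refine ⟨x, ⟨hx, ?_⟩, fun x' hx' => hu x' ⟨hx'.1, ?_⟩⟩
  · rw [dist_edist, hxd]; rfl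
  · rw [edist_dist, hx'.2, Metric.infDist, ENNReal.ofReal_toReal hfin]

theorem UniqueNearest.tendsto {E : Type*} [MetricSpace E] {M : Set E} (hM : IsCompact M)
    {R : ℝ} (hu : UniqueNearest M R)
    {ι : Type*} {l : Filter ι} {ys xs : ι → E} {y x : E} (hy : Tendsto ys l (𝓝 y))
    (hR : Metric.infDist y M < R) (hxM : x ∈ M) (hx : dist y x = Metric.infDist y M)
    (hxs : ∀ i, xs i ∈ M) (hd : ∀ i, dist (ys i) (xs i) = Metric.infDist (ys i) M) :
    Tendsto xs l (𝓝 x) := by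
  refine hM.tendsto_nhds_of_unique_mapClusterPt (Eventually.of_forall hxs) fun z hz hcl => ?_
  obtain ⟨U, hU, hUz⟩ := mapClusterPt_iff_ultrafilter.1 hcl
  have h1 : Tendsto (fun i => dist (ys i) (xs i)) U (𝓝 (dist y z)) :=
    (hy.mono_left hU).dist hUz
  have h2 : Tendsto (fun i => dist (ys i) (xs i)) U (𝓝 (Metric.infDist y M)) := by
    simp only [hd]
    exact ((Metric.continuous_infDist_pt M).tendsto y).comp (hy.mono_left hU)
  exact (hu y hR).unique ⟨hz, tendsto_nhds_unique h1 h2⟩ ⟨hxM, hx⟩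

variable {E : Type*} [NormedAddCommGroup E] [InnerProductSpace ℝ E]

/-- The distance to `M` grows at unit rate in the direction away from the nearest point. -/
theorem UniqueNearest.eventually_lt_infDist {M : Set E} (hM : IsCompact M) (hne : M.Nonempty)
    {R : ℝ} (hu : UniqueNearest M R) {y : E} (h0 : 0 < Metric.infDist y M)
    (hR : Metric.infDist y M < R) {c : ℝ} (hc0 : 0 ≤ c) (hc : c < 1) :
    ∃ n : E, ‖n‖ = 1 ∧
      ∀ᶠ h in 𝓝[>] (0 : ℝ), Metric.infDist y M + c * h < Metric.infDist (y + h • n) M := by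
  choose P hPM hP using fun y => hM.exists_infDist_eq_dist hne y
  set ρ := Metric.infDist y M with hρ
  set n : E := ρ⁻¹ • (y - P y) with hn
  have hnorm : ‖y - P y‖ = ρ := by rw [← dist_eq_norm, ← hP]
  have hn1 : ‖n‖ = 1 := by
    rw [hn, norm_smul, hnorm, Real.norm_of_nonneg (by positivity), inv_mul_cancel₀ h0.ne']
  refine ⟨n, hn1, ?_⟩
  have hy : Tendsto (fun h : ℝ => y + h • n) (𝓝[>] 0) (𝓝 y) := by
    have : Tendsto (fun h : ℝ => y + h • n) (𝓝 0) (𝓝 (y + (0 : ℝ) • n)) :=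
      Continuous.tendsto (by fun_prop) 0
    rw [zero_smul, add_zero] at this
    exact this.mono_left nhdsWithin_le_nhds
  have hlim : Tendsto (fun h : ℝ => P (y + h • n)) (𝓝[>] 0) (𝓝 (P y)) :=
    hu.tendsto hM hy hR (hPM y) (hP y).symm (fun _ => hPM _) fun _ => (hP _).symm
  have hin : Tendsto (fun h : ℝ => inner ℝ n (y - P (y + h • n))) (𝓝[>] 0)
      (𝓝 (inner ℝ n (y - P y))) := tendsto_const_nhds.inner (tendsto_const_nhds.sub hlim)
  have hval : inner ℝ n (y - P y) = ρ := by
    rw [hn, inner_smul_left, real_inner_self_eq_norm_sq, hnorm]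
    simp only [conj_trivial]
    field_simp
  rw [hval] at hin
  have hlt : c * ρ < ρ := by nlinarith
  filter_upwards [hin.eventually (lt_mem_nhds hlt), self_mem_nhdsWithin] with h hh hpos
  have hpos : 0 < h := hpos
  have hge : ρ ≤ ‖y - P (y + h • n)‖ := by
    rw [← dist_eq_norm]; exact Metric.infDist_le_dist_of_mem (hPM _)
  have hsq : ‖y + h • n - P (y + h • n)‖ ^ 2
      = ‖y - P (y + h • n)‖ ^ 2 + 2 * h * inner ℝ n (y - P (y + h • n)) + h ^ 2 := by
    have : y + h • n - P (y + h • n) = (y - P (y + h • n)) + h • n := by abel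
    rw [this, norm_add_sq_real, inner_smul_right, norm_smul, hn1, real_inner_comm,
      Real.norm_of_nonneg hpos.le]
    ring
  rw [hP, dist_eq_norm]
  refine lt_of_pow_lt_pow_left₀ 2 (norm_nonneg _) ?_
  rw [hsq]
  have h3 : ρ ^ 2 ≤ ‖y - P (y + h • n)‖ ^ 2 := by gcongr
  have h4 : c ^ 2 ≤ 1 := by nlinarith
  nlinarith [mul_pos hpos (sub_pos.2 hh), sq_nonneg h]

theorem UniqueNearest.exists_add_le_infDist [ProperSpace E] {M : Set E} (hM : IsCompact M)
    (hne : M.Nonempty) {R : ℝ} (hu : UniqueNearest M R) {z : E} {s : ℝ} (hs : 0 < s)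
    (hsz : s < Metric.infDist z M) (hR : Metric.infDist z M + s < R) :
    ∃ y, dist y z ≤ s ∧ Metric.infDist z M + s ≤ Metric.infDist y M := by
  have hcont : Continuous (fun y => Metric.infDist y M) := Metric.continuous_infDist_pt M
  obtain ⟨y, hy, hmax⟩ := (isCompact_closedBall z s).exists_isMaxOn
    ⟨z, Metric.mem_closedBall_self hs.le⟩ hcont.continuousOn
  refine ⟨y, hy, ?_⟩
  by_contra! hlt
  have hzy : Metric.infDist z M ≤ Metric.infDist y M := hmax (Metric.mem_closedBall_self hs.le)
  set c : ℝ := (Metric.infDist y M - Metric.infDist z M + s) / (2 * s) with hc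
  have hcs : c * s = (Metric.infDist y M - Metric.infDist z M + s) / 2 := by
    rw [hc]; field_simp
  have hc0 : 0 ≤ c := by rw [hc]; apply div_nonneg <;> linarith
  have hc1 : c < 1 := by
    rw [hc, div_lt_one (by linarith)]; linarith
  obtain ⟨w, hw, hwmax⟩ := (isCompact_closedBall z s).exists_isMaxOn
    (f := fun y => Metric.infDist y M - c * dist y z)
    ⟨z, Metric.mem_closedBall_self hs.le⟩ (by fun_prop)
  have hwz : Metric.infDist z M ≤ Metric.infDist w M - c * dist w z := by
    simpa using hwmax (Metric.mem_closedBall_self hs.le)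
  have hwy : Metric.infDist w M ≤ Metric.infDist y M := hmax hw
  have hws : dist w z < s := by
    refine lt_of_le_of_ne hw fun h => ?_
    rw [h] at hwz
    linarith
  have hw0 : 0 < Metric.infDist w M := by
    have := Metric.infDist_le_infDist_add_dist (s := M) (x := z) (y := w)
    rw [dist_comm] at this
    linarith
  obtain ⟨n, hn, hev⟩ := hu.eventually_lt_infDist hM hne hw0 (by linarith) hc0 hc1
  have hev2 : ∀ᶠ h in 𝓝[>] (0 : ℝ), h < s - dist w z :=
    nhdsWithin_le_nhds (gt_mem_nhds (by linarith))
  obtain ⟨h, ⟨h1, h2⟩, h3⟩ := ((hev.and hev2).and self_mem_nhdsWithin).exists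
  have h3 : 0 < h := h3
  have hd : dist (w + h • n) z ≤ dist w z + h := by
    calc dist (w + h • n) z ≤ dist (w + h • n) w + dist w z := dist_triangle _ _ _
      _ = dist w z + h := by
        rw [dist_eq_norm, add_sub_cancel_left, norm_smul, hn, Real.norm_of_nonneg h3.le]; ring
  have h4 := hwmax (show w + h • n ∈ Metric.closedBall z s by
    rw [Metric.mem_closedBall]; linarith)
  simp only [Set.mem_ofPred_eq] at h4
  have := mul_le_mul_of_nonneg_left hd hc0
  nlinarith

/-- Federer's extension of normal segments: if `p` is nearest to `x`, then `p` is nearest to all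
points of the ray from `p` through `x` at distance less than `R` from `p`. -/
theorem UniqueNearest.le_infDist_ray [ProperSpace E] {M : Set E} (hM : IsCompact M) {R : ℝ}
    (hu : UniqueNearest M R) {p n : E} (hp : p ∈ M) (hn : ‖n‖ = 1) {d : ℝ} (hd : 0 < d)
    (hpd : d ≤ Metric.infDist (p + d • n) M) {t : ℝ} (hdt : d ≤ t) (htR : t < R) :
    t ≤ Metric.infDist (p + t • n) M := by
  have hne : M.Nonempty := ⟨p, hp⟩
  have hclosed : IsClosed {t : ℝ | t ≤ Metric.infDist (p + t • n) M} := by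
    refine isClosed_le continuous_id ?_
    exact (Metric.continuous_infDist_pt M).comp (by fun_prop)
  have hsub := (hclosed.inter isClosed_Icc).Icc_subset_of_forall_exists_gt (a := d) (b := t)
    hpd ?_
  · exact hsub ⟨hdt, le_rfl⟩
  rintro a ⟨ha, hda, hat⟩ b hb
  have ha : a ≤ Metric.infDist (p + a • n) M := ha
  have hb : a < b := hb
  have ha0 : 0 < a := hd.trans_le hda
  have hdist : dist (p + a • n) p = a := by
    rw [dist_eq_norm, add_sub_cancel_left, norm_smul, hn, Real.norm_of_nonneg ha0.le, mul_one]
  have heq : Metric.infDist (p + a • n) M = a :=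
    le_antisymm ((Metric.infDist_le_dist_of_mem hp).trans_eq hdist) ha
  obtain ⟨s, hs0, hs⟩ : ∃ s, 0 < s ∧ s < min (b - a) (min a (R - a)) :=
    exists_between (lt_min (by linarith) (lt_min ha0 (by linarith)))
  have hs1 : s < b - a := hs.trans_le (min_le_left _ _)
  have hs2 : s < a := hs.trans_le ((min_le_right _ _).trans (min_le_left _ _))
  have hs3 : s < R - a := hs.trans_le ((min_le_right _ _).trans (min_le_right _ _))
  obtain ⟨y, hyz, hy⟩ := hu.exists_add_le_infDist hM hne (z := p + a • n) hs0 (by linarith)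
    (by linarith)
  rw [heq] at hy
  have hyp : a + s ≤ ‖(y - (p + a • n)) + a • n‖ := by
    have : (y - (p + a • n)) + a • n = y - p := by abel
    rw [this, ← dist_eq_norm]
    exact hy.trans (Metric.infDist_le_dist_of_mem hp)
  set v := y - (p + a • n) with hv
  have hvs : ‖v‖ ≤ s := by rwa [hv, ← dist_eq_norm]
  have hsq : (a + s) ^ 2 ≤ ‖v + a • n‖ ^ 2 := by gcongr
  rw [norm_add_sq_real, inner_smul_right, norm_smul, hn, Real.norm_of_nonneg ha0.le] at hsq
  have hv2 : ‖v‖ ^ 2 ≤ s ^ 2 := by gcongr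
  have hvn : s ≤ inner ℝ v n := by
    by_contra! hlt
    nlinarith
  have hzero : ‖v - s • n‖ ^ 2 ≤ 0 := by
    rw [norm_sub_sq_real, inner_smul_right, norm_smul, hn, Real.norm_of_nonneg hs0.le]
    nlinarith
  have hvs' : v = s • n := by
    have : ‖v - s • n‖ = 0 := by
      have := norm_nonneg (v - s • n)
      nlinarith
    exact sub_eq_zero.1 (norm_eq_zero.1 this)
  refine ⟨a + s, ?_, by linarith, by linarith⟩
  have : p + (a + s) • n = y := by
    rw [add_smul, ← hvs', hv]; abel
  change a + s ≤ Metric.infDist (p + (a + s) • n) M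
  rwa [this]

theorem UniqueNearest.ball_disjoint [ProperSpace E] {M : Set E} (hM : IsCompact M) {R : ℝ}
    (hu : UniqueNearest M R) {p n : E} (hp : p ∈ M) (hn : ‖n‖ = 1) {d : ℝ} (hd : 0 < d)
    (hdR : d < R) (hpd : d ≤ Metric.infDist (p + d • n) M) {m : E} (hm : m ∈ M) :
    R ≤ dist (p + R • n) m := by
  have hcl : IsClosed {t : ℝ | t ≤ dist (p + t • n) m} :=
    isClosed_le continuous_id (by fun_prop)
  have hev : ∀ᶠ t in 𝓝[<] R, t ∈ {t : ℝ | t ≤ dist (p + t • n) m} := by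
    filter_upwards [self_mem_nhdsWithin, nhdsWithin_le_nhds (lt_mem_nhds hdR)] with t ht htd
    exact (hu.le_infDist_ray hM hp hn hd hpd htd.le ht).trans (Metric.infDist_le_dist_of_mem hm)
  exact hcl.mem_of_tendsto (tendsto_id.mono_left (nhdsWithin_le_nhds : 𝓝[<] R ≤ 𝓝 R)) hev

end Reach

section Normal

variable {E : Type*} [NormedAddCommGroup E] [InnerProductSpace ℝ E] [CompleteSpace E]

/-- The unit normal `∇f / ‖∇f‖`. -/
def unitNormal (f : E → ℝ) (p : E) : E := ‖gradient f p‖⁻¹ • gradient f p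

theorem hasDerivAt_comp_line {f : E → ℝ} {p : E} (hf : DifferentiableAt ℝ f p) (v : E) :
    HasDerivAt (fun h : ℝ => f (p + h • v)) (inner ℝ (gradient f p) v) 0 := by
  have h1 : HasFDerivAt f (InnerProductSpace.toDual ℝ E (gradient f p)) (p + (0 : ℝ) • v) := by
    simpa using hf.hasGradientAt.hasFDerivAt
  have h2 : HasDerivAt (fun h : ℝ => p + h • v) v 0 := by
    simpa using ((hasDerivAt_id (0 : ℝ)).smul_const v).const_add p
  exact h1.comp_hasDerivAt (0 : ℝ) h2

theorem inner_gradient_nonneg {f : E → ℝ} {p n v : E} {R : ℝ} (hR : 0 < R)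
    (hf : DifferentiableAt ℝ f p) (hp : f p = 0)
    (hpos : ∀ z, dist z (p + R • n) < R → 0 < f z) (hn : ‖n‖ = 1) (hv : 0 < inner ℝ v n) :
    0 ≤ inner ℝ (gradient f p) v := by
  have hder := hasDerivAt_comp_line hf v
  have hslope := hder.tendsto_slope.mono_left (nhdsWithin_mono (0 : ℝ)
    (show Set.Ioi (0 : ℝ) ⊆ {0}ᶜ from fun x hx => ne_of_gt hx))
  refine ge_of_tendsto hslope ?_
  have hev : ∀ᶠ h in 𝓝[>] (0 : ℝ), h * ‖v‖ ^ 2 < 2 * R * inner ℝ v n := by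
    have : Tendsto (fun h : ℝ => h * ‖v‖ ^ 2) (𝓝 0) (𝓝 (0 * ‖v‖ ^ 2)) :=
      Continuous.tendsto (by fun_prop) 0
    rw [zero_mul] at this
    exact (this.mono_left nhdsWithin_le_nhds).eventually (gt_mem_nhds (by positivity))
  filter_upwards [hev, self_mem_nhdsWithin] with h hh h0
  have h0 : 0 < h := h0
  have : 0 < f (p + h • v) := by
    apply hpos
    rw [dist_eq_norm]
    have e : p + h • v - (p + R • n) = h • v - R • n := by abel
    rw [e]
    refine lt_of_pow_lt_pow_left₀ 2 hR.le ?_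
    rw [norm_sub_sq_real, inner_smul_left, inner_smul_right, norm_smul, norm_smul, hn,
      Real.norm_of_nonneg h0.le, Real.norm_of_nonneg hR.le]
    simp only [conj_trivial]
    nlinarith
  rw [slope_def_field]
  simp only [zero_smul, add_zero, hp, sub_zero]
  positivity

/-- A ball on which `f` is positive and which touches the zero set of `f` at `p` is centred on the
normal at `p`. -/
theorem eq_unitNormal {f : E → ℝ} {p n : E} {R : ℝ} (hR : 0 < R)
    (hf : DifferentiableAt ℝ f p) (hp : f p = 0) (hne : gradient f p ≠ 0)
    (hpos : ∀ z, dist z (p + R • n) < R → 0 < f z) (hn : ‖n‖ = 1) : n = unitNormal f p := by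
  set G := gradient f p with hG
  have key : ∀ v, 0 < inner ℝ v n → 0 ≤ inner ℝ G v := fun v hv =>
    inner_gradient_nonneg hR hf hp hpos hn hv
  have hnn : inner ℝ n n = (1 : ℝ) := by rw [real_inner_self_eq_norm_sq, hn]; norm_num
  set a := inner ℝ G n with ha
  set g := G - a • n with hg
  have hgn : inner ℝ g n = 0 := by
    rw [hg, inner_sub_left, inner_smul_left, hnn]; simp [ha]
  have hGg : inner ℝ G g = ‖g‖ ^ 2 := by
    have : G = g + a • n := by rw [hg]; abel
    rw [this, inner_add_left, inner_smul_left, real_inner_comm g n, hgn,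
      real_inner_self_eq_norm_sq]
    simp
  have hg0 : g = 0 := by
    by_contra h
    have hpos : 0 < ‖g‖ ^ 2 := by positivity
    have h1 := key (n - ((a + 1) / ‖g‖ ^ 2) • g) (by
      rw [inner_sub_left, inner_smul_left, hgn, hnn]; simp)
    rw [inner_sub_right, inner_smul_right, hGg, div_mul_cancel₀ _ hpos.ne'] at h1
    linarith
  have hGa : G = a • n := by rw [← sub_eq_zero, ← hg, hg0]
  have ha0 : 0 ≤ a := key n (by rw [hnn]; norm_num)
  have hnorm : ‖G‖ = a := by rw [hGa, norm_smul, hn, Real.norm_of_nonneg ha0, mul_one]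
  have hane : a ≠ 0 := fun h => hne (by rw [hGa, h, zero_smul])
  have hun : unitNormal f p = a⁻¹ • G := by rw [unitNormal, ← hG, hnorm]
  rw [hun, hGa, smul_smul, inv_mul_cancel₀ hane, one_smul]

theorem norm_unitNormal {f : E → ℝ} {p : E} (hne : gradient f p ≠ 0) : ‖unitNormal f p‖ = 1 := by
  rw [unitNormal, norm_smul, norm_inv, norm_norm, inv_mul_cancel₀ (norm_ne_zero_iff.2 hne)]

theorem unitNormal_neg (f : E → ℝ) (p : E) : unitNormal (-f) p = -unitNormal f p := by
  have : gradient (-f) p = -gradient f p := by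
    simp [gradient, fderiv_neg]
  simp [unitNormal, this]

theorem continuousAt_unitNormal {f : E → ℝ} (hf : ContDiff ℝ 1 f) {p : E}
    (hne : gradient f p ≠ 0) : ContinuousAt (unitNormal f) p := by
  have hc : Continuous (gradient f) := by
    unfold gradient
    exact (InnerProductSpace.toDual ℝ E).symm.continuous.comp (hf.continuous_fderiv one_ne_zero)
  exact (hc.continuousAt.norm.inv₀ (norm_ne_zero_iff.2 hne)).smul hc.continuousAt

/-- `f` is positive on the ball of radius `R` which touches its zero set at `p` on the side of the
gradient. -/
theorem pos_of_dist_lt [ProperSpace E] {f : E → ℝ} (hf : ContDiff ℝ 1 f)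
    (hreg : ∀ p, f p = 0 → gradient f p ≠ 0) (hM : IsCompact {p | f p = 0}) {R : ℝ} (hR : 0 < R)
    (hu : UniqueNearest {p | f p = 0} R) {p z : E} (hp : f p = 0)
    (hz : dist z (p + R • unitNormal f p) < R) : 0 < f z := by
  set M := {p | f p = 0} with hMdef
  have hne : M.Nonempty := ⟨p, hp⟩
  choose P hPM hP using fun y => hM.exists_infDist_eq_dist hne y
  set ν := unitNormal f p with hν
  have hν1 : ‖ν‖ = 1 := norm_unitNormal (hreg p hp)
  have hx : Tendsto (fun h : ℝ => p + h • ν) (𝓝[>] 0) (𝓝 p) := by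
    have : Tendsto (fun h : ℝ => p + h • ν) (𝓝 0) (𝓝 (p + (0 : ℝ) • ν)) :=
      Continuous.tendsto (by fun_prop) 0
    rw [zero_smul, add_zero] at this
    exact this.mono_left nhdsWithin_le_nhds
  have hp0 : Metric.infDist p M = 0 := Metric.infDist_zero_of_mem hp
  have hlim : Tendsto (fun h : ℝ => P (p + h • ν)) (𝓝[>] 0) (𝓝 p) :=
    hu.tendsto hM hx (by rw [hp0]; exact hR) hp (by rw [hp0, dist_self]) (fun _ => hPM _)
      fun _ => (hP _).symm
  have hfpos : ∀ᶠ h in 𝓝[>] (0 : ℝ), 0 < f (p + h • ν) := by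
    have hd : DifferentiableAt ℝ f p := hf.differentiable one_ne_zero p
    have hder := hasDerivAt_comp_line hd ν
    have hpos : 0 < inner ℝ (gradient f p) ν := by
      rw [hν, unitNormal, inner_smul_right, real_inner_self_eq_norm_sq]
      have : 0 < ‖gradient f p‖ := norm_pos_iff.2 (hreg p hp)
      positivity
    have hslope := hder.tendsto_slope.mono_left (nhdsWithin_mono (0 : ℝ)
      (show Set.Ioi (0 : ℝ) ⊆ {0}ᶜ from fun x hx => ne_of_gt hx))
    filter_upwards [hslope.eventually (lt_mem_nhds hpos), self_mem_nhdsWithin] with h hh h0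
    have h0 : 0 < h := h0
    rw [slope_def_field] at hh
    simp only [zero_smul, add_zero, hp, sub_zero] at hh
    exact (div_pos_iff_of_pos_right h0).1 hh
  have hev : ∀ᶠ h in 𝓝[>] (0 : ℝ),
      dist z (P (p + h • ν) + R • unitNormal f (P (p + h • ν))) < R := by
    have hc : ContinuousAt (fun q => dist z (q + R • unitNormal f q)) p :=
      continuousAt_const.dist
        (continuousAt_id.add (continuousAt_const.smul (continuousAt_unitNormal hf (hreg p hp))))
    exact (hc.tendsto.comp hlim).eventually (gt_mem_nhds hz)
  have hRev : ∀ᶠ h in 𝓝[>] (0 : ℝ), h < R := nhdsWithin_le_nhds (gt_mem_nhds hR)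
  obtain ⟨h, ⟨⟨hfx, hzx⟩, hhR⟩, h0⟩ :=
    (((hfpos.and hev).and hRev).and self_mem_nhdsWithin).exists
  have h0 : 0 < h := h0
  set x := p + h • ν with hxdef
  set q := P x with hq
  have hqM : f q = 0 := hPM x
  set d := dist x q with hd
  have hdinf : Metric.infDist x M = d := hP x
  have hd0 : 0 < d := by
    rw [hd, dist_pos]
    rintro h
    rw [h, hqM] at hfx
    exact lt_irrefl _ hfx
  have hdh : d ≤ h := by
    rw [← hdinf]
    refine (Metric.infDist_le_dist_of_mem (show p ∈ M from hp)).trans ?_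
    rw [dist_eq_norm, hxdef, add_sub_cancel_left, norm_smul, hν1, Real.norm_of_nonneg h0.le,
      mul_one]
  set n := d⁻¹ • (x - q) with hn
  have hn1 : ‖n‖ = 1 := by
    rw [hn, norm_smul, ← dist_eq_norm, ← hd, Real.norm_of_nonneg (by positivity),
      inv_mul_cancel₀ hd0.ne']
  have hxq : x = q + d • n := by
    rw [hn, smul_smul, mul_inv_cancel₀ hd0.ne', one_smul]; abel
  have hball : ∀ y, dist y (q + R • n) < R → 0 < f y := by
    have hmiss : ∀ y ∈ Metric.ball (q + R • n) R, f y ≠ 0 := by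
      intro y hy hfy
      have := hu.ball_disjoint hM (hPM x) hn1 hd0 (by linarith) (by rw [← hq, ← hxq, hdinf]) hfy
      rw [Metric.mem_ball, dist_comm] at hy
      linarith
    have hxb : x ∈ Metric.ball (q + R • n) R := by
      rw [Metric.mem_ball, hxq, dist_eq_norm, add_sub_add_left_eq_sub, ← sub_smul, norm_smul, hn1,
        mul_one, Real.norm_eq_abs, abs_lt]
      constructor <;> linarith
    intro y hy
    by_contra! hneg
    obtain ⟨w, hw, hw0⟩ := (convex_ball (q + R • n) R).isPreconnected.intermediate_value
      (Metric.mem_ball.2 hy) hxb hf.continuous.continuousOn ⟨hneg, hfx.le⟩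
    exact hmiss w hw hw0
  have hnν : n = unitNormal f q :=
    eq_unitNormal hR (hf.differentiable one_ne_zero q) hqM (hreg q hqM) hball hn1
  exact hball z (by rw [hnν]; exact hzx)

theorem neg_of_dist_lt [ProperSpace E] {f : E → ℝ} (hf : ContDiff ℝ 1 f)
    (hreg : ∀ p, f p = 0 → gradient f p ≠ 0) (hM : IsCompact {p | f p = 0}) {R : ℝ} (hR : 0 < R)
    (hu : UniqueNearest {p | f p = 0} R) {p z : E} (hp : f p = 0)
    (hz : dist z (p - R • unitNormal f p) < R) : f z < 0 := by
  have hset : {p | (-f) p = 0} = {p | f p = 0} := by ext; simp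
  have hgrad : ∀ p, gradient (-f) p = -gradient f p := fun p => by simp [gradient, fderiv_neg]
  have := pos_of_dist_lt (f := -f) hf.neg (fun p hp => by
    rw [hgrad, neg_ne_zero]; exact hreg p (by simpa using hp)) (by rwa [hset]) hR
    (by rwa [hset]) (p := p) (z := z) (by simpa using hp) (by
      rw [unitNormal_neg, smul_neg, ← sub_eq_add_neg]; exact hz)
  simpa using this

end Normal

/-! ### Cut-off directions: estimates in coordinates -/

/-- A cut-off function which vanishes up to `1 / 3` and equals `1` from `1 / 2` on. -/
def cutoff (s : ℝ) : ℝ := max 0 (min 1 (6 * (s - 1 / 3)))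

theorem cutoff_nonneg (s : ℝ) : 0 ≤ cutoff s := le_max_left _ _

theorem cutoff_le_one (s : ℝ) : cutoff s ≤ 1 := max_le zero_le_one (min_le_left _ _)

theorem lt_of_cutoff_pos {s : ℝ} (h : 0 < cutoff s) : 1 / 3 < s := by
  by_contra! hs
  have : cutoff s = 0 := max_eq_left ((min_le_right _ _).trans (by linarith))
  exact h.ne' this

theorem cutoff_eq_one {s : ℝ} (h : 1 / 2 ≤ s) : cutoff s = 1 := by
  rw [cutoff, min_eq_left (by linarith), max_eq_right zero_le_one]

theorem continuous_cutoff : Continuous cutoff := by unfold cutoff; fun_prop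

theorem cutoff_inner_bound {u v : ℝ} (hu : 0 ≤ u) (hv : 0 ≤ v) (h : u ^ 2 + v ^ 2 = 1) :
    3 / 4 ≤ cutoff u * u ^ 2 + cutoff v * v ^ 2 := by
  have h1 := cutoff_nonneg u
  have h2 := cutoff_nonneg v
  rcases le_total (1 / 2) u with hu2 | hu2
  · rw [cutoff_eq_one hu2]
    rcases le_total (1 / 2) v with hv2 | hv2
    · rw [cutoff_eq_one hv2]; linarith
    · have : v ^ 2 ≤ 1 / 4 := by nlinarith
      have := mul_nonneg h2 (sq_nonneg v)
      linarith
  · have hu4 : u ^ 2 ≤ 1 / 4 := by nlinarith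
    have hv2 : 1 / 2 ≤ v := by nlinarith
    rw [cutoff_eq_one hv2]
    have := mul_nonneg h1 (sq_nonneg u)
    linarith

theorem crossing_bounds {u d τ : ℝ} (hu : 0 ≤ u) (hd : 0 < d) (hd2 : d ^ 2 ≤ 2) (hτ : 0 ≤ τ)
    (hτd : τ ≤ 1.6 * d) :
    -(0.85 * u) ≤ (d - cutoff u * τ) * u ∧ (d - cutoff u * τ) * u ≤ d * u ∧
      d * u ≤ 1.4143 * u := by
  have hd3 : d ≤ 1.4143 := by nlinarith
  have h1 := cutoff_nonneg u
  have h2 := cutoff_le_one u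
  have h3 : 0 ≤ cutoff u * τ := mul_nonneg h1 hτ
  have h4 : cutoff u * τ ≤ 1.6 * d := (mul_le_of_le_one_left hτ h2).trans hτd
  refine ⟨?_, by gcongr; linarith, by gcongr⟩
  nlinarith

/-- Passing through an edge: the position of the nearest point `(g₁, g₂)` (relative to the point
where the edge is crossed) contradicts the two tangent balls, if the next cell has no zero. -/
theorem no_edge_crossing {u v d τ α Y Y' g₁ g₂ : ℝ} (hu : 0 ≤ u) (hv : 0 ≤ v)
    (huv : u ^ 2 + v ^ 2 = 1) (hd : 0 < d) (hd2 : d ^ 2 ≤ 2) (hτ : 0 ≤ τ) (hτd : τ ≤ 1.6 * d)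
    (hl : 0 < cutoff u) (hg₁ : g₁ = (d - cutoff u * τ) * u) (hg₂ : g₂ = (d - cutoff v * τ) * v)
    (hα0 : 0 ≤ α) (hα1 : α ≤ 1) (hY0 : 0 ≤ Y) (hY1 : Y ≤ 1) (hY' : Y - 1 ≤ Y') (hY'' : Y' ≤ Y)
    (hB : 4.74 * ((α + g₁) * u + (g₂ - Y') * v) ≤ (α + g₁) ^ 2 + (g₂ - Y') ^ 2)
    (hG : ∀ s t, 0 ≤ s → s ≤ 1 → Y - 1 ≤ t → t ≤ Y →
      4.74 * ((s - g₁) * u + (t - g₂) * v) ≤ (s - g₁) ^ 2 + (t - g₂) ^ 2) : False := by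
  have hu3 : 1 / 3 < u := lt_of_cutoff_pos hl
  have hu1 : u ≤ 1 := by nlinarith only [huv, hu, sq_nonneg v]
  have hv1 : v ≤ 1 := by nlinarith only [huv, hv, sq_nonneg u]
  have hd3 : d ≤ 1.4143 := by nlinarith only [hd2, hd]
  obtain ⟨hg₁l, hg₁u, hdu⟩ := crossing_bounds hu hd hd2 hτ hτd
  obtain ⟨hg₂l, hg₂u, hdv⟩ := crossing_bounds hv hd hd2 hτ hτd
  rw [← hg₁] at hg₁l hg₁u
  rw [← hg₂] at hg₂l hg₂u
  rcases le_or_gt g₂ Y with hgY | hgY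
  · rcases lt_or_ge g₁ 1 with hg1 | hg1
    · -- the point of the next cell at the height of `p`
      have hX : (1 - g₁) * (1 - g₁ - 4.74 * u) < 0 :=
        mul_neg_of_pos_of_neg (by linarith) (by linarith)
      rcases le_or_gt (Y - 1) g₂ with hgY' | hgY'
      · have := hG 1 g₂ (by norm_num) le_rfl hgY' hgY
        linarith
      · have := hG 1 (Y - 1) (by norm_num) le_rfl le_rfl (by linarith)
        have he : (Y - 1 - g₂) * (Y - 1 - g₂ - 4.74 * v) ≤ 0 :=
          mul_nonpos_of_nonneg_of_nonpos (by linarith) (by linarith)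
        linarith
    · have hu7 : 0.7 ≤ u := by linarith
      rw [cutoff_eq_one (by linarith), one_mul] at hg₁
      have hdτ : 1 ≤ d - τ := by
        by_contra! hlt
        nlinarith only [mul_nonneg (sub_nonneg.2 hlt.le) hu, hg₁, hg1, hu1, hlt, hu7]
      have hg₂v : v ≤ g₂ := by
        have := mul_le_of_le_one_left hτ (cutoff_le_one v)
        have h1 : (d - τ) * v ≤ (d - cutoff v * τ) * v := by gcongr
        have h2 := mul_le_mul_of_nonneg_right hdτ hv
        rw [hg₂]; linarith
      have h1 : 2.2 ≤ (α + g₁) * (4.74 * u - (α + g₁)) := by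
        nlinarith only [mul_nonneg (show 0 ≤ α + g₁ - 1 by linarith)
          (show 0 ≤ 1 + 1.4143 * u - (α + g₁) by linarith), hu7, hg1, hα0,
          mul_nonneg (show 0 ≤ α + g₁ - 1 by linarith) (show 0 ≤ u - 0.7 by linarith)]
      have h2 : (g₂ - Y') * (g₂ - Y' - 4.74 * v) ≤ 1.6 := by
        have hlo : v - 1 ≤ g₂ - Y' := by linarith
        have hhi : g₂ - Y' ≤ 1 := by linarith
        nlinarith only [mul_nonneg (show 0 ≤ g₂ - Y' - (v - 1) by linarith)
          (show 0 ≤ 1 - (g₂ - Y') by linarith), sq_nonneg (v - 0.366), hlo, hhi, hv, hv1,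
          mul_nonneg (show 0 ≤ g₂ - Y' - (v - 1) by linarith) hv]
      linarith
  · rcases le_or_gt 0 g₁ with hg1 | hg1
    · rcases le_or_gt 0.301 v with hv3 | hv3
      · have h1 : (α + g₁) * (α + g₁ - 4.74 * u) ≤ 0 :=
          mul_nonpos_of_nonneg_of_nonpos (by linarith) (by linarith)
        have h2 : (g₂ - Y') * (g₂ - Y' - 4.74 * v) < 0 :=
          mul_neg_of_pos_of_neg (by linarith) (by linarith)
        linarith
      · have hu9 : 0.953 ≤ u := by nlinarith only [huv, hv3, hv, hu]
        have he : g₂ - Y ≤ 0.4258 := by linarith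
        have hg8 : 0.8 ≤ g₁ := by
          by_contra! hlt
          have := hG 1 Y (by norm_num) le_rfl (by linarith) le_rfl
          have h3 : 0.86 ≤ (1 - g₁) * (4.74 * u - (1 - g₁)) := by
            nlinarith only [hu9, hg1, hlt, mul_nonneg (show 0 ≤ 1 - g₁ by linarith)
              (show 0 ≤ u - 0.953 by linarith), mul_nonneg (show 0 ≤ 1 - g₁ - 0.2 by linarith) (show 0 ≤ g₁ by linarith)]
          have h4 : (g₂ - Y) * (g₂ - Y + 4.74 * v) ≤ 0.4258 * (0.4258 + 4.74 * 0.301) := by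
            gcongr
          linarith
        have h1 : 2.9 ≤ (α + g₁) * (4.74 * u - (α + g₁)) := by
          nlinarith only [hu9, hg8, hα0, mul_nonneg (show 0 ≤ α + g₁ by linarith)
            (show 0 ≤ u - 0.953 by linarith), mul_nonneg (show 0 ≤ α + g₁ - 0.8 by linarith)
            (show 0 ≤ 2.4143 - (α + g₁) by linarith)]
        have h2 : (g₂ - Y') * (g₂ - Y' - 4.74 * v) ≤ 1.4258 * 1.4258 := by
          have e1 : (g₂ - Y') * (g₂ - Y' - 4.74 * v) ≤ (g₂ - Y') * (g₂ - Y') :=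
            mul_le_mul_of_nonneg_left (by linarith) (by linarith)
          have e2 : (g₂ - Y') * (g₂ - Y') ≤ 1.4258 * 1.4258 :=
            mul_le_mul (by linarith) (by linarith) (by linarith) (by norm_num)
          exact e1.trans e2
        linarith
    · have hdu0 : d < cutoff u * τ := by
        by_contra! h
        have := mul_nonneg (sub_nonneg.2 h) hu
        linarith
      have hdv0 : cutoff v * τ < d := by
        by_contra! h
        have := mul_nonneg (sub_nonneg.2 h) hv
        linarith
      have hv2 : v < 1 / 2 := by
        by_contra! h
        rw [cutoff_eq_one h] at hdv0
        have := mul_le_of_le_one_left hτ (cutoff_le_one u)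
        linarith
      have hu8 : 0.866 ≤ u := by nlinarith only [huv, hv2, hv, hu]
      have := hG 1 Y (by norm_num) le_rfl (by linarith) le_rfl
      have h3 : 3 ≤ (1 - g₁) * (4.74 * u - (1 - g₁)) := by
        nlinarith only [hu8, hg1, mul_nonneg (show 0 ≤ -g₁ by linarith)
          (show 0 ≤ 0.85 + g₁ by linarith), mul_nonneg (show 0 ≤ -g₁ by linarith)
          (show 0 ≤ u - 0.866 by linarith)]
      have h4 : (g₂ - Y) * (g₂ - Y + 4.74 * v) ≤ 0.7072 * (0.7072 + 4.74 * (1 / 2)) := by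
        gcongr
        · linarith
        · linarith
      linarith

/-- Passing through a vertex. -/
theorem no_corner_crossing {u v d τ α β g₁ g₂ : ℝ} (hu : 0 ≤ u) (hv : 0 ≤ v)
    (huv : u ^ 2 + v ^ 2 = 1) (hd : 0 < d) (hd2 : d ^ 2 ≤ 2) (hτ : 0 ≤ τ) (hτd : τ ≤ 1.6 * d)
    (hlu : 0 < cutoff u) (hlv : 0 < cutoff v)
    (hg₁ : g₁ = (d - cutoff u * τ) * u) (hg₂ : g₂ = (d - cutoff v * τ) * v)
    (hne : 0 < g₁ ^ 2 + g₂ ^ 2)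
    (hα0 : 0 ≤ α) (hα1 : α ≤ 1) (hβ0 : 0 ≤ β) (hβ1 : β ≤ 1)
    (hB : 4.74 * ((α + g₁) * u + (β + g₂) * v) ≤ (α + g₁) ^ 2 + (β + g₂) ^ 2)
    (hG : ∀ s t, 0 ≤ s → s ≤ 1 → 0 ≤ t → t ≤ 1 →
      4.74 * ((s - g₁) * u + (t - g₂) * v) ≤ (s - g₁) ^ 2 + (t - g₂) ^ 2) : False := by
  have hu3 : 1 / 3 < u := lt_of_cutoff_pos hlu
  have hv3 : 1 / 3 < v := lt_of_cutoff_pos hlv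
  have hd3 : d ≤ 1.4143 := by nlinarith only [hd2, hd]
  obtain ⟨hg₁l, hg₁u, hdu⟩ := crossing_bounds hu hd hd2 hτ hτd
  obtain ⟨hg₂l, hg₂u, hdv⟩ := crossing_bounds hv hd hd2 hτ hτd
  have key : ∀ {u v g₁ g₂ : ℝ}, 0 ≤ u → 0 ≤ v → u ^ 2 + v ^ 2 = 1 →
      g₁ = (d - cutoff u * τ) * u → g₂ = (d - cutoff v * τ) * v → g₁ ≤ d * u → g₂ < 0 → 0 ≤ g₁ →
      g₁ ≤ 1 := by
    intro u v g₁ g₂ hu hv huv hg₁ hg₂ hg₁u h2 h1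
    by_contra! hlt
    have hu7 : 0.7 ≤ u := by linarith [mul_le_mul_of_nonneg_right hd3 hu]
    rw [cutoff_eq_one (by linarith), one_mul] at hg₁
    have hdτ : 0 < d - τ := by
      by_contra! h
      linarith [mul_nonpos_of_nonpos_of_nonneg h hu]
    have := mul_le_of_le_one_left hτ (cutoff_le_one v)
    have : 0 ≤ g₂ := by rw [hg₂]; exact mul_nonneg (by linarith) hv
    linarith
  have hk₁ := key hu hv huv hg₁ hg₂ (by rw [hg₁]; exact hg₁u)
  have hk₂ := key hv hu (by linarith) hg₂ hg₁ (by rw [hg₂]; exact hg₂u)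
  rw [← hg₁] at hg₁l hg₁u
  rw [← hg₂] at hg₂l hg₂u
  have n₁ : g₁ < 0 → (-g₁) * (-g₁ - 4.74 * u) < 0 := fun h =>
    mul_neg_of_pos_of_neg (by linarith) (by linarith)
  have n₂ : g₂ < 0 → (-g₂) * (-g₂ - 4.74 * v) < 0 := fun h =>
    mul_neg_of_pos_of_neg (by linarith) (by linarith)
  rcases le_or_gt 0 g₁ with h1 | h1 <;> rcases le_or_gt 0 g₂ with h2 | h2
  · have a1 : (α + g₁) * (α + g₁ - 4.74 * u) ≤ 0 :=
      mul_nonpos_of_nonneg_of_nonpos (by linarith) (by linarith)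
    have a2 : (β + g₂) * (β + g₂ - 4.74 * v) ≤ 0 :=
      mul_nonpos_of_nonneg_of_nonpos (by linarith) (by linarith)
    rcases h1.eq_or_lt with e1 | e1
    · have e2 : 0 < g₂ := lt_of_le_of_ne h2 (by rintro rfl; simp [← e1] at hne)
      have : (β + g₂) * (β + g₂ - 4.74 * v) < 0 :=
        mul_neg_of_pos_of_neg (by linarith) (by linarith)
      linarith
    · have : (α + g₁) * (α + g₁ - 4.74 * u) < 0 :=
        mul_neg_of_pos_of_neg (by linarith) (by linarith)
      linarith
  · have := hG g₁ 0 h1 (hk₁ h2 h1) le_rfl zero_le_one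
    linarith [n₂ h2]
  · have := hG 0 g₂ le_rfl zero_le_one h2 (hk₂ h1 h2)
    linarith [n₁ h1]
  · have := hG 0 0 le_rfl zero_le_one le_rfl zero_le_one
    linarith [n₁ h1, n₂ h2]

/-! ### Tangent balls of radius `2.37` -/

/-- The Euclidean plane. -/
abbrev Plane := EuclideanSpace ℝ (Fin 2)

/-- `ν` is a field of unit normals along the zero set of `g`, pointing to the positive side, such
that the open balls of radius `2.37` touching the zero set at any of its points lie on one side. -/
structure TangentBalls (g : Plane → ℝ) (ν : Plane → Plane) : Prop where
  cont : Continuous g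
  compact : IsCompact {p | g p = 0}
  contNormal : ContinuousOn ν {p | g p = 0}
  unit : ∀ p, g p = 0 → ν p 0 ^ 2 + ν p 1 ^ 2 = 1
  pos : ∀ p z, g p = 0 → (z 0 - p 0) ^ 2 + (z 1 - p 1) ^ 2
    < 4.74 * ((z 0 - p 0) * ν p 0 + (z 1 - p 1) * ν p 1) → 0 < g z
  neg : ∀ p z, g p = 0 → (z 0 - p 0) ^ 2 + (z 1 - p 1) ^ 2
    < -(4.74 * ((z 0 - p 0) * ν p 0 + (z 1 - p 1) * ν p 1)) → g z < 0

theorem plane_dist_sq (x y : Plane) : dist x y ^ 2 = (x 0 - y 0) ^ 2 + (x 1 - y 1) ^ 2 := by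
  rw [EuclideanSpace.dist_eq, Real.sq_sqrt (by positivity), Fin.sum_univ_two, Real.dist_eq,
    Real.dist_eq, sq_abs, sq_abs]

namespace TangentBalls

variable {g : Plane → ℝ} {ν : Plane → Plane}

theorem negate (h : TangentBalls g ν) : TangentBalls (-g) (-ν) where
  cont := h.cont.neg
  compact := by simpa using h.compact
  contNormal := by simpa using h.contNormal.neg
  unit p hp := by simpa using h.unit p (by simpa using hp)
  pos p z hp hz := by
    have := h.neg p z (by simpa using hp) (by simp at hz; linarith)
    simpa using this
  neg p z hp hz := by
    have := h.pos p z (by simpa using hp) (by simp at hz; linarith)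
    simpa using this

/-- Balls on opposite sides are disjoint. -/
theorem le_dist_centers (h : TangentBalls g ν) {p q : Plane} (hp : g p = 0) (hq : g q = 0) :
    4.74 ^ 2 ≤ ((p 0 + 2.37 * ν p 0) - (q 0 - 2.37 * ν q 0)) ^ 2 +
      ((p 1 + 2.37 * ν p 1) - (q 1 - 2.37 * ν q 1)) ^ 2 := by
  by_contra! hlt
  set c : Plane := !₂[((p 0 + 2.37 * ν p 0) + (q 0 - 2.37 * ν q 0)) / 2,
    ((p 1 + 2.37 * ν p 1) + (q 1 - 2.37 * ν q 1)) / 2] with hc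
  have h0 : c 0 = ((p 0 + 2.37 * ν p 0) + (q 0 - 2.37 * ν q 0)) / 2 := by simp [hc]
  have h1 : c 1 = ((p 1 + 2.37 * ν p 1) + (q 1 - 2.37 * ν q 1)) / 2 := by simp [hc]
  have up := h.unit p hp
  have uq := h.unit q hq
  have hpos := h.pos p c hp (by rw [h0, h1]; linarith)
  have hneg := h.neg q c hq (by rw [h0, h1]; linarith)
  linarith

/-- The normal is Lipschitz along the zero set. -/
theorem normal_sub_sq_le (h : TangentBalls g ν) {p q : Plane} (hp : g p = 0) (hq : g q = 0) :
    2.37 ^ 2 * ((ν p 0 - ν q 0) ^ 2 + (ν p 1 - ν q 1) ^ 2) ≤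
      (p 0 - q 0) ^ 2 + (p 1 - q 1) ^ 2 := by
  have h1 := h.le_dist_centers hp hq
  have h2 := h.le_dist_centers hq hp
  have up := h.unit p hp
  have uq := h.unit q hq
  linarith

/-- Nearest points are reached along normals. -/
theorem sub_nearest (h : TangentBalls g ν) {x p : Plane} {d : ℝ} (hx : 0 < g x) (hp : g p = 0)
    (hd : dist x p = d) (hmin : ∀ q, g q = 0 → d ≤ dist x q) :
    x 0 - p 0 = d * ν p 0 ∧ x 1 - p 1 = d * ν p 1 := by
  have hd0 : 0 < d := by
    rw [← hd, dist_pos]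
    rintro rfl
    exact hx.ne' hp
  have hball : ∀ z, dist z x < d → 0 < g z := by
    intro z hz
    by_contra! hneg
    obtain ⟨w, hw, hw0⟩ := (convex_ball x d).isPreconnected.intermediate_value
      (Metric.mem_ball.2 hz) (Metric.mem_ball_self hd0) h.cont.continuousOn ⟨hneg, hx.le⟩
    have := hmin w hw0
    rw [Metric.mem_ball, dist_comm] at hw
    linarith
  have up := h.unit p hp
  have hdsq : (x 0 - p 0) ^ 2 + (x 1 - p 1) ^ 2 = d ^ 2 := by rw [← plane_dist_sq, hd]
  set a := x 0 - p 0 with ha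
  set b := x 1 - p 1 with hb
  -- otherwise the two balls would have a common point
  have hge : (d + 2.37) ^ 2 ≤ (a + 2.37 * ν p 0) ^ 2 + (b + 2.37 * ν p 1) ^ 2 := by
    by_contra! hlt
    have hk : 0 < d + 2.37 := by linarith
    set k := d / (d + 2.37) with hkd
    have hk' : k * (d + 2.37) = d := by rw [hkd]; field_simp
    have hk0 : 0 < k := by positivity
    have hk1 : (1 - k) * (d + 2.37) = 2.37 := by linarith
    have hk10 : 0 < 1 - k := by
      by_contra! hcon
      nlinarith
    set c : Plane := !₂[x 0 - k * (a + 2.37 * ν p 0), x 1 - k * (b + 2.37 * ν p 1)] with hc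
    have h0 : c 0 = x 0 - k * (a + 2.37 * ν p 0) := by simp [hc]
    have h1 : c 1 = x 1 - k * (b + 2.37 * ν p 1) := by simp [hc]
    have hpos := hball c (by
      refine lt_of_pow_lt_pow_left₀ 2 hd0.le ?_
      rw [plane_dist_sq, h0, h1]
      have := mul_lt_mul_of_pos_left hlt (pow_pos hk0 2)
      rw [← mul_pow, hk'] at this
      linarith)
    have hneg := h.neg p c hp (by
      rw [h0, h1]
      have := mul_lt_mul_of_pos_left hlt (pow_pos hk10 2)
      rw [← mul_pow, hk1] at this
      have e0 : x 0 - k * (a + 2.37 * ν p 0) - p 0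
          = (1 - k) * (a + 2.37 * ν p 0) - 2.37 * ν p 0 := by rw [ha]; ring
      have e1 : x 1 - k * (b + 2.37 * ν p 1) - p 1
          = (1 - k) * (b + 2.37 * ν p 1) - 2.37 * ν p 1 := by rw [hb]; ring
      rw [e0, e1]
      nlinarith only [this, up])
    linarith
  have hin : d ≤ a * ν p 0 + b * ν p 1 := by nlinarith only [hge, up, hdsq]
  have hz : (a - d * ν p 0) ^ 2 + (b - d * ν p 1) ^ 2 ≤ 0 := by
    nlinarith only [hin, hd0, up, hdsq]
  constructor
  · nlinarith only [hz, sq_nonneg (a - d * ν p 0), sq_nonneg (b - d * ν p 1)]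
  · nlinarith only [hz, sq_nonneg (a - d * ν p 0), sq_nonneg (b - d * ν p 1)]

theorem nearest_unique_of_pos (h : TangentBalls g ν) {x p q : Plane} {d : ℝ} (hx : 0 < g x)
    (hp : g p = 0) (hd : dist x p = d) (hmin : ∀ q, g q = 0 → d ≤ dist x q) (hd2 : d < 2.37)
    (hq : g q = 0) (hdq : dist x q = d) : q = p := by
  obtain ⟨e0, e1⟩ := h.sub_nearest hx hp hd hmin
  have up := h.unit p hp
  have hsq : (x 0 - q 0) ^ 2 + (x 1 - q 1) ^ 2 = d ^ 2 := by rw [← plane_dist_sq, hdq]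
  have f0 : x 0 = p 0 + d * ν p 0 := by linarith
  have f1 : x 1 = p 1 + d * ν p 1 := by linarith
  rw [f0, f1] at hsq
  have hk : (q 0 - p 0) ^ 2 + (q 1 - p 1) ^ 2
      = 2 * d * ((q 0 - p 0) * ν p 0 + (q 1 - p 1) * ν p 1) := by
    linear_combination hsq - d ^ 2 * up
  have hle : ¬ ((q 0 - p 0) ^ 2 + (q 1 - p 1) ^ 2
      < 4.74 * ((q 0 - p 0) * ν p 0 + (q 1 - p 1) * ν p 1)) := fun hlt =>
    (h.pos p q hp hlt).ne' hq
  have hd0 : 0 ≤ d := hd ▸ dist_nonneg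
  have hzero : (q 0 - p 0) ^ 2 + (q 1 - p 1) ^ 2 ≤ 0 := by
    by_contra! hpos
    apply hle
    nlinarith
  have a0 : q 0 = p 0 := by nlinarith only [hzero, sq_nonneg (q 0 - p 0), sq_nonneg (q 1 - p 1)]
  have a1 : q 1 = p 1 := by nlinarith only [hzero, sq_nonneg (q 0 - p 0), sq_nonneg (q 1 - p 1)]
  ext i
  fin_cases i
  · exact a0
  · exact a1

theorem uniqueNearest (h : TangentBalls g ν) (hne : {p | g p = 0}.Nonempty) :
    UniqueNearest {p | g p = 0} 2.37 := by
  intro x hx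
  obtain ⟨p, hp, hd⟩ := h.compact.exists_infDist_eq_dist hne x
  refine ⟨p, ⟨hp, hd.symm⟩, ?_⟩
  rintro q ⟨hq, hqd⟩
  have hmin : ∀ q, g q = 0 → Metric.infDist x {p | g p = 0} ≤ dist x q := fun q hq =>
    Metric.infDist_le_dist_of_mem (show q ∈ {p | g p = 0} from hq)
  have hp' : g p = 0 := hp
  have hq' : g q = 0 := hq
  rcases lt_trichotomy (g x) 0 with h0 | h0 | h0
  · exact h.negate.nearest_unique_of_pos (x := x) (by simpa using h0) (by simpa using hp') hd.symm
      (fun q hq => hmin q (by simpa using hq)) hx (by simpa using hq') hqd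
  · have hz : Metric.infDist x {p | g p = 0} = 0 := Metric.infDist_zero_of_mem h0
    rw [hz] at hd hqd
    rw [← dist_eq_zero.1 hd.symm, ← dist_eq_zero.1 hqd]
  · exact h.nearest_unique_of_pos h0 hp' hd.symm hmin hx hq' hqd

end TangentBalls

/-- The direction obtained from a vector by cutting off small coordinates. -/
def cutDirection (u : Plane) : Plane := !₂[cutoff |u 0| * u 0, cutoff |u 1| * u 1]

@[simp] theorem cutDirection_zero (u : Plane) : cutDirection u 0 = cutoff |u 0| * u 0 := by
  simp [cutDirection]

@[simp] theorem cutDirection_one (u : Plane) : cutDirection u 1 = cutoff |u 1| * u 1 := by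
  simp [cutDirection]

theorem cutDirection_neg (u : Plane) : cutDirection (-u) = -cutDirection u := by
  ext i
  fin_cases i <;> simp

theorem continuous_cutDirection : Continuous cutDirection := by
  have := continuous_cutoff
  unfold cutDirection
  fun_prop

/-- `x` is at distance `d ≤ √2` on the positive side of the zero set, and `p` is nearest to `x`. -/
structure Foot (g : Plane → ℝ) (ν : Plane → Plane) (x p : Plane) (d : ℝ) : Prop where
  balls : TangentBalls g ν
  pos : 0 < g x
  zero : g p = 0
  dpos : 0 < d
  dle : d ^ 2 ≤ 2
  eq0 : x 0 = p 0 + d * ν p 0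
  eq1 : x 1 = p 1 + d * ν p 1

namespace Foot

variable {g : Plane → ℝ} {ν : Plane → Plane} {x p : Plane} {d : ℝ}

/-- The squared length and the normal component of the cut direction. -/
theorem direction_bounds (F : Foot g ν x p d) :
    3 / 4 ≤ cutDirection (ν p) 0 * ν p 0 + cutDirection (ν p) 1 * ν p 1 ∧
    cutDirection (ν p) 0 ^ 2 + cutDirection (ν p) 1 ^ 2
      ≤ cutDirection (ν p) 0 * ν p 0 + cutDirection (ν p) 1 * ν p 1 ∧
    cutDirection (ν p) 0 * ν p 0 + cutDirection (ν p) 1 * ν p 1 ≤ 1 := by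
  have up := F.balls.unit p F.zero
  have h1 := cutoff_inner_bound (abs_nonneg (ν p 0)) (abs_nonneg (ν p 1))
    (by rw [sq_abs, sq_abs]; exact up)
  rw [sq_abs, sq_abs] at h1
  have a0 := cutoff_nonneg |ν p 0|
  have a1 := cutoff_le_one |ν p 0|
  have b0 := cutoff_nonneg |ν p 1|
  have b1 := cutoff_le_one |ν p 1|
  simp only [cutDirection_zero, cutDirection_one]
  set l := cutoff |ν p 0|
  set m := cutoff |ν p 1|
  have c0 : l ^ 2 * ν p 0 ^ 2 ≤ l * ν p 0 ^ 2 := by gcongr; nlinarith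
  have c1 : m ^ 2 * ν p 1 ^ 2 ≤ m * ν p 1 ^ 2 := by gcongr; nlinarith
  have d0 : l * ν p 0 ^ 2 ≤ ν p 0 ^ 2 := mul_le_of_le_one_left (sq_nonneg _) a1
  have d1 : m * ν p 1 ^ 2 ≤ ν p 1 ^ 2 := mul_le_of_le_one_left (sq_nonneg _) b1
  refine ⟨?_, ?_, ?_⟩ <;> linarith

theorem d_le (F : Foot g ν x p d) : d ≤ 1.4143 := by nlinarith [F.dpos, F.dle]

/-- The point reached from `x` at time `t`, against the normal. -/
def move (ν : Plane → Plane) (x p : Plane) (t : ℝ) : Plane := x - t • cutDirection (ν p)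

@[simp] theorem move_zero (t : ℝ) : move ν x p t 0 = x 0 - t * cutDirection (ν p) 0 := by
  simp [move]

@[simp] theorem move_one (t : ℝ) : move ν x p t 1 = x 1 - t * cutDirection (ν p) 1 := by
  simp [move]

theorem continuous_move (ν : Plane → Plane) (x p : Plane) : Continuous (move ν x p) := by
  unfold move; fun_prop

theorem pos_of_lt (F : Foot g ν x p d) {t : ℝ} (ht0 : 0 ≤ t) (ht : t < d) :
    0 < g (move ν x p t) := by
  obtain ⟨h1, h2, h3⟩ := F.direction_bounds
  have up := F.balls.unit p F.zero
  have hd := F.d_le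
  have hd0 := F.dpos
  apply F.balls.pos p _ F.zero
  rw [move_zero, move_one, F.eq0, F.eq1]
  set a := cutDirection (ν p) 0
  set b := cutDirection (ν p) 1
  set k := a * ν p 0 + b * ν p 1 with hk
  have e1 : (p 0 + d * ν p 0 - t * a - p 0) ^ 2 + (p 1 + d * ν p 1 - t * b - p 1) ^ 2
      = d ^ 2 - 2 * d * t * k + t ^ 2 * (a ^ 2 + b ^ 2) := by
    rw [hk]; linear_combination d ^ 2 * up
  have e2 : (p 0 + d * ν p 0 - t * a - p 0) * ν p 0 + (p 1 + d * ν p 1 - t * b - p 1) * ν p 1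
      = d - t * k := by
    rw [hk]; linear_combination d * up
  rw [e1, e2]
  have h4 : t ^ 2 * (a ^ 2 + b ^ 2) ≤ t ^ 2 * k := by gcongr
  have h5 : 0 < d - t * k := by nlinarith
  have h6 : d ^ 2 - 2 * d * t * k + t ^ 2 * k ≤ d * (d - t * k) := by
    have : 0 ≤ t * k * (d - t) := by
      apply mul_nonneg (mul_nonneg ht0 (by linarith)) (by linarith)
    linarith
  nlinarith

theorem neg_at_end (F : Foot g ν x p d) : g (move ν x p (1.6 * d)) < 0 := by
  obtain ⟨h1, h2, h3⟩ := F.direction_bounds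
  have up := F.balls.unit p F.zero
  have hd := F.d_le
  have hd0 := F.dpos
  apply F.balls.neg p _ F.zero
  rw [move_zero, move_one, F.eq0, F.eq1]
  set a := cutDirection (ν p) 0
  set b := cutDirection (ν p) 1
  set k := a * ν p 0 + b * ν p 1 with hk
  have e1 : (p 0 + d * ν p 0 - 1.6 * d * a - p 0) ^ 2 + (p 1 + d * ν p 1 - 1.6 * d * b - p 1) ^ 2
      = d ^ 2 * (1 - 3.2 * k + 2.56 * (a ^ 2 + b ^ 2)) := by
    rw [hk]; linear_combination d ^ 2 * up
  have e2 : (p 0 + d * ν p 0 - 1.6 * d * a - p 0) * ν p 0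
      + (p 1 + d * ν p 1 - 1.6 * d * b - p 1) * ν p 1 = d * (1 - 1.6 * k) := by
    rw [hk]; linear_combination d * up
  rw [e1, e2]
  have h4 : d ^ 2 * (1 - 3.2 * k + 2.56 * (a ^ 2 + b ^ 2)) ≤ d ^ 2 * 0.52 := by
    gcongr; linarith
  have h5 : 0.2 * d ≤ d * (1.6 * k - 1) := by nlinarith
  nlinarith

/-- After the first hit, the path stays in the negative region. -/
theorem neg_after_zero (F : Foot g ν x p d) {t t' : ℝ} (ht0 : 0 ≤ t)
    (hz : g (move ν x p t) = 0) (htt : t < t') (ht' : t' ≤ 1.6 * d) : g (move ν x p t') < 0 := by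
  obtain ⟨h1, h2, h3⟩ := F.direction_bounds
  have up := F.balls.unit p F.zero
  have hd := F.d_le
  have hd0 := F.dpos
  have htd : d ≤ t := by
    by_contra! hlt
    exact (F.pos_of_lt ht0 hlt).ne' hz
  have hnorm := F.balls.normal_sub_sq_le F.zero hz
  apply F.balls.neg _ _ hz
  set q := move ν x p t with hq
  have q0 : q 0 = x 0 - t * cutDirection (ν p) 0 := by rw [hq, move_zero]
  have q1 : q 1 = x 1 - t * cutDirection (ν p) 1 := by rw [hq, move_one]
  rw [move_zero, move_one]
  have a0 : x 0 - t' * cutDirection (ν p) 0 - q 0 = -((t' - t) * cutDirection (ν p) 0) := by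
    rw [q0]; ring
  have a1 : x 1 - t' * cutDirection (ν p) 1 - q 1 = -((t' - t) * cutDirection (ν p) 1) := by
    rw [q1]; ring
  rw [a0, a1]
  rw [q0, q1, F.eq0, F.eq1] at hnorm
  set a := cutDirection (ν p) 0
  set b := cutDirection (ν p) 1
  set k := a * ν p 0 + b * ν p 1 with hk
  set c := a * (ν p 0 - ν q 0) + b * (ν p 1 - ν q 1) with hc
  have e1 : (p 0 - (p 0 + d * ν p 0 - t * a)) ^ 2 + (p 1 - (p 1 + d * ν p 1 - t * b)) ^ 2
      = d ^ 2 - 2 * d * t * k + t ^ 2 * (a ^ 2 + b ^ 2) := by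
    rw [hk]; linear_combination d ^ 2 * up
  rw [e1] at hnorm
  have h4 : t ^ 2 * (a ^ 2 + b ^ 2) ≤ t ^ 2 * k := by gcongr
  have h5 : d ^ 2 - 2 * d * t * k + t ^ 2 * k ≤ d ^ 2 * 0.52 := by
    have e : d ^ 2 - 2 * d * t * k + t ^ 2 * k = k * (t - d) ^ 2 + d ^ 2 * (1 - k) := by ring
    rw [e]
    have : (t - d) ^ 2 ≤ (0.6 * d) ^ 2 := by
      apply pow_le_pow_left₀ <;> linarith
    have h7 := mul_le_mul_of_nonneg_left this (show 0 ≤ k by linarith)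
    have h8 := mul_le_mul_of_nonneg_left h1 (sq_nonneg d)
    linarith
  have h6 : 2.37 ^ 2 * ((ν p 0 - ν q 0) ^ 2 + (ν p 1 - ν q 1) ^ 2) ≤ 1.04 := by
    have := F.dle
    linarith
  have hcs : c ^ 2 ≤ (a ^ 2 + b ^ 2) * ((ν p 0 - ν q 0) ^ 2 + (ν p 1 - ν q 1) ^ 2) := by
    rw [hc]
    nlinarith only [sq_nonneg (a * (ν p 1 - ν q 1) - b * (ν p 0 - ν q 0))]
  have hc2 : c ^ 2 ≤ k * 0.1852 := by
    refine hcs.trans (mul_le_mul h2 (by linarith) (by positivity) (by linarith))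
  have hck : c ≤ 0.5 * k := by
    refine le_of_sq_le_sq ?_ (by linarith)
    nlinarith only [hc2, h1]
  have hin : 0.5 * k ≤ a * ν q 0 + b * ν q 1 := by
    have : a * ν q 0 + b * ν q 1 = k - c := by rw [hk, hc]; ring
    linarith
  have hs : 0 < t' - t := by linarith
  have hs1 : t' - t ≤ 0.85 := by linarith
  set s := t' - t
  have h9 : s * (a ^ 2 + b ^ 2) ≤ 0.85 * k := mul_le_mul hs1 h2 (by positivity) (by norm_num)
  have h10 : s * (s * (a ^ 2 + b ^ 2)) < s * (4.74 * (a * ν q 0 + b * ν q 1)) := by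
    apply mul_lt_mul_of_pos_left _ hs
    linarith
  linarith

theorem exists_unique_hit (F : Foot g ν x p d) :
    ∃ t, (0 < t ∧ t ≤ 1.6 * d ∧ g (move ν x p t) = 0) ∧
      ∀ t', 0 ≤ t' → t' ≤ 1.6 * d → g (move ν x p t') = 0 → t' = t := by
  have hd0 := F.dpos
  have hc : ContinuousOn (fun t => g (move ν x p t)) (Set.Icc 0 (1.6 * d)) :=
    (F.balls.cont.comp (continuous_move ν x p)).continuousOn
  have h0 : g (move ν x p 0) = g x := by simp [move]
  obtain ⟨t, ⟨ht0, ht1⟩, ht⟩ := intermediate_value_Icc' (by linarith) hc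
    (show (0 : ℝ) ∈ Set.Icc _ _ from ⟨F.neg_at_end.le, by rw [h0]; exact F.pos.le⟩)
  have ht : g (move ν x p t) = 0 := ht
  refine ⟨t, ⟨lt_of_le_of_ne ht0 ?_, ht1, ht⟩, ?_⟩
  · rintro rfl
    rw [h0] at ht
    exact F.pos.ne' ht
  · intro t' h1 h2 h3
    rcases lt_trichotomy t' t with h | h | h
    · exact absurd ht (F.neg_after_zero h1 h3 h ht1).ne
    · exact h
    · exact absurd h3 (F.neg_after_zero ht0 ht h h2).ne

end Foot

/-! ### Cells of the integer grid -/

/-- The closed unit square with lower left vertex `(i, j)`. -/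
def unitCell (i j : ℤ) : Set Plane :=
  {p | p 0 ∈ Set.Icc (i : ℝ) (i + 1) ∧ p 1 ∈ Set.Icc (j : ℝ) (j + 1)}

theorem isClosed_unitCell (i j : ℤ) : IsClosed (unitCell i j) := by
  unfold unitCell
  exact (isClosed_Icc.preimage (by fun_prop : Continuous fun p : Plane => p 0)).inter
    (isClosed_Icc.preimage (by fun_prop : Continuous fun p : Plane => p 1))

theorem convex_unitCell (i j : ℤ) : Convex ℝ (unitCell i j) := by
  have h0 : IsLinearMap ℝ (fun p : Plane => p 0) := ⟨fun _ _ => rfl, fun _ _ => rfl⟩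
  have h1 : IsLinearMap ℝ (fun p : Plane => p 1) := ⟨fun _ _ => rfl, fun _ _ => rfl⟩
  exact ((convex_Icc _ _).is_linear_preimage h0).inter ((convex_Icc _ _).is_linear_preimage h1)

/-- The union of the cells of the `n × n` grid which meet `Z`. -/
def cellUnion (Z : Set Plane) (n : ℤ) : Set Plane :=
  {p | ∃ i j : ℤ, (0 ≤ i ∧ i < n) ∧ (0 ≤ j ∧ j < n) ∧ (unitCell i j ∩ Z).Nonempty ∧
    p ∈ unitCell i j}

theorem isClosed_cellUnion (Z : Set Plane) (n : ℤ) : IsClosed (cellUnion Z n) := by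
  have : cellUnion Z n = ⋃ q ∈ {q : ℤ × ℤ | q ∈ Set.Ico 0 n ×ˢ Set.Ico 0 n ∧
      (unitCell q.1 q.2 ∩ Z).Nonempty}, unitCell q.1 q.2 := by
    ext p
    simp only [cellUnion, Set.mem_ofPred_eq, Set.mem_iUnion, Prod.exists, Set.mem_prod, Set.mem_Ico,
      exists_prop]
    constructor
    · rintro ⟨i, j, hi, hj, hne, hp⟩
      exact ⟨i, j, ⟨⟨hi, hj⟩, hne⟩, hp⟩
    · rintro ⟨i, j, ⟨⟨hi, hj⟩, hne⟩, hp⟩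
      exact ⟨i, j, hi, hj, hne, hp⟩
  rw [this]
  refine Set.Finite.isClosed_biUnion ?_ fun q _ => isClosed_unitCell _ _
  exact ((Set.finite_Ico 0 n).prod (Set.finite_Ico 0 n)).subset fun q hq => hq.1

/-- In one coordinate: the next interval met when leaving `y` with velocity `σ w`. -/
theorem exists_next_interval {i n : ℤ} (hi0 : 0 ≤ i) (hin : i < n) {y σ w : ℝ}
    (hy : y ∈ Set.Icc (i : ℝ) (i + 1)) (hσ : σ = 1 ∨ σ = -1) (hw : 0 ≤ w)
    (hup : 0 < w → σ = 1 → y < n) (hdown : 0 < w → σ = -1 → 0 < y) :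
    ∃ i' : ℤ, (0 ≤ i' ∧ i' < n) ∧
      (∃ ε > 0, ∀ s, 0 ≤ s → s ≤ ε → y + s * (σ * w) ∈ Set.Icc (i' : ℝ) (i' + 1)) ∧
      ((0 < w ∧ (∀ z ∈ Set.Icc (i : ℝ) (i + 1), -1 ≤ σ * (z - y) ∧ σ * (z - y) ≤ 0) ∧
          ∀ t, 0 ≤ t → t ≤ 1 → y + σ * t ∈ Set.Icc (i' : ℝ) (i' + 1)) ∨
        (i' = i ∧ ∃ Y, (0 ≤ Y ∧ Y ≤ 1) ∧
          (∀ z ∈ Set.Icc (i : ℝ) (i + 1), Y - 1 ≤ σ * (z - y) ∧ σ * (z - y) ≤ Y) ∧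
          ∀ t, Y - 1 ≤ t → t ≤ Y → y + σ * t ∈ Set.Icc (i : ℝ) (i + 1))) := by
  obtain ⟨hy0, hy1⟩ := hy
  have hsame : ∃ Y : ℝ, (0 ≤ Y ∧ Y ≤ 1) ∧
      (∀ z ∈ Set.Icc (i : ℝ) (i + 1), Y - 1 ≤ σ * (z - y) ∧ σ * (z - y) ≤ Y) ∧
      ∀ t, Y - 1 ≤ t → t ≤ Y → y + σ * t ∈ Set.Icc (i : ℝ) (i + 1) := by
    rcases hσ with rfl | rfl
    · refine ⟨i + 1 - y, ⟨by linarith, by linarith⟩, fun z hz => ?_, fun t h1 h2 => ?_⟩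
      · exact ⟨by linarith [hz.1], by linarith [hz.2]⟩
      · exact ⟨by linarith, by linarith⟩
    · refine ⟨y - i, ⟨by linarith, by linarith⟩, fun z hz => ?_, fun t h1 h2 => ?_⟩
      · exact ⟨by linarith [hz.2], by linarith [hz.1]⟩
      · exact ⟨by linarith, by linarith⟩
  rcases hw.eq_or_lt with hw0 | hw0
  · refine ⟨i, ⟨hi0, hin⟩, ⟨1, one_pos, fun s _ _ => ?_⟩, Or.inr ⟨rfl, hsame⟩⟩
    rw [← hw0, mul_zero, mul_zero, add_zero]
    exact ⟨hy0, hy1⟩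
  · rcases hσ with rfl | rfl
    · rcases hy1.eq_or_lt with he | hlt
      · have hyn := hup hw0 rfl
        have hin' : i + 1 < n := by
          rw [he] at hyn; exact_mod_cast hyn
        refine ⟨i + 1, ⟨by omega, hin'⟩, ⟨1 / w, by positivity, fun s h1 h2 => ?_⟩,
          Or.inl ⟨hw0, fun z hz => ⟨by linarith [hz.1], by linarith [hz.2]⟩,
            fun t h1 h2 => ?_⟩⟩
        · have : s * w ≤ 1 := by rwa [le_div_iff₀ hw0] at h2
          have := mul_nonneg h1 hw0.le
          push_cast
          constructor <;> linarith
        · push_cast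
          constructor <;> linarith
      · refine ⟨i, ⟨hi0, hin⟩, ⟨(i + 1 - y) / w, div_pos (by linarith) hw0, fun s h1 h2 => ?_⟩,
          Or.inr ⟨rfl, hsame⟩⟩
        rw [le_div_iff₀ hw0] at h2
        have := mul_nonneg h1 hw0.le
        constructor <;> linarith
    · rcases hy0.eq_or_lt with he | hlt
      · have hyn := hdown hw0 rfl
        have hin' : 0 < i := by
          rw [← he] at hyn; exact_mod_cast hyn
        refine ⟨i - 1, ⟨by omega, by omega⟩, ⟨1 / w, by positivity, fun s h1 h2 => ?_⟩,
          Or.inl ⟨hw0, fun z hz => ⟨by linarith [hz.2], by linarith [hz.1]⟩,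
            fun t h1 h2 => ?_⟩⟩
        · have : s * w ≤ 1 := by rwa [le_div_iff₀ hw0] at h2
          have := mul_nonneg h1 hw0.le
          push_cast
          constructor <;> linarith
        · push_cast
          constructor <;> linarith
      · refine ⟨i, ⟨hi0, hin⟩, ⟨(y - i) / w, div_pos (by linarith) hw0, fun s h1 h2 => ?_⟩,
          Or.inr ⟨rfl, hsame⟩⟩
        rw [le_div_iff₀ hw0] at h2
        have := mul_nonneg h1 hw0.le
        constructor <;> linarith

namespace Foot

variable {g : Plane → ℝ} {ν : Plane → Plane} {x p : Plane} {d : ℝ}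

/-- If the path towards the zero set leaves a cell which meets the zero set, then the next cell
meets the zero set as well. -/
theorem next_cell (F : Foot g ν x p d) {n : ℤ}
    (hZ : ∀ q, g q = 0 → (0 ≤ q 0 ∧ q 0 ≤ n) ∧ (0 ≤ q 1 ∧ q 1 ≤ n)) {T τ : ℝ} (hT : T ≤ 1.6 * d)
    (hz : g (move ν x p T) = 0) (hτ0 : 0 ≤ τ) (hτT : τ < T) (hpos : 0 < g (move ν x p τ))
    (hy : move ν x p τ ∈ cellUnion {q | g q = 0} n) :
    ∃ ε > 0, ∀ s, 0 ≤ s → s ≤ ε → move ν x p (τ + s) ∈ cellUnion {q | g q = 0} n := by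
  obtain ⟨i, j, hi, hj, ⟨q, hq, hq0⟩, hyc⟩ := hy
  have hq0 : g q = 0 := hq0
  have up := F.balls.unit p F.zero
  set y := move ν x p τ with hydef
  have y0 : y 0 = x 0 - τ * (cutoff |ν p 0| * ν p 0) := by rw [hydef, move_zero, cutDirection_zero]
  have y1 : y 1 = x 1 - τ * (cutoff |ν p 1| * ν p 1) := by rw [hydef, move_one, cutDirection_one]
  obtain ⟨σ, hσ, hσu⟩ : ∃ σ : ℝ, (σ = 1 ∨ σ = -1) ∧ -ν p 0 = σ * |ν p 0| := by
    rcases le_total 0 (ν p 0) with h | h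
    · exact ⟨-1, Or.inr rfl, by rw [abs_of_nonneg h]; ring⟩
    · exact ⟨1, Or.inl rfl, by rw [abs_of_nonpos h]; ring⟩
  obtain ⟨ρ, hρ, hρu⟩ : ∃ ρ : ℝ, (ρ = 1 ∨ ρ = -1) ∧ -ν p 1 = ρ * |ν p 1| := by
    rcases le_total 0 (ν p 1) with h | h
    · exact ⟨-1, Or.inr rfl, by rw [abs_of_nonneg h]; ring⟩
    · exact ⟨1, Or.inl rfl, by rw [abs_of_nonpos h]; ring⟩
  have hσσ : σ * σ = 1 := by rcases hσ with rfl | rfl <;> norm_num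
  have hρρ : ρ * ρ = 1 := by rcases hρ with rfl | rfl <;> norm_num
  set u := |ν p 0| with hu
  set v := |ν p 1| with hv
  have hu0 : 0 ≤ u := abs_nonneg _
  have hv0 : 0 ≤ v := abs_nonneg _
  have huv : u ^ 2 + v ^ 2 = 1 := by rw [hu, hv, sq_abs, sq_abs]; exact up
  have eu : ν p 0 = -(σ * u) := by linarith
  have ev : ν p 1 = -(ρ * v) := by linarith
  have hlu := cutoff_nonneg u
  have hlv := cutoff_nonneg v
  have zT := hZ _ hz
  rw [move_zero, move_one, cutDirection_zero, cutDirection_one, ← hu, ← hv, eu, ev] at zT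
  rw [eu] at y0
  rw [ev] at y1
  have hTτ : 0 < T - τ := by linarith
  obtain ⟨i', hi', ⟨ε₁, hε₁, hin₁⟩, hcase₁⟩ := exists_next_interval (n := n) hi.1 hi.2 hyc.1 hσ
    (mul_nonneg hlu hu0)
    (fun hw h1 => by
      subst h1
      have := mul_pos hTτ hw
      linarith [zT.1.2])
    (fun hw h1 => by
      subst h1
      have := mul_pos hTτ hw
      linarith [zT.1.1])
  obtain ⟨j', hj', ⟨ε₂, hε₂, hin₂⟩, hcase₂⟩ := exists_next_interval (n := n) hj.1 hj.2 hyc.2 hρ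
    (mul_nonneg hlv hv0)
    (fun hw h1 => by
      subst h1
      have := mul_pos hTτ hw
      linarith [zT.2.2])
    (fun hw h1 => by
      subst h1
      have := mul_pos hTτ hw
      linarith [zT.2.1])
  -- it remains to see that the new cell meets the zero set
  suffices hmeet : (unitCell i' j' ∩ {q | g q = 0}).Nonempty by
    refine ⟨min ε₁ ε₂, lt_min hε₁ hε₂, fun s h0 h1 => ⟨i', j', hi', hj', hmeet, ?_, ?_⟩⟩
    · have := hin₁ s h0 (h1.trans (min_le_left _ _))
      have e : move ν x p (τ + s) 0 = y 0 + s * (σ * (cutoff u * u)) := by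
        rw [move_zero, cutDirection_zero, ← hu, eu, y0]; ring
      rwa [e]
    · have := hin₂ s h0 (h1.trans (min_le_right _ _))
      have e : move ν x p (τ + s) 1 = y 1 + s * (ρ * (cutoff v * v)) := by
        rw [move_one, cutDirection_one, ← hv, ev, y1]; ring
      rwa [e]
  by_contra hempty
  have hyc' : y ∈ unitCell i' j' := by
    have h1 := hin₁ 0 le_rfl hε₁.le
    have h2 := hin₂ 0 le_rfl hε₂.le
    rw [zero_mul, add_zero] at h1 h2
    exact ⟨h1, h2⟩
  have hcpos : ∀ z ∈ unitCell i' j', 0 < g z := by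
    intro z hzc
    by_contra! hneg
    obtain ⟨w, hw, hw0⟩ := (convex_unitCell i' j').isPreconnected.intermediate_value
      hzc hyc' F.balls.cont.continuousOn ⟨hneg, hpos.le⟩
    exact hempty ⟨w, hw, hw0⟩
  set g₁ := (d - cutoff u * τ) * u with hg₁
  set g₂ := (d - cutoff v * τ) * v with hg₂
  have p0 : p 0 - y 0 = σ * g₁ := by rw [y0, F.eq0, eu, hg₁]; ring
  have p1 : p 1 - y 1 = ρ * g₂ := by rw [y1, F.eq1, ev, hg₂]; ring
  have hB : 4.74 * ((g₁ - σ * (q 0 - y 0)) * u + (g₂ - ρ * (q 1 - y 1)) * v)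
      ≤ (g₁ - σ * (q 0 - y 0)) ^ 2 + (g₂ - ρ * (q 1 - y 1)) ^ 2 := by
    by_contra! hlt
    refine (F.balls.pos p q F.zero ?_).ne' hq0
    have e0 : q 0 - p 0 = -(σ * (g₁ - σ * (q 0 - y 0))) := by
      linear_combination -p0 + (y 0 - q 0) * hσσ
    have e1 : q 1 - p 1 = -(ρ * (g₂ - ρ * (q 1 - y 1))) := by
      linear_combination -p1 + (y 1 - q 1) * hρρ
    rw [e0, e1, eu, ev]
    set A := g₁ - σ * (q 0 - y 0)
    set B := g₂ - ρ * (q 1 - y 1)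
    have f1 : (-(σ * A)) ^ 2 + (-(ρ * B)) ^ 2 = A ^ 2 + B ^ 2 := by
      linear_combination A ^ 2 * hσσ + B ^ 2 * hρρ
    have f2 : -(σ * A) * -(σ * u) + -(ρ * B) * -(ρ * v) = A * u + B * v := by
      linear_combination A * u * hσσ + B * v * hρρ
    rw [f1, f2]
    exact hlt
  have hG : ∀ s t, y 0 + σ * s ∈ Set.Icc (i' : ℝ) (i' + 1) →
      y 1 + ρ * t ∈ Set.Icc (j' : ℝ) (j' + 1) →
      4.74 * ((s - g₁) * u + (t - g₂) * v) ≤ (s - g₁) ^ 2 + (t - g₂) ^ 2 := by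
    intro s t hs ht
    by_contra! hlt
    have hmem : (!₂[y 0 + σ * s, y 1 + ρ * t] : Plane) ∈ unitCell i' j' := by
      constructor
      · simpa using hs
      · simpa using ht
    refine (F.balls.neg p _ F.zero ?_).not_gt (hcpos _ hmem)
    have e0 : (!₂[y 0 + σ * s, y 1 + ρ * t] : Plane) 0 - p 0 = σ * (s - g₁) := by
      simp; linear_combination -p0
    have e1 : (!₂[y 0 + σ * s, y 1 + ρ * t] : Plane) 1 - p 1 = ρ * (t - g₂) := by
      simp; linear_combination -p1
    rw [e0, e1, eu, ev]
    have f1 : (σ * (s - g₁)) ^ 2 + (ρ * (t - g₂)) ^ 2 = (s - g₁) ^ 2 + (t - g₂) ^ 2 := by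
      linear_combination (s - g₁) ^ 2 * hσσ + (t - g₂) ^ 2 * hρρ
    have f2 : -(4.74 * (σ * (s - g₁) * -(σ * u) + ρ * (t - g₂) * -(ρ * v)))
        = 4.74 * ((s - g₁) * u + (t - g₂) * v) := by
      linear_combination 4.74 * (s - g₁) * u * hσσ + 4.74 * (t - g₂) * v * hρρ
    rw [f1, f2]
    exact hlt
  have hτd : τ ≤ 1.6 * d := by linarith
  have hcut : ∀ {a : ℝ}, 0 ≤ a → 0 < cutoff a * a → 0 < cutoff a := fun ha h =>
    pos_of_mul_pos_left h ha
  rcases hcase₁ with ⟨hw₁, hb₁, hc₁⟩ | ⟨rfl, Y, hY, hb₁, hc₁⟩ <;>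
    rcases hcase₂ with ⟨hw₂, hb₂, hc₂⟩ | ⟨rfl, X, hX, hb₂, hc₂⟩
  · obtain ⟨a1, a2⟩ := hb₁ _ hq.1
    obtain ⟨b1, b2⟩ := hb₂ _ hq.2
    refine no_corner_crossing hu0 hv0 huv F.dpos F.dle hτ0 hτd (hcut hu0 hw₁) (hcut hv0 hw₂)
      hg₁ hg₂ ?_ (α := -(σ * (q 0 - y 0))) (β := -(ρ * (q 1 - y 1))) (by linarith) (by linarith)
      (by linarith) (by linarith) ?_ fun s t h1 h2 h3 h4 => hG s t (hc₁ s h1 h2) (hc₂ t h3 h4)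
    · by_contra! hle
      have z1 : g₁ = 0 := by nlinarith only [hle, sq_nonneg g₁, sq_nonneg g₂]
      have z2 : g₂ = 0 := by nlinarith only [hle, sq_nonneg g₁, sq_nonneg g₂]
      have : y = p := by
        ext k
        fin_cases k
        · simp only [Fin.zero_eta]; rw [z1] at p0; linarith
        · simp only [Fin.mk_one]; rw [z2] at p1; linarith
      rw [this] at hpos
      exact hpos.ne' F.zero
    · convert hB using 3 <;> ring
  · obtain ⟨a1, a2⟩ := hb₁ _ hq.1
    obtain ⟨b1, b2⟩ := hb₂ _ hq.2
    refine no_edge_crossing hu0 hv0 huv F.dpos F.dle hτ0 hτd (hcut hu0 hw₁)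
      hg₁ hg₂ (α := -(σ * (q 0 - y 0))) (Y' := ρ * (q 1 - y 1)) (Y := X) (by linarith)
      (by linarith) hX.1 hX.2 b1 b2 ?_ fun s t h1 h2 h3 h4 => hG s t (hc₁ s h1 h2) (hc₂ t h3 h4)
    convert hB using 3 <;> ring
  · obtain ⟨a1, a2⟩ := hb₁ _ hq.1
    obtain ⟨b1, b2⟩ := hb₂ _ hq.2
    refine no_edge_crossing hv0 hu0 (by linarith) F.dpos F.dle hτ0 hτd (hcut hv0 hw₂)
      hg₂ hg₁ (α := -(ρ * (q 1 - y 1))) (Y' := σ * (q 0 - y 0)) (Y := Y) (by linarith)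
      (by linarith) hY.1 hY.2 a1 a2 ?_ fun s t h1 h2 h3 h4 => by
        have := hG t s (hc₁ t h3 h4) (hc₂ s h1 h2)
        linarith
    linarith
  · exact hempty ⟨q, hq, hq0⟩

theorem path_mem (F : Foot g ν x p d) {n : ℤ}
    (hZ : ∀ q, g q = 0 → (0 ≤ q 0 ∧ q 0 ≤ n) ∧ (0 ≤ q 1 ∧ q 1 ≤ n)) {T : ℝ}
    (hT : T ≤ 1.6 * d) (hz : g (move ν x p T) = 0) (hx : x ∈ cellUnion {q | g q = 0} n) {t : ℝ}
    (ht0 : 0 ≤ t) (htT : t ≤ T) : move ν x p t ∈ cellUnion {q | g q = 0} n := by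
  have hclosed : IsClosed ({t | move ν x p t ∈ cellUnion {q | g q = 0} n} ∩ Set.Icc 0 T) :=
    ((isClosed_cellUnion _ n).preimage (continuous_move ν x p)).inter isClosed_Icc
  refine hclosed.Icc_subset_of_forall_mem_nhdsWithin (by simpa [move] using hx) ?_ ⟨ht0, htT⟩
  rintro τ ⟨hτ, hτ0, hτT⟩
  have hpos : 0 < g (move ν x p τ) := by
    by_contra! hneg
    rcases hneg.eq_or_lt with h | h
    · exact (F.neg_after_zero hτ0 h hτT hT).ne hz
    · have hc : ContinuousOn (fun t => g (move ν x p t)) (Set.Icc 0 τ) :=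
        (F.balls.cont.comp (continuous_move ν x p)).continuousOn
      have h0 : g (move ν x p 0) = g x := by simp [move]
      obtain ⟨t', ⟨h1, h2⟩, h3⟩ := intermediate_value_Icc' hτ0 hc
        (show (0 : ℝ) ∈ Set.Icc _ _ from ⟨h.le, by rw [h0]; exact F.pos.le⟩)
      exact (F.neg_after_zero h1 h3 (h2.trans_lt hτT) hT).ne hz
  obtain ⟨ε, hε, hmem⟩ := F.next_cell hZ hT hz hτ0 hτT hpos hτ
  refine mem_nhdsGT_iff_exists_Ioc_subset.2 ⟨τ + ε, by simpa using hε, fun s hs => ?_⟩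
  have := hmem (s - τ) (by linarith [hs.1]) (by linarith [hs.2])
  rwa [add_sub_cancel] at this

end Foot

namespace TangentBalls

variable {g : Plane → ℝ} {ν : Plane → Plane}

theorem infDist_sq_le {Z : Set Plane} {n : ℤ} {x : Plane} (hx : x ∈ cellUnion Z n) :
    Metric.infDist x Z ^ 2 ≤ 2 := by
  obtain ⟨i, j, -, -, ⟨q, hq, hqZ⟩, hxc⟩ := hx
  have h1 : Metric.infDist x Z ≤ dist x q := Metric.infDist_le_dist_of_mem hqZ
  have h2 : Metric.infDist x Z ^ 2 ≤ dist x q ^ 2 := by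
    gcongr
    exact Metric.infDist_nonneg
  rw [plane_dist_sq] at h2
  have a : (x 0 - q 0) ^ 2 ≤ 1 := by
    rw [sq_le_one_iff_abs_le_one, abs_le]
    constructor <;> linarith [hq.1.1, hq.1.2, hxc.1.1, hxc.1.2]
  have b : (x 1 - q 1) ^ 2 ≤ 1 := by
    rw [sq_le_one_iff_abs_le_one, abs_le]
    constructor <;> linarith [hq.2.1, hq.2.2, hxc.2.1, hxc.2.2]
  linarith

theorem foot (h : TangentBalls g ν) {n : ℤ} {x p : Plane} (hx : x ∈ cellUnion {q | g q = 0} n)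
    (hpos : 0 < g x) (hp : g p = 0) (hd : Metric.infDist x {q | g q = 0} = dist x p) :
    Foot g ν x p (Metric.infDist x {q | g q = 0}) := by
  obtain ⟨e0, e1⟩ := h.sub_nearest hpos hp hd.symm fun q hq =>
    Metric.infDist_le_dist_of_mem (show q ∈ {q | g q = 0} from hq)
  refine ⟨h, hpos, hp, ?_, infDist_sq_le hx, by linarith, by linarith⟩
  rw [hd, dist_pos]
  rintro rfl
  exact hpos.ne' hp

/-- From every point of the union of cells there is exactly one signed time at which the line in the
cut normal direction hits the zero set, and the segment up to there stays in the union. -/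
theorem exists_unique_signed_hit (h : TangentBalls g ν) {n : ℤ}
    (hZ : ∀ q, g q = 0 → (0 ≤ q 0 ∧ q 0 ≤ n) ∧ (0 ≤ q 1 ∧ q 1 ≤ n)) {x p : Plane}
    (hx : x ∈ cellUnion {q | g q = 0} n) (hp : g p = 0)
    (hd : Metric.infDist x {q | g q = 0} = dist x p) :
    ∃ S : ℝ, (0 ≤ S * g x ∧ |S| ≤ 1.6 * Metric.infDist x {q | g q = 0} ∧
        g (x - S • cutDirection (ν p)) = 0) ∧
      (∀ S' : ℝ, 0 ≤ S' * g x → |S'| ≤ 1.6 * Metric.infDist x {q | g q = 0} →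
        g (x - S' • cutDirection (ν p)) = 0 → S' = S) ∧
      ∀ t, 0 ≤ t → t ≤ 1 →
        x - (t * S) • cutDirection (ν p) ∈ cellUnion {q | g q = 0} n := by
  rcases lt_trichotomy (g x) 0 with h0 | h0 | h0
  · have hset : {q | (-g) q = 0} = {q | g q = 0} := by ext; simp
    have F : Foot (-g) (-ν) x p (Metric.infDist x {q | g q = 0}) := by
      have := h.negate.foot (x := x) (p := p) (n := n) (by rwa [hset]) (by simpa using h0)
        (by simpa using hp) (by rwa [hset])
      rwa [hset] at this
    have hmove : ∀ t, Foot.move (-ν) x p t = x - (-t) • cutDirection (ν p) := by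
      intro t
      simp only [Foot.move, Pi.neg_apply, cutDirection_neg, smul_neg, neg_smul]
    obtain ⟨t, ⟨ht0, ht1, ht⟩, hu⟩ := F.exists_unique_hit
    have hz := ht
    rw [hmove] at ht
    refine ⟨-t, ⟨by nlinarith, by rwa [abs_neg, abs_of_pos ht0], by simpa using ht⟩, ?_, ?_⟩
    · intro S h1 h2 h3
      have hS : S ≤ 0 := by
        by_contra! hc
        nlinarith
      have := hu (-S) (by linarith) ((neg_le_abs S).trans h2) (by rw [hmove]; simpa using h3)
      linarith
    · intro s hs0 hs1
      have := F.path_mem (n := n) (fun q hq => hZ q (by simpa using hq)) ht1 hz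
        (by rwa [hset]) (t := s * t) (by positivity) (mul_le_of_le_one_left ht0.le hs1)
      rw [hmove, hset] at this
      rwa [mul_neg]
  · have hz : Metric.infDist x {q | g q = 0} = 0 := Metric.infDist_zero_of_mem h0
    refine ⟨0, by simp [h0, hz], ?_, ?_⟩
    · intro S _ h2 _
      rw [hz, mul_zero] at h2
      exact abs_nonpos_iff.1 h2
    · intro t _ _
      simpa using hx
  · have F := h.foot hx h0 hp hd
    obtain ⟨t, ⟨ht0, ht1, ht⟩, hu⟩ := F.exists_unique_hit
    refine ⟨t, ⟨by positivity, by rwa [abs_of_pos ht0], ht⟩, ?_, ?_⟩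
    · intro S h1 h2 h3
      have hS : 0 ≤ S := by
        by_contra! hc
        nlinarith
      exact hu S hS ((le_abs_self S).trans h2) h3
    · intro s hs0 hs1
      exact F.path_mem hZ ht1 ht hx (t := s * t) (by positivity)
        (mul_le_of_le_one_left ht0.le hs1)

/-- The zero set is a deformation retract of the union of the cells which meet it. -/
theorem isDeformationRetract_cellUnion (h : TangentBalls g ν) {n : ℤ}
    (hZ : ∀ q, g q = 0 → (0 ≤ q 0 ∧ q 0 ≤ n) ∧ (0 ≤ q 1 ∧ q 1 ≤ n))
    (hsub : {q | g q = 0} ⊆ cellUnion {q | g q = 0} n) :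
    IsDeformationRetract {q | g q = 0} (cellUnion {q | g q = 0} n) := by
  rcases Set.eq_empty_or_nonempty {q | g q = 0} with hemp | hne
  · have : cellUnion {q | g q = 0} n = ∅ := by
      rw [hemp]
      ext p
      simp [cellUnion]
    rw [this, hemp]
    exact IsDeformationRetract.refl _
  set X := cellUnion {q | g q = 0} n with hX
  choose P hPM hP using fun y => h.compact.exists_infDist_eq_dist hne y
  have hex := fun x : X => h.exists_unique_signed_hit hZ x.2 (hPM x) (hP x)
  choose S hS hSu hSX using hex
  set W : Plane → Plane := fun x => cutDirection (ν (P x)) with hW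
  have hlt : ∀ x : X, Metric.infDist (x : Plane) {q | g q = 0} < 1.5 := by
    intro x
    have h1 := infDist_sq_le x.2
    nlinarith
  have hPc : Continuous fun x : X => P x := by
    rw [continuous_iff_continuousAt]
    intro x
    exact (h.uniqueNearest hne).tendsto h.compact (ys := fun x : X => (x : Plane))
      (continuous_subtype_val.tendsto x) ((hlt x).trans (by norm_num)) (hPM x) (hP x).symm
      (fun _ => hPM _) fun _ => (hP _).symm
  have hWc : Continuous fun x : X => W x := by
    refine continuous_cutDirection.comp ?_
    exact h.contNormal.comp_continuous hPc fun x => hPM x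
  have hSc : Continuous S := by
    rw [continuous_iff_continuousAt]
    intro x
    refine (isCompact_Icc (a := (-3 : ℝ)) (b := 3)).tendsto_nhds_of_unique_mapClusterPt
      (Eventually.of_forall fun y => ?_) fun z _ hcl => ?_
    · have := (hS y).2.1
      have h2 := hlt y
      exact abs_le.1 (by linarith)
    · obtain ⟨U, hU, hUz⟩ := mapClusterPt_iff_ultrafilter.1 hcl
      have hg : Tendsto (fun y : X => g y) U (𝓝 (g x)) :=
        ((h.cont.comp continuous_subtype_val).tendsto x).mono_left hU
      have hD : Tendsto (fun y : X => Metric.infDist (y : Plane) {q | g q = 0}) U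
          (𝓝 (Metric.infDist (x : Plane) {q | g q = 0})) :=
        (((Metric.continuous_infDist_pt _).comp continuous_subtype_val).tendsto x).mono_left hU
      have hWx : Tendsto (fun y : X => W y) U (𝓝 (W x)) := (hWc.tendsto x).mono_left hU
      have hx : Tendsto (fun y : X => (y : Plane)) U (𝓝 (x : Plane)) :=
        (continuous_subtype_val.tendsto x).mono_left hU
      refine hSu x z ?_ ?_ ?_
      · exact ge_of_tendsto (hUz.mul hg) (Eventually.of_forall fun y => (hS y).1)
      · exact le_of_tendsto_of_tendsto hUz.abs (hD.const_mul 1.6)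
          (Eventually.of_forall fun y => (hS y).2.1)
      · have h1 : Tendsto (fun y : X => g (y - S y • W y)) U (𝓝 (g (x - z • W x))) :=
          (h.cont.tendsto _).comp (hx.sub (hUz.smul hWx))
        have h2 : Tendsto (fun y : X => g (y - S y • W y)) U (𝓝 0) := by
          have : (fun y : X => g (y - S y • W y)) = fun _ => 0 := funext fun y => (hS y).2.2
          rw [this]
          exact tendsto_const_nhds
        exact tendsto_nhds_unique h1 h2
  classical
  set r : Plane → Plane := fun x => if hx : x ∈ X then x - S ⟨x, hx⟩ • W x else x with hr
  have hrX : ∀ x : X, r x = x - S x • W x := fun x => by simp only [hr, dif_pos x.2]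
  refine IsDeformationRetract.of_segment hsub r ?_ ?_ ?_ ?_
  · rw [continuousOn_iff_continuous_domRestrict]
    have : X.domRestrict r = fun x : X => (x : Plane) - S x • W x := funext hrX
    rw [this]
    exact continuous_subtype_val.sub (hSc.smul hWc)
  · intro x hx
    rw [hrX ⟨x, hx⟩]
    exact (hS ⟨x, hx⟩).2.2
  · intro x hx
    have hz : Metric.infDist x {q | g q = 0} = 0 := Metric.infDist_zero_of_mem hx
    have h1 := (hS ⟨x, hsub hx⟩).2.1
    rw [hz, mul_zero] at h1
    rw [hrX ⟨x, hsub hx⟩, abs_nonpos_iff.1 h1, zero_smul, sub_zero]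
  · rintro x hx t ⟨h0, h1⟩
    have := hSX ⟨x, hx⟩ t h0 h1
    rw [hrX ⟨x, hx⟩]
    convert this using 1
    rw [mul_smul, sub_sub_cancel_left, smul_neg, sub_eq_add_neg]

end TangentBalls

/-! ### Collapsing a square onto its top edge and some of its vertical edges -/

/-- The length by which a point at depth `u` and at distance `x` from a vertical edge is moved
along the collapse towards that edge; `w` is `1` if the edge is kept, and `0` otherwise. -/
def collapseLength (w u x : ℝ) : ℝ := min u (w * max 0 (1 - 2 * x))

theorem collapseLength_facts {w u x : ℝ} (hw : w = 0 ∨ w = 1) (hu0 : 0 ≤ u) (hu1 : u ≤ 1)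
    (hx : 0 ≤ x) :
    0 ≤ collapseLength w u x ∧ collapseLength w u x ≤ u ∧ (w = 0 → collapseLength w u x = 0) ∧
      (1 / 2 ≤ x → collapseLength w u x = 0) ∧ (x = 0 → w = 1 → collapseLength w u x = u) := by
  unfold collapseLength
  have h0 : 0 ≤ max 0 (1 - 2 * x) := le_max_left _ _
  refine ⟨le_min hu0 ?_, min_le_left _ _, ?_, ?_, ?_⟩
  · rcases hw with rfl | rfl <;> simp
  · rintro rfl; simpa using hu0
  · intro h
    rw [max_eq_left (by linarith), mul_zero, min_eq_right hu0]
  · rintro rfl rfl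
    simpa using hu1

/-- The collapse of the unit square onto its top edge, its left edge if `w = 1`, and its right edge
if `w' = 1`. -/
def squareCollapse (w w' : ℝ) (p : ℝ × ℝ) : ℝ × ℝ :=
  (p.1 - min (collapseLength w (1 - p.2) p.1) p.1
      + min (collapseLength w' (1 - p.2) (1 - p.1)) (1 - p.1),
    1 - ((collapseLength w (1 - p.2) p.1 - min (collapseLength w (1 - p.2) p.1) p.1)
      + (collapseLength w' (1 - p.2) (1 - p.1)
        - min (collapseLength w' (1 - p.2) (1 - p.1)) (1 - p.1))))

theorem continuous_squareCollapse (w w' : ℝ) : Continuous (squareCollapse w w') := by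
  unfold squareCollapse collapseLength
  fun_prop

theorem squareCollapse_mem {w w' : ℝ} (hw : w = 0 ∨ w = 1) (hw' : w' = 0 ∨ w' = 1) {p : ℝ × ℝ}
    (h1 : p.1 ∈ Set.Icc (0 : ℝ) 1) (h2 : p.2 ∈ Set.Icc (0 : ℝ) 1) :
    ((squareCollapse w w' p).1 ∈ Set.Icc (0 : ℝ) 1 ∧ (squareCollapse w w' p).2 ∈ Set.Icc (0 : ℝ) 1) ∧
      ((squareCollapse w w' p).2 = 1 ∨ ((squareCollapse w w' p).1 = 0 ∧ w = 1) ∨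
        ((squareCollapse w w' p).1 = 1 ∧ w' = 1)) := by
  obtain ⟨x, y⟩ := p
  simp only [Set.mem_Icc] at h1 h2
  obtain ⟨a1, a2, a3, a4, -⟩ := collapseLength_facts hw (u := 1 - y) (x := x) (by linarith)
    (by linarith) h1.1
  obtain ⟨b1, b2, b3, b4, -⟩ := collapseLength_facts hw' (u := 1 - y) (x := 1 - x) (by linarith)
    (by linarith) (by linarith)
  simp only [squareCollapse, Set.mem_Icc]
  generalize collapseLength w (1 - y) x = c at *
  generalize collapseLength w' (1 - y) (1 - x) = c' at *
  rcases le_total (1 / 2) x with hx | hx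
  · rw [a4 hx, min_eq_left h1.1]
    rcases le_total c' (1 - x) with h | h
    · rw [min_eq_left h]
      exact ⟨⟨⟨by linarith, by linarith⟩, by linarith, by linarith⟩, Or.inl (by ring)⟩
    · rw [min_eq_right h]
      refine ⟨⟨⟨by linarith, by linarith⟩, by linarith, by linarith⟩, ?_⟩
      rcases hw' with h0 | h0
      · left; linarith [b3 h0]
      · exact Or.inr (Or.inr ⟨by ring, h0⟩)
  · rw [b4 (by linarith), min_eq_left (by linarith : (0 : ℝ) ≤ 1 - x)]
    rcases le_total c x with h | h
    · rw [min_eq_left h]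
      exact ⟨⟨⟨by linarith, by linarith⟩, by linarith, by linarith⟩, Or.inl (by ring)⟩
    · rw [min_eq_right h]
      refine ⟨⟨⟨by linarith, by linarith⟩, by linarith, by linarith⟩, ?_⟩
      rcases hw with h0 | h0
      · left; linarith [a3 h0]
      · exact Or.inr (Or.inl ⟨by ring, h0⟩)

theorem squareCollapse_eq {w w' : ℝ} (hw : w = 0 ∨ w = 1) (hw' : w' = 0 ∨ w' = 1) {p : ℝ × ℝ}
    (h1 : p.1 ∈ Set.Icc (0 : ℝ) 1) (h2 : p.2 ∈ Set.Icc (0 : ℝ) 1)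
    (h : p.2 = 1 ∨ (p.1 = 0 ∧ w = 1) ∨ (p.1 = 1 ∧ w' = 1)) : squareCollapse w w' p = p := by
  obtain ⟨x, y⟩ := p
  simp only [Set.mem_Icc] at h1 h2 h
  obtain ⟨a1, a2, a3, a4, a5⟩ := collapseLength_facts hw (u := 1 - y) (x := x) (by linarith)
    (by linarith) h1.1
  obtain ⟨b1, b2, b3, b4, b5⟩ := collapseLength_facts hw' (u := 1 - y) (x := 1 - x) (by linarith)
    (by linarith) (by linarith)
  simp only [squareCollapse, Prod.mk.injEq]
  generalize collapseLength w (1 - y) x = c at *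
  generalize collapseLength w' (1 - y) (1 - x) = c' at *
  rcases h with rfl | ⟨rfl, h⟩ | ⟨rfl, h⟩
  · have hc : c = 0 := by linarith
    have hc' : c' = 0 := by linarith
    rw [hc, hc', min_eq_left h1.1, min_eq_left (by linarith : (0 : ℝ) ≤ 1 - x)]
    constructor <;> ring
  · have hc' : c' = 0 := b4 (by norm_num)
    rw [a5 rfl h, hc', min_eq_right (by linarith : (0 : ℝ) ≤ 1 - y), min_eq_left (by norm_num)]
    constructor <;> ring
  · have hc : c = 0 := a4 (by norm_num)
    rw [b5 (by norm_num) h, hc, min_eq_left (zero_le_one), sub_self,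
      min_eq_right (by linarith : (0 : ℝ) ≤ 1 - y)]
    constructor <;> ring

/-- A closed set which meets the unit square in its top edge and some of its vertical edges is a
deformation retract of its union with the square. -/
theorem isDeformationRetract_union_square {A : Set (ℝ × ℝ)} (hA : IsClosed A) (l r : Prop)
    (h : ∀ p : ℝ × ℝ, p.1 ∈ Set.Icc (0 : ℝ) 1 → p.2 ∈ Set.Icc (0 : ℝ) 1 →
      (p ∈ A ↔ p.2 = 1 ∨ (p.1 = 0 ∧ l) ∨ (p.1 = 1 ∧ r))) :
    IsDeformationRetract A (A ∪ Set.Icc (0 : ℝ) 1 ×ˢ Set.Icc (0 : ℝ) 1) := by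
  classical
  have hflag : ∀ q : Prop, ∃ w : ℝ, (w = 0 ∨ w = 1) ∧ (q ↔ w = 1) := fun q => by
    by_cases hq : q
    · exact ⟨1, Or.inr rfl, by simp [hq]⟩
    · exact ⟨0, Or.inl rfl, by simp [hq]⟩
  obtain ⟨w, hw, hl⟩ := hflag l
  obtain ⟨w', hw', hr⟩ := hflag r
  rw [hl, hr] at h
  set Q : Set (ℝ × ℝ) := Set.Icc (0 : ℝ) 1 ×ˢ Set.Icc (0 : ℝ) 1 with hQ
  have hmem : ∀ p ∈ Q, squareCollapse w w' p ∈ A ∧ squareCollapse w w' p ∈ Q := fun p hp => by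
    obtain ⟨⟨q1, q2⟩, q3⟩ := squareCollapse_mem hw hw' hp.1 hp.2
    exact ⟨(h _ q1 q2).2 q3, q1, q2⟩
  have hfix : ∀ p ∈ A, (if p ∈ Q then squareCollapse w w' p else p) = p := fun p hp => by
    split_ifs with hpQ
    · exact squareCollapse_eq hw hw' hpQ.1 hpQ.2 ((h p hpQ.1 hpQ.2).1 hp)
    · rfl
  have hQc : IsClosed Q := isClosed_Icc.prod isClosed_Icc
  have hconv : Convex ℝ Q := (convex_Icc 0 1).prod (convex_Icc 0 1)
  refine IsDeformationRetract.of_segment Set.subset_union_left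
    (fun p => if p ∈ Q then squareCollapse w w' p else p) ?_ ?_ hfix ?_
  · refine ContinuousOn.union_of_isClosed (continuousOn_id.congr hfix)
      ((continuous_squareCollapse w w').continuousOn.congr fun p hp => if_pos hp) hA hQc
  · intro p hp
    by_cases hpQ : p ∈ Q
    · simpa only [if_pos hpQ] using (hmem p hpQ).1
    · simpa only [if_neg hpQ] using hp.resolve_right hpQ
  · intro p hp t ht
    by_cases hpQ : p ∈ Q
    · simp only [if_pos hpQ]
      exact Or.inr (hconv.add_smul_sub_mem hpQ (hmem p hpQ).2 ht)
    · simpa only [if_neg hpQ, sub_self, smul_zero, add_zero] using hp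

/-! ### Tangent discs at the zeros of a function on `ℝ × ℝ` -/

/-- `p` is a zero of `g`, and the open discs of radius `2.37` centered at `m` and `m'` are tangent to
each other at `p` and lie in `{g < 0}` and `{0 < g}`. -/
structure TangentDiscs (g : ℝ × ℝ → ℝ) (p m m' : ℝ × ℝ) : Prop where
  zero : g p = 0
  fst : m.1 + m'.1 = 2 * p.1
  snd : m.2 + m'.2 = 2 * p.2
  circle : (p.1 - m.1) ^ 2 + (p.2 - m.2) ^ 2 = 5.6169
  neg : ∀ s t, (s - m.1) ^ 2 + (t - m.2) ^ 2 < 5.6169 → g (s, t) < 0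
  pos : ∀ s t, (s - m'.1) ^ 2 + (t - m'.2) ^ 2 < 5.6169 → 0 < g (s, t)

namespace TangentDiscs

variable {g : ℝ × ℝ → ℝ} {p m m' q w w' : ℝ × ℝ}

theorem negate (h : TangentDiscs g p m m') : TangentDiscs (-g) p m' m where
  zero := by simp [h.zero]
  fst := by linarith [h.fst]
  snd := by linarith [h.snd]
  circle := by
    rw [← h.circle, show m'.1 = 2 * p.1 - m.1 by linarith [h.fst],
      show m'.2 = 2 * p.2 - m.2 by linarith [h.snd]]
    ring
  neg s t hst := by simpa using h.pos s t hst
  pos s t hst := by simpa using h.neg s t hst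

theorem le_of_pos (h : TangentDiscs g p m m') {s t : ℝ} (hv : 0 < g (s, t)) :
    5.6169 ≤ (s - m.1) ^ 2 + (t - m.2) ^ 2 := by
  by_contra! hlt
  exact absurd (h.neg s t hlt) hv.not_gt

theorem separated (h : TangentDiscs g p m m') (h' : TangentDiscs g q w w') :
    22.4676 ≤ (m'.1 - w.1) ^ 2 + (m'.2 - w.2) ^ 2 := by
  by_contra! hlt
  have h1 := h.pos ((m'.1 + w.1) / 2) ((m'.2 + w.2) / 2) (by nlinarith only [hlt])
  have h2 := h'.neg ((m'.1 + w.1) / 2) ((m'.2 + w.2) / 2) (by nlinarith only [hlt])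
  linarith

end TangentDiscs

/-- The center of a disc of radius `2.37` which avoids the vertices of the unit square and whose
boundary meets the square lies straight above, below, left or right of the square. -/
theorem center_cases {a b m n : ℝ} (ha : a ∈ Set.Icc (0 : ℝ) 1) (hb : b ∈ Set.Icc (0 : ℝ) 1)
    (hc : (a - m) ^ 2 + (b - n) ^ 2 = 5.6169)
    (h00 : 5.6169 ≤ (0 - m) ^ 2 + (0 - n) ^ 2) (h10 : 5.6169 ≤ (1 - m) ^ 2 + (0 - n) ^ 2)
    (h01 : 5.6169 ≤ (0 - m) ^ 2 + (1 - n) ^ 2) (h11 : 5.6169 ≤ (1 - m) ^ 2 + (1 - n) ^ 2)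
    (hne : (a ≠ 0 ∨ b ≠ 0) ∧ (a ≠ 1 ∨ b ≠ 0) ∧ (a ≠ 0 ∨ b ≠ 1) ∧ (a ≠ 1 ∨ b ≠ 1)) :
    ((0 < m ∧ m < 1) ∧ 1 < n) ∨ ((0 < m ∧ m < 1) ∧ n < 0) ∨
      ((0 < n ∧ n < 1) ∧ 1 < m) ∨ ((0 < n ∧ n < 1) ∧ m < 0) := by
  obtain ⟨ha0, ha1⟩ := ha
  obtain ⟨hb0, hb1⟩ := hb
  obtain ⟨n00, n10, n01, n11⟩ := hne
  have corner : ∀ x y c d : ℝ, 0 ≤ x → 0 ≤ y → 0 ≤ c → 0 ≤ d → (c ≠ 0 ∨ d ≠ 0) →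
      x ^ 2 + y ^ 2 < (x + c) ^ 2 + (y + d) ^ 2 := fun x y c d hx hy hc hd hcd => by
    rcases hcd with h | h
    · have : 0 < c ^ 2 := by positivity
      nlinarith
    · have : 0 < d ^ 2 := by positivity
      nlinarith
  rcases le_or_gt m 0 with hm | hm
  · rcases le_or_gt n 0 with hn | hn
    · have := corner (-m) (-n) a b (by linarith) (by linarith) ha0 hb0 n00
      nlinarith only [this, hc, h00]
    rcases lt_or_ge n 1 with hn1 | hn1
    · refine Or.inr (Or.inr (Or.inr ⟨⟨hn, hn1⟩, lt_of_le_of_ne hm ?_⟩))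
      rintro rfl
      nlinarith only [h00, hn, hn1]
    · have := corner (-m) (n - 1) a (1 - b) (by linarith) (by linarith) ha0 (by linarith)
        (n01.imp_right fun h h' => h (by linarith))
      nlinarith only [this, hc, h01]
  rcases lt_or_ge m 1 with hm1 | hm1
  · rcases lt_or_ge n 0 with hn | hn
    · exact Or.inr (Or.inl ⟨⟨hm, hm1⟩, hn⟩)
    rcases lt_or_ge 1 n with hn1 | hn1
    · exact Or.inl ⟨⟨hm, hm1⟩, hn1⟩
    · nlinarith only [h00, hm, hm1, hn, hn1]
  · rcases le_or_gt n 0 with hn | hn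
    · have := corner (m - 1) (-n) (1 - a) b (by linarith) (by linarith) (by linarith) hb0
        (n10.imp_left fun h h' => h (by linarith))
      nlinarith only [this, hc, h10]
    rcases lt_or_ge n 1 with hn1 | hn1
    · refine Or.inr (Or.inr (Or.inl ⟨⟨hn, hn1⟩, lt_of_le_of_ne hm1 ?_⟩))
      rintro rfl
      nlinarith only [h10, hn, hn1]
    · have := corner (m - 1) (n - 1) (1 - a) (1 - b) (by linarith) (by linarith) (by linarith)
        (by linarith) (n11.imp (fun h h' => h (by linarith)) fun h h' => h (by linarith))
      nlinarith only [this, hc, h11]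

/-- Bounds for the position of a disc of radius `2.37` whose center is straight above the square. -/
theorem center_above_bounds {a b m n : ℝ} (hb : b ≤ 1)
    (hc : (a - m) ^ 2 + (b - n) ^ 2 = 5.6169)
    (h01 : 5.6169 ≤ (0 - m) ^ 2 + (1 - n) ^ 2) (h11 : 5.6169 ≤ (1 - m) ^ 2 + (1 - n) ^ 2)
    (hm : 0 < m ∧ m < 1) (hn : 1 < n) :
    (3.316 ≤ n ∧ n ≤ 3.37) ∧ (-1 / 2 ≤ 2 * a - m ∧ 2 * a - m ≤ 3 / 2) ∧
      (-1.424 ≤ 2 * b - n ∧ 2 * b - n ≤ -1.316) := by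
  have hn1 : 2.316 ≤ n - 1 := by
    by_contra! h
    rcases le_total m (1 / 2) with h' | h'
    · nlinarith only [h01, h, h', hm.1, hn]
    · nlinarith only [h11, h, h', hm.2, hn]
  have hbn : n - b ≤ 2.37 := by
    by_contra! h
    nlinarith only [hc, h, sq_nonneg (a - m)]
  have h1 : (a - m) ^ 2 ≤ m ^ 2 := by nlinarith only [hc, h01, hb, hn]
  have h2 : (a - m) ^ 2 ≤ (1 - m) ^ 2 := by nlinarith only [hc, h11, hb, hn]
  have h3 := abs_le.1 (abs_le_of_sq_le_sq h1 hm.1.le)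
  have h4 := abs_le.1 (abs_le_of_sq_le_sq h2 (by linarith [hm.2]))
  refine ⟨⟨by linarith, by linarith⟩, ⟨by linarith [h3.1, h4.1], by linarith [h3.2, h4.2]⟩,
    by linarith, by linarith⟩

/-- The data of a zero in the unit square whose negative tangent disc is centered straight above
the square, at the four vertices of which `g` is positive. -/
structure ArchAbove (g : ℝ × ℝ → ℝ) (p m m' : ℝ × ℝ) : Prop extends TangentDiscs g p m m' where
  mem₁ : p.1 ∈ Set.Icc (0 : ℝ) 1
  mem₂ : p.2 ∈ Set.Icc (0 : ℝ) 1
  pos00 : 0 < g (0, 0)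
  pos10 : 0 < g (1, 0)
  pos01 : 0 < g (0, 1)
  pos11 : 0 < g (1, 1)
  center₁ : 0 < m.1 ∧ m.1 < 1
  center₂ : 1 < m.2

namespace ArchAbove

variable {g : ℝ × ℝ → ℝ} {p m m' : ℝ × ℝ}

theorem bounds (h : ArchAbove g p m m') :
    (3.316 ≤ m.2 ∧ m.2 ≤ 3.37) ∧ (-1 / 2 ≤ m'.1 ∧ m'.1 ≤ 3 / 2) ∧
      (-1.424 ≤ m'.2 ∧ m'.2 ≤ -1.316) := by
  obtain ⟨h1, h2, h3⟩ := center_above_bounds h.mem₂.2 h.circle (h.le_of_pos h.pos01)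
    (h.le_of_pos h.pos11) h.center₁ h.center₂
  have h4 := h.fst
  have h5 := h.snd
  exact ⟨h1, ⟨by linarith [h2.1], by linarith [h2.2]⟩, by linarith [h3.1], by linarith [h3.2]⟩

theorem neg_above (h : ArchAbove g p m m') : g (0, 2) < 0 := by
  obtain ⟨⟨h1, h2⟩, -, -⟩ := h.bounds
  exact h.neg _ _ (by nlinarith only [h1, h2, h.center₁.1, h.center₁.2])

theorem pos_below (h : ArchAbove g p m m') {s t : ℝ} (hs : s ∈ Set.Icc (0 : ℝ) 1)
    (ht : t ∈ Set.Icc (-1 : ℝ) 0) : 0 < g (s, t) := by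
  obtain ⟨-, ⟨h3, h4⟩, h5, h6⟩ := h.bounds
  obtain ⟨hs0, hs1⟩ := hs
  obtain ⟨ht0, ht1⟩ := ht
  have e1 : (s - m'.1) ^ 2 ≤ (3 / 2) ^ 2 := sq_le_sq' (by linarith) (by linarith)
  have e2 : (t - m'.2) ^ 2 ≤ 1.424 ^ 2 := sq_le_sq' (by linarith) (by linarith)
  exact h.pos _ _ (by nlinarith only [e1, e2])

theorem pos_far_below (h : ArchAbove g p m m') : 0 < g (0, -2) := by
  obtain ⟨-, ⟨h3, h4⟩, h5, h6⟩ := h.bounds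
  have e1 : (0 - m'.1) ^ 2 ≤ (3 / 2) ^ 2 := sq_le_sq' (by linarith) (by linarith)
  have e2 : (-2 - m'.2) ^ 2 ≤ 1 ^ 2 := sq_le_sq' (by linarith) (by linarith)
  exact h.pos _ _ (by nlinarith only [e1, e2])

/-- The tangent disc at any other zero in the square is centered above the square as well. -/
theorem of_tangentDiscs (h : ArchAbove g p m m') {q w w' : ℝ × ℝ} (hq : TangentDiscs g q w w')
    (h1 : q.1 ∈ Set.Icc (0 : ℝ) 1) (h2 : q.2 ∈ Set.Icc (0 : ℝ) 1) : ArchAbove g q w w' := by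
  have v00 := hq.le_of_pos h.pos00
  have v10 := hq.le_of_pos h.pos10
  have v01 := hq.le_of_pos h.pos01
  have v11 := hq.le_of_pos h.pos11
  have ne : ∀ s t, 0 < g (s, t) → q.1 ≠ s ∨ q.2 ≠ t := fun s t hst => by
    by_contra! hc
    have : q = (s, t) := Prod.ext hc.1 hc.2
    rw [← this, hq.zero] at hst
    exact lt_irrefl _ hst
  have hsep := h.separated hq
  obtain ⟨-, ⟨b3, b4⟩, b5, b6⟩ := h.bounds
  rcases center_cases h1 h2 hq.circle v00 v10 v01 v11
    ⟨ne _ _ h.pos00, ne _ _ h.pos10, ne _ _ h.pos01, ne _ _ h.pos11⟩ with hc | hc | hc | hc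
  · exact { hq with
      mem₁ := h1, mem₂ := h2, pos00 := h.pos00, pos10 := h.pos10, pos01 := h.pos01,
      pos11 := h.pos11, center₁ := hc.1, center₂ := hc.2 }
  · obtain ⟨⟨c1, c2⟩, -, -⟩ := center_above_bounds (a := q.1) (b := 1 - q.2) (m := w.1)
      (n := 1 - w.2) (by linarith [h2.1]) (by linarith [hq.circle]) (by linarith)
      (by linarith) hc.1 (by linarith)
    have e1 : (m'.1 - w.1) ^ 2 ≤ 2 ^ 2 := sq_le_sq' (by linarith [hc.1.2]) (by linarith [hc.1.1])
    have e2 : (m'.2 - w.2) ^ 2 ≤ 2 ^ 2 := sq_le_sq' (by linarith) (by linarith)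
    nlinarith only [e1, e2, hsep]
  · obtain ⟨⟨c1, c2⟩, -, -⟩ := center_above_bounds (a := q.2) (b := q.1) (m := w.2)
      (n := w.1) (by linarith [h1.2]) (by linarith [hq.circle]) (by linarith)
      (by linarith) hc.1 (by linarith)
    have e1 : (m'.1 - w.1) ^ 2 ≤ 3.9 ^ 2 := sq_le_sq' (by linarith) (by linarith)
    have e2 : (m'.2 - w.2) ^ 2 ≤ 2.5 ^ 2 := sq_le_sq' (by linarith [hc.1.2]) (by linarith [hc.1.1])
    nlinarith only [e1, e2, hsep]
  · obtain ⟨⟨c1, c2⟩, -, -⟩ := center_above_bounds (a := q.2) (b := 1 - q.1) (m := w.2)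
      (n := 1 - w.1) (by linarith [h1.1]) (by linarith [hq.circle]) (by linarith)
      (by linarith) hc.1 (by linarith)
    have e1 : (m'.1 - w.1) ^ 2 ≤ 3.9 ^ 2 := sq_le_sq' (by linarith) (by linarith)
    have e2 : (m'.2 - w.2) ^ 2 ≤ 2.5 ^ 2 := sq_le_sq' (by linarith [hc.1.2]) (by linarith [hc.1.1])
    nlinarith only [e1, e2, hsep]

end ArchAbove

/-- A continuous function all of whose zeros have tangent discs of radius `2.37` on both sides. -/
structure HasTangentDiscs (g : ℝ × ℝ → ℝ) : Prop where
  cont : Continuous g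
  discs : ∀ p, g p = 0 → ∃ m m', TangentDiscs g p m m'

theorem HasTangentDiscs.negate {g : ℝ × ℝ → ℝ} (h : HasTangentDiscs g) : HasTangentDiscs (-g) where
  cont := h.cont.neg
  discs p hp := by
    obtain ⟨m, m', hm⟩ := h.discs p (by simpa using hp)
    exact ⟨m', m, hm.negate⟩

namespace ArchAbove

variable {g : ℝ × ℝ → ℝ} {p m m' : ℝ × ℝ}

/-- There is a zero in the square whose positive tangent disc is not centered to the right of the
square. -/
theorem exists_center_le_one (hg : HasTangentDiscs g) (h : ArchAbove g p m m') :
    ∃ q w w', ArchAbove g q w w' ∧ w'.1 ≤ 1 := by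
  rcases le_or_gt p.1 m.1 with hpm | hpm
  · exact ⟨p, m, m', h, by linarith [h.fst, h.mem₁.2]⟩
  have hm0 := h.center₁.1
  have hm1 := h.center₁.2
  have hneg : g (m.1, 1) < 0 := h.neg _ _ (by
    nlinarith only [h.circle, hpm, h.center₂, h.mem₂.2])
  have hline : Continuous fun s : ℝ => g (s, 1) := hg.cont.comp (by fun_prop)
  have hzero : ∀ s, 0 ≤ s → g (s, 1) < 0 → ∃ t ∈ Set.Icc 0 s, g (t, 1) = 0 := fun s hs hs' =>
    intermediate_value_Icc' hs hline.continuousOn ⟨hs'.le, h.pos01.le⟩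
  obtain ⟨a, ⟨⟨ha0, ha1⟩, hga⟩, hleast⟩ :=
    (isCompact_Icc.inter_right (isClosed_eq hline continuous_const) :
      IsCompact (Set.Icc 0 m.1 ∩ {s | g (s, 1) = 0})).exists_isLeast (hzero _ hm0.le hneg)
  have hga : g (a, 1) = 0 := hga
  obtain ⟨w, w', hw⟩ := hg.discs (a, 1) hga
  have harch := h.of_tangentDiscs hw ⟨ha0, by linarith⟩ ⟨zero_le_one, le_rfl⟩
  refine ⟨_, w, w', harch, ?_⟩
  have haw : a ≤ w.1 := by
    by_contra! hlt
    have hw0 := harch.center₁.1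
    have hs : g ((a + w.1) / 2, 1) < 0 := hw.neg _ _ (by
      have := hw.circle
      simp only at this
      nlinarith only [this, hlt])
    obtain ⟨t, ⟨ht0, ht1⟩, ht⟩ := hzero _ (by linarith) hs
    have := hleast ⟨⟨ht0, by linarith⟩, ht⟩
    linarith
  have := hw.fst
  simp only at this
  linarith

/-- If the square diagonally below to the left contains a zero, then the square to the left has a
vertex where `g` is not positive. -/
theorem not_pos_left (hg : HasTangentDiscs g) (h : ArchAbove g p m m') {z : ℝ × ℝ} (hz : g z = 0)
    (hz1 : z.1 ∈ Set.Icc (-1 : ℝ) 0) (hz2 : z.2 ∈ Set.Icc (-1 : ℝ) 0)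
    (h1 : 0 < g (-1, 0)) : g (-1, 1) ≤ 0 := by
  by_contra! h2
  obtain ⟨q, w, w', hq, hw'⟩ := h.exists_center_le_one hg
  obtain ⟨-, ⟨b3, b4⟩, b5, b6⟩ := hq.bounds
  have p11 : 0 < g (-1, -1) := by
    have e1 : (-1 - w'.1) ^ 2 ≤ 2 ^ 2 := sq_le_sq' (by linarith) (by linarith)
    have e2 : (-1 - w'.2) ^ 2 ≤ 1 ^ 2 := sq_le_sq' (by linarith) (by linarith)
    exact hq.pos _ _ (by nlinarith only [e1, e2])
  have p01 : 0 < g (0, -1) := h.pos_below ⟨le_rfl, zero_le_one⟩ ⟨le_rfl, by norm_num⟩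
  obtain ⟨k, k', hk⟩ := hg.discs z hz
  have v00 := hk.le_of_pos p11
  have v10 := hk.le_of_pos p01
  have v01 := hk.le_of_pos h1
  have v11 := hk.le_of_pos h.pos00
  have hcirc := hk.circle
  have ne : ∀ s t, 0 < g (s, t) → z.1 ≠ s ∨ z.2 ≠ t := fun s t hst => by
    by_contra! hc
    have : z = (s, t) := Prod.ext hc.1 hc.2
    rw [← this, hz] at hst
    exact lt_irrefl _ hst
  have ne' : ∀ s t, 0 < g (s, t) → z.1 + 1 ≠ s + 1 ∨ z.2 + 1 ≠ t + 1 := fun s t hst =>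
    (ne s t hst).imp (fun h h' => h (by linarith)) fun h h' => h (by linarith)
  have hcases := center_cases (a := z.1 + 1) (b := z.2 + 1) (m := k.1 + 1) (n := k.2 + 1)
    ⟨by linarith [hz1.1], by linarith [hz1.2]⟩ ⟨by linarith [hz2.1], by linarith [hz2.2]⟩
    (by linarith) (by linarith) (by linarith) (by linarith) (by linarith)
    ⟨by simpa using ne' _ _ p11, by simpa using ne' _ _ p01, by simpa using ne' _ _ h1,
      by simpa using ne' _ _ h.pos00⟩
  rcases hcases with hc | hc | hc | hc
  · obtain ⟨⟨c1, c2⟩, -, -⟩ := center_above_bounds (a := z.1 + 1) (b := z.2 + 1) (m := k.1 + 1)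
      (n := k.2 + 1) (by linarith [hz2.2]) (by linarith) (by linarith) (by linarith) hc.1 hc.2
    have := hk.neg 0 1 (by nlinarith only [c1, c2, hc.1.1, hc.1.2])
    linarith [h.pos01]
  · obtain ⟨⟨c1, c2⟩, -, -⟩ := center_above_bounds (a := z.1 + 1) (b := -z.2) (m := k.1 + 1)
      (n := -k.2) (by linarith [hz2.1]) (by linarith) (by linarith) (by linarith) hc.1
      (by linarith)
    have := hk.neg 0 (-2) (by nlinarith only [c1, c2, hc.1.1, hc.1.2])
    linarith [h.pos_far_below]
  · obtain ⟨⟨c1, c2⟩, -, -⟩ := center_above_bounds (a := z.2 + 1) (b := z.1 + 1) (m := k.2 + 1)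
      (n := k.1 + 1) (by linarith [hz1.2]) (by linarith) (by linarith) (by linarith) hc.1 hc.2
    have := hk.neg 1 0 (by nlinarith only [c1, c2, hc.1.1, hc.1.2])
    linarith [h.pos10]
  · obtain ⟨⟨c1, c2⟩, -, -⟩ := center_above_bounds (a := z.2 + 1) (b := -z.1) (m := k.2 + 1)
      (n := -k.1) (by linarith [hz1.1]) (by linarith) (by linarith) (by linarith) hc.1
      (by linarith)
    have hsep := hq.separated hk
    have e1 : (w'.1 - k.1) ^ 2 ≤ 4.37 ^ 2 := sq_le_sq' (by linarith) (by linarith)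
    have e2 : (w'.2 - k.2) ^ 2 ≤ 1.5 ^ 2 := sq_le_sq' (by linarith [hc.1.2]) (by linarith [hc.1.1])
    nlinarith only [e1, e2, hsep]

end ArchAbove

/-! ### The integer grid in `ℝ × ℝ` and its symmetries -/

/-- The closed unit square with lower left vertex `k`. -/
def latticeCell (k : ℤ × ℤ) : Set (ℝ × ℝ) :=
  Set.Icc (k.1 : ℝ) (k.1 + 1) ×ˢ Set.Icc (k.2 : ℝ) (k.2 + 1)

/-- The vertices of `latticeCell k`. -/
def cellVertices (k : ℤ × ℤ) : Set (ℝ × ℝ) :=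
  {p | (p.1 = k.1 ∨ p.1 = k.1 + 1) ∧ (p.2 = k.2 ∨ p.2 = k.2 + 1)}

/-- The cell `k` has a vertex where `g` is nonnegative and one where it is nonpositive. -/
def SelectedCell (g : ℝ × ℝ → ℝ) (k : ℤ × ℤ) : Prop :=
  ∃ v ∈ cellVertices k, ∃ w ∈ cellVertices k, 0 ≤ g v ∧ g w ≤ 0

/-- The cell `k` contains a zero of `g`. -/
def MeetingCell (g : ℝ × ℝ → ℝ) (k : ℤ × ℤ) : Prop :=
  ∃ p ∈ latticeCell k, g p = 0

/-- The union of a set of cells. -/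
def latticeUnion (S : Set (ℤ × ℤ)) : Set (ℝ × ℝ) := ⋃ k ∈ S, latticeCell k

theorem mem_latticeUnion {S : Set (ℤ × ℤ)} {p : ℝ × ℝ} :
    p ∈ latticeUnion S ↔ ∃ k ∈ S, p ∈ latticeCell k := by
  simp [latticeUnion]

theorem isClosed_latticeCell (k : ℤ × ℤ) : IsClosed (latticeCell k) :=
  isClosed_Icc.prod isClosed_Icc

theorem isClosed_latticeUnion {S : Set (ℤ × ℤ)} (hS : S.Finite) : IsClosed (latticeUnion S) :=
  hS.isClosed_biUnion fun k _ => isClosed_latticeCell k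

theorem cellVertices_subset (k : ℤ × ℤ) : cellVertices k ⊆ latticeCell k := by
  rintro p ⟨h1, h2⟩
  constructor
  · rcases h1 with h | h <;> rw [h] <;> constructor <;> linarith
  · rcases h2 with h | h <;> rw [h] <;> constructor <;> linarith

theorem selectedCell_neg {g : ℝ × ℝ → ℝ} {k : ℤ × ℤ} : SelectedCell (-g) k ↔ SelectedCell g k := by
  unfold SelectedCell
  simp only [Pi.neg_apply, Left.nonneg_neg_iff, Left.neg_nonpos_iff]
  constructor <;> rintro ⟨v, hv, w, hw, h1, h2⟩ <;> exact ⟨w, hw, v, hv, h2, h1⟩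

theorem meetingCell_neg {g : ℝ × ℝ → ℝ} {k : ℤ × ℤ} : MeetingCell (-g) k ↔ MeetingCell g k := by
  simp [MeetingCell]

theorem SelectedCell.meetingCell {g : ℝ × ℝ → ℝ} (hg : Continuous g) {k : ℤ × ℤ}
    (h : SelectedCell g k) : MeetingCell g k := by
  obtain ⟨v, hv, w, hw, h1, h2⟩ := h
  have hconv : Convex ℝ (latticeCell k) := (convex_Icc _ _).prod (convex_Icc _ _)
  obtain ⟨p, hp, hgp⟩ := hconv.isPreconnected.intermediate_value (cellVertices_subset k hw)
    (cellVertices_subset k hv) hg.continuousOn ⟨h2, h1⟩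
  exact ⟨p, hp, hgp⟩

/-- `e` is a symmetry of the integer grid, acting by `c` on its cells. -/
structure IsGridSymmetry (e : ℝ × ℝ ≃ₜ ℝ × ℝ) (c : ℤ × ℤ → ℤ × ℤ) : Prop where
  surj : Function.Surjective c
  cell : ∀ p k, e p ∈ latticeCell (c k) ↔ p ∈ latticeCell k
  vertices : ∀ p k, e p ∈ cellVertices (c k) ↔ p ∈ cellVertices k
  dist : ∀ p q, ((e p).1 - (e q).1) ^ 2 + ((e p).2 - (e q).2) ^ 2 =
    (p.1 - q.1) ^ 2 + (p.2 - q.2) ^ 2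
  mid : ∀ p m m', ((e m).1 + (e m').1 = 2 * (e p).1 ∧ (e m).2 + (e m').2 = 2 * (e p).2) ↔
    (m.1 + m'.1 = 2 * p.1 ∧ m.2 + m'.2 = 2 * p.2)

namespace IsGridSymmetry

variable {e e' : ℝ × ℝ ≃ₜ ℝ × ℝ} {c c' : ℤ × ℤ → ℤ × ℤ} {g : ℝ × ℝ → ℝ}

theorem trans (h : IsGridSymmetry e c) (h' : IsGridSymmetry e' c') :
    IsGridSymmetry (e.trans e') (c' ∘ c) where
  surj := h'.surj.comp h.surj
  cell _ _ := (h'.cell _ _).trans (h.cell _ _)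
  vertices _ _ := (h'.vertices _ _).trans (h.vertices _ _)
  dist _ _ := (h'.dist _ _).trans (h.dist _ _)
  mid _ _ _ := (h'.mid _ _ _).trans (h.mid _ _ _)

theorem tangentDiscs (h : IsGridSymmetry e c) {p m m' : ℝ × ℝ}
    (ht : TangentDiscs g (e p) (e m) (e m')) : TangentDiscs (g ∘ e) p m m' where
  zero := ht.zero
  fst := ((h.mid p m m').1 ⟨ht.fst, ht.snd⟩).1
  snd := ((h.mid p m m').1 ⟨ht.fst, ht.snd⟩).2
  circle := by rw [← ht.circle, h.dist]
  neg s t hst := ht.neg (e (s, t)).1 (e (s, t)).2 (by rwa [h.dist])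
  pos s t hst := ht.pos (e (s, t)).1 (e (s, t)).2 (by rwa [h.dist])

theorem hasTangentDiscs (h : IsGridSymmetry e c) (hg : HasTangentDiscs g) :
    HasTangentDiscs (g ∘ e) where
  cont := hg.cont.comp e.continuous
  discs p hp := by
    obtain ⟨m, m', hm⟩ := hg.discs (e p) hp
    refine ⟨e.symm m, e.symm m', h.tangentDiscs ?_⟩
    simpa using hm

theorem selectedCell (h : IsGridSymmetry e c) {k : ℤ × ℤ} :
    SelectedCell (g ∘ e) k ↔ SelectedCell g (c k) := by
  constructor
  · rintro ⟨v, hv, w, hw, h1, h2⟩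
    exact ⟨e v, (h.vertices _ _).2 hv, e w, (h.vertices _ _).2 hw, h1, h2⟩
  · rintro ⟨v, hv, w, hw, h1, h2⟩
    refine ⟨e.symm v, (h.vertices _ _).1 ?_, e.symm w, (h.vertices _ _).1 ?_, ?_, ?_⟩ <;>
      simpa

theorem meetingCell (h : IsGridSymmetry e c) {k : ℤ × ℤ} :
    MeetingCell (g ∘ e) k ↔ MeetingCell g (c k) := by
  constructor
  · rintro ⟨p, hp, h1⟩
    exact ⟨e p, (h.cell _ _).2 hp, h1⟩
  · rintro ⟨p, hp, h1⟩
    refine ⟨e.symm p, (h.cell _ _).1 ?_, ?_⟩ <;> simpa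

theorem image_latticeUnion (h : IsGridSymmetry e c) (S : Set (ℤ × ℤ)) :
    e '' latticeUnion (c ⁻¹' S) = latticeUnion S := by
  ext p
  simp only [Set.mem_image, mem_latticeUnion, Set.mem_preimage]
  constructor
  · rintro ⟨q, ⟨k, hk, hq⟩, rfl⟩
    exact ⟨c k, hk, (h.cell _ _).2 hq⟩
  · rintro ⟨k, hk, hp⟩
    obtain ⟨k, rfl⟩ := h.surj k
    exact ⟨e.symm p, ⟨k, hk, (h.cell _ _).1 (by simpa)⟩, by simp⟩

end IsGridSymmetry

/-- Translation by an integer vector. -/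
def translation (i j : ℤ) : ℝ × ℝ ≃ₜ ℝ × ℝ where
  toFun p := (i + p.1, j + p.2)
  invFun p := (p.1 - i, p.2 - j)
  left_inv p := by simp
  right_inv p := by simp
  continuous_toFun := by fun_prop
  continuous_invFun := by fun_prop

/-- Reflection in the vertical line through the center of the unit square. -/
def reflection : ℝ × ℝ ≃ₜ ℝ × ℝ where
  toFun p := (1 - p.1, p.2)
  invFun p := (1 - p.1, p.2)
  left_inv p := by simp
  right_inv p := by simp
  continuous_toFun := by fun_prop
  continuous_invFun := by fun_prop

theorem translation_apply (i j : ℤ) (p : ℝ × ℝ) : translation i j p = (i + p.1, j + p.2) := rfl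

theorem reflection_apply (p : ℝ × ℝ) : reflection p = (1 - p.1, p.2) := rfl

theorem isGridSymmetry_translation (i j : ℤ) :
    IsGridSymmetry (translation i j) fun k => (i + k.1, j + k.2) where
  surj k := ⟨(k.1 - i, k.2 - j), by simp⟩
  cell p k := by
    simp [translation_apply, latticeCell, add_assoc, -Set.Icc_prod_Icc]
  vertices p k := by
    simp [translation_apply, cellVertices, add_assoc]
  dist p q := by simp [translation_apply]
  mid p m m' := by
    simp only [translation_apply]
    constructor <;> rintro ⟨h1, h2⟩ <;> constructor <;> linarith

theorem isGridSymmetry_reflection : IsGridSymmetry reflection fun k => (-k.1, k.2) where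
  surj k := ⟨(-k.1, k.2), by simp⟩
  cell p k := by
    simp only [reflection_apply, latticeCell, Set.mem_prod,
      Set.mem_Icc]
    push_cast
    constructor <;> rintro ⟨⟨h1, h2⟩, h3⟩ <;> refine ⟨⟨?_, ?_⟩, h3⟩ <;> linarith
  vertices p k := by
    simp only [reflection_apply, cellVertices, Set.mem_ofPred_eq]
    push_cast
    refine and_congr_left fun _ => ?_
    rw [or_comm]
    refine or_congr ?_ ?_ <;> constructor <;> intro h <;> linarith
  dist p q := by
    simp only [reflection_apply]
    ring
  mid p m m' := by
    simp only [reflection_apply]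
    constructor <;> rintro ⟨h1, h2⟩ <;> constructor <;> linarith

theorem isGridSymmetry_swap : IsGridSymmetry (Homeomorph.prodComm ℝ ℝ) Prod.swap where
  surj := Prod.swap_surjective
  cell p k := by
    simp only [latticeCell, Homeomorph.coe_prodComm, Set.mem_prod, Prod.fst_swap, Prod.snd_swap]
    exact and_comm
  vertices p k := by
    simp only [cellVertices, Homeomorph.coe_prodComm, Set.mem_ofPred_eq, Prod.fst_swap,
      Prod.snd_swap]
    exact and_comm
  dist p q := by
    simp only [Homeomorph.coe_prodComm, Prod.fst_swap, Prod.snd_swap]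
    ring
  mid p m m' := by
    simp only [Homeomorph.coe_prodComm, Prod.fst_swap, Prod.snd_swap]
    exact and_comm

/-! ### Removing the cells that are not selected -/

theorem ArchAbove.reflect {g : ℝ × ℝ → ℝ} {p m m' : ℝ × ℝ} (h : ArchAbove g p m m') :
    ArchAbove (g ∘ reflection) (reflection p) (reflection m) (reflection m') :=
  have hr : ∀ q, reflection (reflection q) = q := fun q => by simp [reflection_apply]
  { isGridSymmetry_reflection.tangentDiscs (by simpa only [hr] using h.toTangentDiscs) with
    mem₁ := by
      have := h.mem₁
      constructor
      · simpa [reflection_apply] using this.2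
      · simpa [reflection_apply] using this.1
    mem₂ := by simpa [reflection_apply] using h.mem₂
    pos00 := by simpa [reflection_apply] using h.pos10
    pos10 := by simpa [reflection_apply] using h.pos00
    pos01 := by simpa [reflection_apply] using h.pos11
    pos11 := by simpa [reflection_apply] using h.pos01
    center₁ := by
      have := h.center₁
      constructor
      · simpa [reflection_apply] using this.2
      · simpa [reflection_apply] using this.1
    center₂ := by simpa [reflection_apply] using h.center₂ }

theorem ArchAbove.selected_left {g : ℝ × ℝ → ℝ} {p m m' : ℝ × ℝ} (hg : HasTangentDiscs g)
    (h : ArchAbove g p m m') (hz : MeetingCell g (-1, -1)) : SelectedCell g (-1, 0) := by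
  obtain ⟨z, ⟨hz1, hz2⟩, hz0⟩ := hz
  have h1 := h.not_pos_left hg hz0 (by simpa using hz1) (by simpa using hz2)
  refine ⟨(0, 0), by simp [cellVertices], ?_⟩
  rcases le_or_gt (g (-1, 0)) 0 with h2 | h2
  · exact ⟨(-1, 0), by simp [cellVertices], h.pos00.le, h2⟩
  · exact ⟨(-1, 1), by simp [cellVertices], h.pos00.le, h1 h2⟩

theorem ArchAbove.selected_right {g : ℝ × ℝ → ℝ} {p m m' : ℝ × ℝ} (hg : HasTangentDiscs g)
    (h : ArchAbove g p m m') (hz : MeetingCell g (1, -1)) : SelectedCell g (1, 0) :=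
  isGridSymmetry_reflection.selectedCell.1
    (h.reflect.selected_left (isGridSymmetry_reflection.hasTangentDiscs hg)
      (isGridSymmetry_reflection.meetingCell.2 hz))

theorem ArchAbove.selected_above {g : ℝ × ℝ → ℝ} {p m m' : ℝ × ℝ} (h : ArchAbove g p m m') :
    SelectedCell g (0, 1) :=
  ⟨(0, 1), by simp [cellVertices], (0, 2), by simp [cellVertices]; norm_num, h.pos01.le,
    h.neg_above.le⟩

theorem ArchAbove.exists_zero_above {g : ℝ × ℝ → ℝ} {p m m' : ℝ × ℝ} (hg : Continuous g)
    (h : ArchAbove g p m m') : ∃ y, 1 < y ∧ y < 2 ∧ g (0, y) = 0 := by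
  obtain ⟨y, ⟨h1, h2⟩, hy⟩ := intermediate_value_Ioo' (one_le_two : (1 : ℝ) ≤ 2)
    (f := fun y => g (0, y)) (hg.comp (by fun_prop)).continuousOn ⟨h.neg_above, h.pos01⟩
  exact ⟨y, h1, h2, hy⟩

theorem ArchAbove.not_meeting_below {g : ℝ × ℝ → ℝ} {p m m' : ℝ × ℝ} (h : ArchAbove g p m m') :
    ¬ MeetingCell g (0, -1) := by
  rintro ⟨z, ⟨hz1, hz2⟩, hz0⟩
  have := h.pos_below (s := z.1) (t := z.2) (by simpa using hz1) (by simpa using hz2)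
  exact this.ne' hz0

/-- The condition under which the unit cell can be collapsed onto the union of the cells in `S`,
for its top edge. -/
theorem isDeformationRetract_insert {S : Set (ℤ × ℤ)} (hS : S.Finite) (h0 : (0, 0) ∉ S)
    (habove : (0, 1) ∈ S) (hbelow : (0, -1) ∉ S) (hleft : (-1, -1) ∈ S → (-1, 0) ∈ S)
    (hright : (1, -1) ∈ S → (1, 0) ∈ S) :
    IsDeformationRetract (latticeUnion S) (latticeUnion (insert (0, 0) S)) := by
  have hunion : latticeUnion (insert (0, 0) S) =
      latticeUnion S ∪ Set.Icc (0 : ℝ) 1 ×ˢ Set.Icc (0 : ℝ) 1 := by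
    rw [latticeUnion, Set.biUnion_insert, Set.union_comm]
    simp [latticeUnion, latticeCell]
  rw [hunion]
  refine isDeformationRetract_union_square (isClosed_latticeUnion hS) ((-1, 0) ∈ S) ((1, 0) ∈ S) ?_
  rintro ⟨x, y⟩ ⟨hx0, hx1⟩ ⟨hy0, hy1⟩
  simp only at hx0 hx1 hy0 hy1 ⊢
  rw [mem_latticeUnion]
  constructor
  · rintro ⟨⟨a, b⟩, hk, ⟨ha0, ha1⟩, hb0, hb1⟩
    simp only at ha0 ha1 hb0 hb1
    have a1 : a ≤ 1 := by exact_mod_cast ha0.trans hx1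
    have a2 : -1 ≤ a := by
      have : (0 : ℝ) ≤ a + 1 := hx0.trans ha1
      have : (0 : ℤ) ≤ a + 1 := by exact_mod_cast this
      linarith
    have b1 : b ≤ 1 := by exact_mod_cast hb0.trans hy1
    have b2 : -1 ≤ b := by
      have : (0 : ℝ) ≤ b + 1 := hy0.trans hb1
      have : (0 : ℤ) ≤ b + 1 := by exact_mod_cast this
      linarith
    have hx_left : a = -1 → x = 0 := fun h => by subst h; push_cast at ha1; linarith
    have hx_right : a = 1 → x = 1 := fun h => by subst h; push_cast at ha0; linarith
    have hy_top : b = 1 → y = 1 := fun h => by subst h; push_cast at hb0; linarith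
    have ha : a = -1 ∨ a = 0 ∨ a = 1 := by omega
    have hb : b = -1 ∨ b = 0 ∨ b = 1 := by omega
    rcases hb with rfl | rfl | rfl
    · rcases ha with rfl | rfl | rfl
      · exact Or.inr (Or.inl ⟨hx_left rfl, hleft hk⟩)
      · exact absurd hk hbelow
      · exact Or.inr (Or.inr ⟨hx_right rfl, hright hk⟩)
    · rcases ha with rfl | rfl | rfl
      · exact Or.inr (Or.inl ⟨hx_left rfl, hk⟩)
      · exact absurd hk h0
      · exact Or.inr (Or.inr ⟨hx_right rfl, hk⟩)
    · exact Or.inl (hy_top rfl)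
  · rintro (rfl | ⟨rfl, h⟩ | ⟨rfl, h⟩)
    · exact ⟨_, habove, by simp [latticeCell, hx0, hx1]⟩
    · exact ⟨_, h, by simp [latticeCell, hy0, hy1]⟩
    · exact ⟨_, h, by simp [latticeCell, hy0, hy1]⟩

/-- The cells of the `n × n` grid. -/
def gridCells (n : ℤ) : Set (ℤ × ℤ) := Set.Ico 0 n ×ˢ Set.Ico 0 n

theorem IsGridSymmetry.isDeformationRetract_insert {e : ℝ × ℝ ≃ₜ ℝ × ℝ} {c : ℤ × ℤ → ℤ × ℤ}
    {g : ℝ × ℝ → ℝ} {n : ℤ} {p m m' : ℝ × ℝ} (he : IsGridSymmetry e c) (hc : Function.Injective c)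
    (hg : HasTangentDiscs g) (ha : ArchAbove (g ∘ e) p m m') {S : Set (ℤ × ℤ)} (hS : S.Finite)
    (hmeet : ∀ k ∈ S, MeetingCell g k) (hgrid : S ⊆ gridCells n)
    (hsel : ∀ k ∈ gridCells n, SelectedCell g k → k ∈ S) (h0 : c (0, 0) ∉ S)
    (habove : (∃ y, 1 < y ∧ y < 2 ∧ g (e (0, y)) = 0) → c (0, 1) ∈ gridCells n)
    (hleft : c (-1, -1) ∈ gridCells n → c (-1, 0) ∈ gridCells n)
    (hright : c (1, -1) ∈ gridCells n → c (1, 0) ∈ gridCells n) :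
    IsDeformationRetract (latticeUnion S) (latticeUnion (insert (c (0, 0)) S)) := by
  have hge := he.hasTangentDiscs hg
  have hpre : c ⁻¹' insert (c (0, 0)) S = insert (0, 0) (c ⁻¹' S) := by
    ext k
    simp [hc.eq_iff]
  rw [← he.image_latticeUnion S, ← he.image_latticeUnion (insert _ S), hpre]
  refine IsDeformationRetract.image e
    (_root_.isDeformationRetract_insert (hS.preimage hc.injOn) h0 ?_ ?_ ?_ ?_)
  · exact hsel _ (habove (ha.exists_zero_above hge.cont)) (he.selectedCell.1 ha.selected_above)
  · exact fun h => ha.not_meeting_below (he.meetingCell.2 (hmeet _ h))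
  · exact fun h => hsel _ (hleft (hgrid h))
      (he.selectedCell.1 (ha.selected_left hge (he.meetingCell.2 (hmeet _ h))))
  · exact fun h => hsel _ (hright (hgrid h))
      (he.selectedCell.1 (ha.selected_right hge (he.meetingCell.2 (hmeet _ h))))

theorem IsGridSymmetry.archAbove {e : ℝ × ℝ ≃ₜ ℝ × ℝ} {c : ℤ × ℤ → ℤ × ℤ} {g : ℝ × ℝ → ℝ}
    {p m m' : ℝ × ℝ} (he : IsGridSymmetry e c) (hv : ∀ v ∈ cellVertices (c (0, 0)), 0 < g v)
    (ht : TangentDiscs g p m m') (hp : p ∈ latticeCell (c (0, 0)))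
    (h1 : 0 < (e.symm m).1 ∧ (e.symm m).1 < 1) (h2 : 1 < (e.symm m).2) :
    ArchAbove (g ∘ e) (e.symm p) (e.symm m) (e.symm m') :=
  have hp' : e.symm p ∈ latticeCell (0, 0) := (he.cell _ _).1 (by simpa)
  { he.tangentDiscs (by simpa using ht) with
    mem₁ := by simpa using hp'.1
    mem₂ := by simpa using hp'.2
    pos00 := hv _ ((he.vertices _ _).2 (by simp [cellVertices]))
    pos10 := hv _ ((he.vertices _ _).2 (by simp [cellVertices]))
    pos01 := hv _ ((he.vertices _ _).2 (by simp [cellVertices]))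
    pos11 := hv _ ((he.vertices _ _).2 (by simp [cellVertices]))
    center₁ := h1
    center₂ := h2 }

/-- A cell which contains a zero and has only positive vertices can be collapsed. -/
theorem isDeformationRetract_insert_of_pos {g : ℝ × ℝ → ℝ} {n : ℤ} (hg : HasTangentDiscs g)
    (hZ : ∀ q, g q = 0 → (0 ≤ q.1 ∧ q.1 ≤ n) ∧ (0 ≤ q.2 ∧ q.2 ≤ n)) {S : Set (ℤ × ℤ)}
    (hmeet : ∀ k ∈ S, MeetingCell g k) (hgrid : S ⊆ gridCells n)
    (hsel : ∀ k ∈ gridCells n, SelectedCell g k → k ∈ S) {k : ℤ × ℤ} (hk : k ∈ gridCells n)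
    (hkm : MeetingCell g k) (hkS : k ∉ S) (hpos : ∀ v ∈ cellVertices k, 0 < g v) :
    IsDeformationRetract (latticeUnion S) (latticeUnion (insert k S)) := by
  have hS : S.Finite := ((Set.finite_Ico 0 n).prod (Set.finite_Ico 0 n)).subset hgrid
  obtain ⟨p, hp, hgp⟩ := hkm
  obtain ⟨m, m', hm⟩ := hg.discs p hgp
  have main : ∀ (e : ℝ × ℝ ≃ₜ ℝ × ℝ) (c : ℤ × ℤ → ℤ × ℤ), IsGridSymmetry e c →
      Function.Injective c → c (0, 0) = k → (0 < (e.symm m).1 ∧ (e.symm m).1 < 1) →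
      1 < (e.symm m).2 →
      (∀ y : ℝ, 1 < y → (0 ≤ (e (0, y)).1 ∧ (e (0, y)).1 ≤ n) ∧
        (0 ≤ (e (0, y)).2 ∧ (e (0, y)).2 ≤ n) → c (0, 1) ∈ gridCells n) →
      (c (-1, -1) ∈ gridCells n → c (-1, 0) ∈ gridCells n) →
      (c (1, -1) ∈ gridCells n → c (1, 0) ∈ gridCells n) →
      IsDeformationRetract (latticeUnion S) (latticeUnion (insert k S)) := by
    intro e c he hc hck h1 h2 h3 h4 h5
    subst hck
    exact he.isDeformationRetract_insert hc hg (he.archAbove hpos hm hp h1 h2) hS hmeet hgrid hsel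
      hkS (fun ⟨y, hy1, _, hy0⟩ => h3 y hy1 (hZ _ hy0)) h4 h5
  obtain ⟨i, j⟩ := k
  obtain ⟨⟨hi0, hin⟩, hj0, hjn⟩ := hk
  obtain ⟨⟨hpi0, hpi1⟩, hpj0, hpj1⟩ := hp
  simp only at hi0 hin hj0 hjn hpi0 hpi1 hpj0 hpj1
  have q00 : 0 < g (i, j) := hpos _ (by simp [cellVertices])
  have q10 : 0 < g (i + 1, j) := hpos _ (by simp [cellVertices])
  have q01 : 0 < g (i, j + 1) := hpos _ (by simp [cellVertices])
  have q11 : 0 < g (i + 1, j + 1) := hpos _ (by simp [cellVertices])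
  have v00 := hm.le_of_pos q00
  have v10 := hm.le_of_pos q10
  have v01 := hm.le_of_pos q01
  have v11 := hm.le_of_pos q11
  have hcirc := hm.circle
  have ne : ∀ s t : ℝ, 0 < g (i + s, j + t) → p.1 - i ≠ s ∨ p.2 - j ≠ t := fun s t hst => by
    by_contra! hc
    have : p = (i + s, j + t) := Prod.ext (by simp [← hc.1]) (by simp [← hc.2])
    rw [← this, hgp] at hst
    exact lt_irrefl _ hst
  have hT := isGridSymmetry_translation i j
  have hTinj : Function.Injective fun k : ℤ × ℤ => (i + k.1, j + k.2) := fun a b h => by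
    simpa [Prod.ext_iff] using h
  have hRinj : Function.Injective fun k : ℤ × ℤ => (-k.1, k.2) := fun a b h => by
    simpa [Prod.ext_iff] using h
  have hcases := center_cases (a := p.1 - i) (b := p.2 - j) (m := m.1 - i) (n := m.2 - j)
    ⟨by linarith, by linarith⟩ ⟨by linarith, by linarith⟩ (by linarith) (by linarith)
    (by linarith) (by linarith) (by linarith)
    ⟨ne 0 0 (by simpa), ne 1 0 (by simpa), ne 0 1 (by simpa), ne 1 1 (by simpa)⟩
  rcases hcases with hc | hc | hc | hc
  · refine main _ _ hT hTinj (by simp) hc.1 hc.2 ?_ ?_ ?_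
    · rintro y hy ⟨-, -, h⟩
      rw [translation_apply] at h
      have : (j : ℝ) + 1 < n := by linarith
      have : j + 1 < n := by exact_mod_cast this
      simp only [gridCells, Set.mem_prod, Set.mem_Ico]
      omega
    all_goals
      simp only [gridCells, Set.mem_prod, Set.mem_Ico]
      omega
  · refine main _ _ (((isGridSymmetry_swap.trans isGridSymmetry_reflection).trans
      isGridSymmetry_swap).trans hT) (hTinj.comp (Prod.swap_injective.comp
      (hRinj.comp Prod.swap_injective))) (by simp) hc.1 (?_ : 1 < 1 - (m.2 - j)) ?_ ?_ ?_
    · linarith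
    · rintro y hy ⟨-, (h : (0 : ℝ) ≤ j + (1 - y)), -⟩
      have : (0 : ℝ) < j := by linarith
      have : 0 < j := by exact_mod_cast this
      simp only [gridCells, Set.mem_prod, Set.mem_Ico, Function.comp, Prod.swap]
      omega
    all_goals
      simp only [gridCells, Set.mem_prod, Set.mem_Ico, Function.comp, Prod.swap]
      omega
  · refine main _ _ (isGridSymmetry_swap.trans hT) (hTinj.comp Prod.swap_injective) (by simp)
      hc.1 hc.2 ?_ ?_ ?_
    · rintro y hy ⟨⟨-, (h : (i : ℝ) + y ≤ n)⟩, -⟩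
      have : (i : ℝ) + 1 < n := by linarith
      have : i + 1 < n := by exact_mod_cast this
      simp only [gridCells, Set.mem_prod, Set.mem_Ico, Function.comp, Prod.swap]
      omega
    all_goals
      simp only [gridCells, Set.mem_prod, Set.mem_Ico, Function.comp, Prod.swap]
      omega
  · refine main _ _ ((isGridSymmetry_swap.trans isGridSymmetry_reflection).trans hT)
      (hTinj.comp (hRinj.comp Prod.swap_injective)) (by simp) hc.1 (?_ : 1 < 1 - (m.1 - i)) ?_ ?_ ?_
    · linarith
    · rintro y hy ⟨⟨(h : (0 : ℝ) ≤ i + (1 - y)), -⟩, -⟩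
      have : (0 : ℝ) < i := by linarith
      have : 0 < i := by exact_mod_cast this
      simp only [gridCells, Set.mem_prod, Set.mem_Ico, Function.comp, Prod.swap]
      omega
    all_goals
      simp only [gridCells, Set.mem_prod, Set.mem_Ico, Function.comp, Prod.swap]
      omega

/-- A cell which contains a zero and is not selected can be collapsed. -/
theorem isDeformationRetract_insert_of_not_selected {g : ℝ × ℝ → ℝ} {n : ℤ}
    (hg : HasTangentDiscs g)
    (hZ : ∀ q, g q = 0 → (0 ≤ q.1 ∧ q.1 ≤ n) ∧ (0 ≤ q.2 ∧ q.2 ≤ n)) {S : Set (ℤ × ℤ)}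
    (hmeet : ∀ k ∈ S, MeetingCell g k) (hgrid : S ⊆ gridCells n)
    (hsel : ∀ k ∈ gridCells n, SelectedCell g k → k ∈ S) {k : ℤ × ℤ} (hk : k ∈ gridCells n)
    (hkm : MeetingCell g k) (hkS : k ∉ S) :
    IsDeformationRetract (latticeUnion S) (latticeUnion (insert k S)) := by
  have hns : ¬ SelectedCell g k := fun h => hkS (hsel k hk h)
  by_cases hpos : ∀ v ∈ cellVertices k, 0 < g v
  · exact isDeformationRetract_insert_of_pos hg hZ hmeet hgrid hsel hk hkm hkS hpos
  · push Not at hpos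
    obtain ⟨w, hw, hgw⟩ := hpos
    refine isDeformationRetract_insert_of_pos hg.negate (fun q hq => hZ q (by simpa using hq))
      (fun k hk => meetingCell_neg.2 (hmeet k hk)) hgrid
      (fun k hk h => hsel k hk (selectedCell_neg.1 h)) hk (meetingCell_neg.2 hkm) hkS ?_
    intro v hv
    rw [Pi.neg_apply, neg_pos]
    by_contra! hgv
    exact hns ⟨v, hv, w, hw, hgv, hgw⟩

/-- The union of the selected cells is a deformation retract of the union of the cells which
contain a zero. -/
theorem HasTangentDiscs.isDeformationRetract_selected {g : ℝ × ℝ → ℝ} {n : ℤ}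
    (hg : HasTangentDiscs g)
    (hZ : ∀ q, g q = 0 → (0 ≤ q.1 ∧ q.1 ≤ n) ∧ (0 ≤ q.2 ∧ q.2 ≤ n)) :
    IsDeformationRetract (latticeUnion {k | k ∈ gridCells n ∧ SelectedCell g k})
      (latticeUnion {k | k ∈ gridCells n ∧ MeetingCell g k}) := by
  set A : Set (ℤ × ℤ) := {k | k ∈ gridCells n ∧ SelectedCell g k}
  set C : Set (ℤ × ℤ) := {k | k ∈ gridCells n ∧ MeetingCell g k}
  have hAC : A ⊆ C := fun k hk => ⟨hk.1, hk.2.meetingCell hg.cont⟩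
  have hC : C.Finite := ((Set.finite_Ico 0 n).prod (Set.finite_Ico 0 n)).subset fun k hk => hk.1
  have key : ∀ t : Set (ℤ × ℤ), t.Finite → t ⊆ C →
      IsDeformationRetract (latticeUnion A) (latticeUnion (A ∪ t)) := by
    intro t ht
    induction t, ht using Set.Finite.induction_on with
    | empty =>
      intro _
      rw [Set.union_empty]
      exact IsDeformationRetract.refl _
    | @insert k t _ _ ih =>
      intro hsub
      have ih' := ih fun x hx => hsub (Set.mem_insert_of_mem _ hx)
      have hkC : k ∈ C := hsub (Set.mem_insert _ _)
      have htC : A ∪ t ⊆ C :=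
        Set.union_subset hAC fun x hx => hsub (Set.mem_insert_of_mem _ hx)
      rw [Set.union_insert]
      by_cases hk : k ∈ A ∪ t
      · rwa [Set.insert_eq_of_mem hk]
      · exact ih'.trans (isDeformationRetract_insert_of_not_selected hg hZ
          (fun x hx => (htC hx).2) (fun x hx => (htC hx).1) (fun x hx h => Or.inl ⟨hx, h⟩)
          hkC.1 hkC.2 hk)
  have := key C hC subset_rfl
  rwa [Set.union_eq_self_of_subset_left hAC] at this

/-! ### Passing from the grid of mesh `δ` to the integer grid -/

/-- The homeomorphism taking the integer grid to the grid of mesh `δ` with lower left vertex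
`(-L, -L)`. -/
def gridScaling (L : ℝ) {δ : ℝ} (hδ : 0 < δ) : Plane ≃ₜ Plane where
  toFun z := !₂[-L + z 0 * δ, -L + z 1 * δ]
  invFun z := !₂[(z 0 + L) / δ, (z 1 + L) / δ]
  left_inv z := by
    ext i
    fin_cases i <;> simp [hδ.ne']
  right_inv z := by
    ext i
    fin_cases i <;> simp [hδ.ne']
  continuous_toFun := by fun_prop
  continuous_invFun := by fun_prop

@[simp] theorem gridScaling_zero (L : ℝ) {δ : ℝ} (hδ : 0 < δ) (z : Plane) :
    gridScaling L hδ z 0 = -L + z 0 * δ := by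
  simp [gridScaling]

@[simp] theorem gridScaling_one (L : ℝ) {δ : ℝ} (hδ : 0 < δ) (z : Plane) :
    gridScaling L hδ z 1 = -L + z 1 * δ := by
  simp [gridScaling]

/-- The plane as a product. -/
def prodPlane : ℝ × ℝ ≃ₜ Plane where
  toFun q := !₂[q.1, q.2]
  invFun z := (z 0, z 1)
  left_inv q := by simp
  right_inv z := by
    ext i
    fin_cases i <;> simp
  continuous_toFun := by fun_prop
  continuous_invFun := by fun_prop

@[simp] theorem prodPlane_zero (q : ℝ × ℝ) : prodPlane q 0 = q.1 := by simp [prodPlane]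

@[simp] theorem prodPlane_one (q : ℝ × ℝ) : prodPlane q 1 = q.2 := by simp [prodPlane]

theorem TangentBalls.hasTangentDiscs {g : Plane → ℝ} {ν : Plane → Plane} (h : TangentBalls g ν) :
    HasTangentDiscs (g ∘ prodPlane) where
  cont := h.cont.comp prodPlane.continuous
  discs q hq := by
    set p := prodPlane q with hp
    have hu := h.unit p hq
    have h0 : p 0 = q.1 := prodPlane_zero q
    have h1 : p 1 = q.2 := prodPlane_one q
    refine ⟨(q.1 - 2.37 * ν p 0, q.2 - 2.37 * ν p 1), (q.1 + 2.37 * ν p 0, q.2 + 2.37 * ν p 1),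
      hq, by ring, by ring, ?_, fun s t hst => ?_, fun s t hst => ?_⟩
    · nlinarith only [hu]
    · refine h.neg p _ hq ?_
      simp only [prodPlane_zero, prodPlane_one, h0, h1]
      nlinarith only [hst, hu]
    · refine h.pos p _ hq ?_
      simp only [prodPlane_zero, prodPlane_one, h0, h1]
      nlinarith only [hst, hu]

theorem isCompact_zeroSet_of_mem_square {f : Plane → ℝ} (hf : Continuous f) {L : ℝ} (hL : 0 < L)
    (hM : ∀ p, f p = 0 → p 0 ∈ Set.Icc (-L) L ∧ p 1 ∈ Set.Icc (-L) L) :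
    IsCompact {p | f p = 0} := by
  refine Metric.isCompact_of_isClosed_isBounded (isClosed_eq hf continuous_const) ?_
  refine (Metric.isBounded_closedBall (x := (0 : Plane)) (r := 2 * L)).subset fun p hp => ?_
  obtain ⟨⟨h1, h2⟩, h3, h4⟩ := hM p hp
  rw [Metric.mem_closedBall]
  refine abs_le_of_sq_le_sq' ?_ (by linarith) |>.2
  rw [plane_dist_sq]
  simp only [PiLp.zero_apply, sub_zero]
  nlinarith only [h1, h2, h3, h4]

theorem tangentBalls_gridScaling {f : Plane → ℝ} (hf : ContDiff ℝ 1 f)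
    (hreg : ∀ p, f p = 0 → gradient f p ≠ 0) (hc : IsCompact {p | f p = 0}) (L : ℝ) {δ : ℝ}
    (hδ : 0 < δ) (hreach : ENNReal.ofReal (2.37 * δ) ≤ reach {p | f p = 0}) :
    TangentBalls (f ∘ gridScaling L hδ) (unitNormal f ∘ gridScaling L hδ) := by
  have hdist : ∀ (p z u : Plane) (σ : ℝ), σ ^ 2 = 1 → u 0 ^ 2 + u 1 ^ 2 = 1 →
      (z 0 - p 0) ^ 2 + (z 1 - p 1) ^ 2 <
        4.74 * σ * ((z 0 - p 0) * u 0 + (z 1 - p 1) * u 1) →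
      dist (gridScaling L hδ z) (gridScaling L hδ p + (σ * (2.37 * δ)) • u) < 2.37 * δ := by
    intro p z u σ hσ hu h
    refine (abs_lt_of_sq_lt_sq' ?_ (by positivity)).2
    rw [plane_dist_sq]
    simp only [PiLp.add_apply, PiLp.smul_apply, smul_eq_mul, gridScaling_zero, gridScaling_one]
    have hδ2 : 0 < δ ^ 2 := by positivity
    have e : (-L + z 0 * δ - (-L + p 0 * δ + σ * (2.37 * δ) * u 0)) ^ 2
        + (-L + z 1 * δ - (-L + p 1 * δ + σ * (2.37 * δ) * u 1)) ^ 2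
        = δ ^ 2 * ((z 0 - p 0) ^ 2 + (z 1 - p 1) ^ 2
          - 4.74 * σ * ((z 0 - p 0) * u 0 + (z 1 - p 1) * u 1)
          + 2.37 ^ 2 * σ ^ 2 * (u 0 ^ 2 + u 1 ^ 2)) := by ring
    rw [e, hσ, hu, mul_pow, mul_comm]
    nlinarith only [h, hδ2]
  have hunit : ∀ p, f p = 0 → unitNormal f p 0 ^ 2 + unitNormal f p 1 ^ 2 = 1 := fun p hp => by
    have := norm_unitNormal (hreg p hp)
    rw [EuclideanSpace.norm_eq, Real.sqrt_eq_one, Fin.sum_univ_two] at this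
    simpa only [Real.norm_eq_abs, sq_abs] using this
  have hR : 0 < 2.37 * δ := by positivity
  have hu : ∀ p, f p = 0 → UniqueNearest {p | f p = 0} (2.37 * δ) := fun p hp =>
    uniqueNearest_of_le_reach ⟨p, hp⟩ hreach
  refine
    { cont := hf.continuous.comp (gridScaling L hδ).continuous
      compact := (gridScaling L hδ).isCompact_preimage.2 hc
      contNormal := fun p hp => ?_
      unit := fun p hp => hunit _ hp
      pos := fun p z hp h => ?_
      neg := fun p z hp h => ?_ }
  · exact ((continuousAt_unitNormal hf (hreg _ hp)).comp
      (gridScaling L hδ).continuous.continuousAt).continuousWithinAt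
  · refine pos_of_dist_lt hf hreg hc hR (hu _ hp) hp ?_
    have := hdist p z _ 1 (by norm_num) (hunit _ hp) (by simpa using h)
    simpa using this
  · refine neg_of_dist_lt hf hreg hc hR (hu _ hp) hp ?_
    have := hdist p z _ (-1) (by norm_num) (hunit _ hp) (by
      refine h.trans_le (le_of_eq ?_)
      simp only [Function.comp]
      ring)
    rwa [neg_one_mul, neg_smul, ← sub_eq_add_neg] at this

theorem gridScaling_mem_gridBox {L δ : ℝ} (hδ : 0 < δ) {z : Plane} {i j : ℕ} :
    gridScaling L hδ z ∈ gridBox L δ i j ↔ z ∈ unitCell i j := by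
  simp [gridBox, unitCell, hδ]

theorem image_gridScaling_cellUnion {f : Plane → ℝ} {L δ : ℝ} (hδ : 0 < δ) (n : ℕ) :
    gridScaling L hδ '' cellUnion {q | (f ∘ gridScaling L hδ) q = 0} n =
      meetingUnion {p | f p = 0} L δ n := by
  ext p
  obtain ⟨z, rfl⟩ := (gridScaling L hδ).surjective p
  rw [(gridScaling L hδ).injective.mem_set_image]
  constructor
  · rintro ⟨i, j, ⟨hi0, hin⟩, ⟨hj0, hjn⟩, ⟨q, hq, hq0⟩, hz⟩
    lift i to ℕ using hi0
    lift j to ℕ using hj0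
    exact ⟨i, by exact_mod_cast hin, j, by exact_mod_cast hjn,
      ⟨_, (gridScaling_mem_gridBox hδ).2 hq, hq0⟩, (gridScaling_mem_gridBox hδ).2 hz⟩
  · rintro ⟨i, hi, j, hj, ⟨q, hq, hq0⟩, hz⟩
    obtain ⟨q, rfl⟩ := (gridScaling L hδ).surjective q
    exact ⟨i, j, ⟨by positivity, by exact_mod_cast hi⟩, ⟨by positivity, by exact_mod_cast hj⟩,
      ⟨q, (gridScaling_mem_gridBox hδ).1 hq, hq0⟩, (gridScaling_mem_gridBox hδ).1 hz⟩

theorem prodPlane_mem_unitCell {q : ℝ × ℝ} {k : ℤ × ℤ} :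
    prodPlane q ∈ unitCell k.1 k.2 ↔ q ∈ latticeCell k := by
  simp [unitCell, latticeCell, -Set.Icc_prod_Icc]

theorem image_prodPlane_latticeUnion (g : Plane → ℝ) (n : ℤ) :
    prodPlane '' latticeUnion {k | k ∈ gridCells n ∧ MeetingCell (g ∘ prodPlane) k} =
      cellUnion {q | g q = 0} n := by
  ext p
  obtain ⟨z, rfl⟩ := prodPlane.surjective p
  rw [prodPlane.injective.mem_set_image, mem_latticeUnion]
  constructor
  · rintro ⟨⟨i, j⟩, ⟨⟨hi, hj⟩, q, hq, hq0⟩, hz⟩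
    exact ⟨i, j, hi, hj, ⟨_, prodPlane_mem_unitCell.2 hq, hq0⟩, prodPlane_mem_unitCell.2 hz⟩
  · rintro ⟨i, j, hi, hj, ⟨q, hq, hq0⟩, hz⟩
    obtain ⟨q, rfl⟩ := prodPlane.surjective q
    exact ⟨(i, j), ⟨⟨hi, hj⟩, q, prodPlane_mem_unitCell.1 hq, hq0⟩, prodPlane_mem_unitCell.1 hz⟩

theorem mem_boxVertices {L δ : ℝ} (hδ : 0 < δ) {q : ℝ × ℝ} {i j : ℕ} :
    gridScaling L hδ (prodPlane q) ∈ boxVertices L δ i j ↔ q ∈ cellVertices (i, j) := by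
  have key : ∀ a b : ℕ, gridScaling L hδ (prodPlane q) = gridVertex L δ a b ↔
      q.1 = a ∧ q.2 = b := fun a b => by
    constructor
    · intro h
      have h0 := congrArg (fun z : Plane => z 0) h
      have h1 := congrArg (fun z : Plane => z 1) h
      simpa [gridVertex, hδ.ne'] using And.intro h0 h1
    · rintro ⟨h0, h1⟩
      ext l
      fin_cases l <;> simp [gridVertex, h0, h1]
  simp only [boxVertices, Set.mem_insert_iff, Set.mem_singleton_iff, key, cellVertices,
    Set.mem_ofPred_eq]
  push_cast
  tauto

theorem image_gridScaling_latticeUnion {f : Plane → ℝ} {L δ : ℝ} (hδ : 0 < δ) (n : ℕ) :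
    gridScaling L hδ '' (prodPlane '' latticeUnion {k | k ∈ gridCells n ∧
      SelectedCell ((f ∘ gridScaling L hδ) ∘ prodPlane) k}) = selectedUnion f L δ n := by
  have hsel : ∀ i j : ℕ, SelectedCell ((f ∘ gridScaling L hδ) ∘ prodPlane) (i, j) ↔
      IsSelected f L δ i j := fun i j => by
    constructor
    · rintro ⟨v, hv, w, hw, h1, h2⟩
      exact ⟨_, (mem_boxVertices hδ).2 hv, _, (mem_boxVertices hδ).2 hw, h1, h2⟩
    · rintro ⟨v, hv, w, hw, h1, h2⟩
      obtain ⟨v, rfl⟩ := (prodPlane.trans (gridScaling L hδ)).surjective v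
      obtain ⟨w, rfl⟩ := (prodPlane.trans (gridScaling L hδ)).surjective w
      exact ⟨v, (mem_boxVertices hδ).1 hv, w, (mem_boxVertices hδ).1 hw, h1, h2⟩
  ext p
  obtain ⟨z, rfl⟩ := (gridScaling L hδ).surjective p
  obtain ⟨z, rfl⟩ := prodPlane.surjective z
  rw [(gridScaling L hδ).injective.mem_set_image, prodPlane.injective.mem_set_image,
    mem_latticeUnion]
  constructor
  · rintro ⟨⟨i, j⟩, ⟨⟨⟨hi0, hin⟩, hj0, hjn⟩, hs⟩, hz⟩
    simp only at hi0 hin hj0 hjn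
    lift i to ℕ using hi0
    lift j to ℕ using hj0
    exact ⟨i, by exact_mod_cast hin, j, by exact_mod_cast hjn, (hsel i j).1 hs,
      (gridScaling_mem_gridBox hδ).2 (prodPlane_mem_unitCell (k := ((i : ℤ), (j : ℤ))).2 hz)⟩
  · rintro ⟨i, hi, j, hj, hs, hz⟩
    exact ⟨(i, j), ⟨⟨⟨Int.natCast_nonneg i, Int.ofNat_lt.2 hi⟩, Int.natCast_nonneg j,
      Int.ofNat_lt.2 hj⟩, (hsel i j).2 hs⟩, (prodPlane_mem_unitCell (k := ((i : ℤ), (j : ℤ)))).1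
        ((gridScaling_mem_gridBox hδ).1 hz)⟩

theorem exists_unit_interval {n : ℕ} (hn : 0 < n) {x : ℝ} (h0 : 0 ≤ x) (h1 : x ≤ n) :
    ∃ i : ℤ, (0 ≤ i ∧ i < n) ∧ x ∈ Set.Icc (i : ℝ) (i + 1) := by
  rcases h1.eq_or_lt with h | h
  · refine ⟨n - 1, ⟨by omega, by omega⟩, ?_⟩
    push_cast
    constructor <;> linarith
  · refine ⟨⌊x⌋, ⟨Int.floor_nonneg.2 h0, Int.floor_lt.2 (by exact_mod_cast h)⟩, Int.floor_le x,
      (Int.lt_floor_add_one x).le⟩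

end

theorem corollary6p5
    (f : EuclideanSpace ℝ (Fin 2) → ℝ) (hf : ContDiff ℝ ∞ f)
    (hreg : ∀ p, f p = 0 → fderiv ℝ f p ≠ 0)
    (L δ : ℝ) (n : ℕ) (hL : 0 < L) (hn : (n : ℝ) * δ = 2 * L)
    (hM : ∀ p, f p = 0 → p 0 ∈ Set.Icc (-L) L ∧ p 1 ∈ Set.Icc (-L) L)
    (hδ : ENNReal.ofReal (2.37 * δ) ≤ reach (zeroSet f))
    (M B B' : Set (EuclideanSpace ℝ (Fin 2)))
    (hMdef : M = zeroSet f)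
    (hBdef : B = selectedUnion f L δ n)
    (hB'def : B' = meetingUnion (zeroSet f) L δ n) :
    IsDeformationRetract M B' ∧
    IsDeformationRetract B B' ∧
    ∃ (iM : M ⊆ B') (iB : B ⊆ B'),
      -- the inclusions of `M` and of `B` induce isomorphisms of fundamental groups
      (∀ x : M, Function.Bijective (FundamentalGroup.map (inclusionMap iM) x)) ∧
      (∀ y : B, Function.Bijective (FundamentalGroup.map (inclusionMap iB) y)) ∧
      -- `π₁(M, x) ≅ π₁(B, y)` whenever `x` and `y` lie in the same path component of `B'`
      (∀ (x : M) (y : B), Joined (inclusionMap iM x) (inclusionMap iB y) →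
        Nonempty (FundamentalGroup M x ≃* FundamentalGroup B y)) ∧
      -- the fundamental groupoids are equivalent (so the path components correspond too)
      Nonempty (FundamentalGroupoid M ≌ FundamentalGroupoid B) ∧
      Nonempty (FundamentalGroupoid B ≌ FundamentalGroupoid B') ∧
      (FundamentalGroupoid.map (inclusionMap iM)).IsEquivalence ∧
      (FundamentalGroupoid.map (inclusionMap iB)).IsEquivalence ∧
      -- the inclusions of `M` and of `B` induce isomorphisms of cohomology in degrees 0 and 1
      (∀ i : ℕ, i ≤ 1 →
        IsIso (Hcoh.map i (inclusionMap iM)) ∧ IsIso (Hcoh.map i (inclusionMap iB)) ∧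
        Nonempty (Hcoh i M ≅ Hcoh i B) ∧ Nonempty (Hcoh i B ≅ Hcoh i B')) := by
  have hn0 : 0 < n := by
    rcases Nat.eq_zero_or_pos n with rfl | h
    · simp only [Nat.cast_zero, zero_mul] at hn; linarith
    · exact h
  have hδ0 : 0 < δ := by
    have hnr : (0 : ℝ) < n := by exact_mod_cast hn0
    by_contra! h
    have := mul_nonpos_of_nonneg_of_nonpos hnr.le h
    linarith
  have hf1 : ContDiff ℝ 1 f := hf.of_le (by exact_mod_cast le_top)
  have hgrad : ∀ p, f p = 0 → gradient f p ≠ 0 := fun p hp h =>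
    hreg p hp (by simpa [gradient] using h)
  have htb := tangentBalls_gridScaling hf1 hgrad
    (isCompact_zeroSet_of_mem_square hf.continuous hL hM) L hδ0 hδ
  have hZ : ∀ q, (f ∘ gridScaling L hδ0) q = 0 →
      (0 ≤ q 0 ∧ q 0 ≤ (n : ℤ)) ∧ (0 ≤ q 1 ∧ q 1 ≤ (n : ℤ)) := by
    intro q hq
    obtain ⟨⟨h1, h2⟩, h3, h4⟩ := hM _ hq
    rw [gridScaling_zero] at h1 h2
    rw [gridScaling_one] at h3 h4
    have hle : ∀ x : ℝ, -L ≤ -L + x * δ → -L + x * δ ≤ L → 0 ≤ x ∧ x ≤ ((n : ℤ) : ℝ) := by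
      intro x hx0 hx1
      refine ⟨nonneg_of_mul_nonneg_left (by linarith) hδ0, le_of_mul_le_mul_right ?_ hδ0⟩
      push_cast
      linarith
    exact ⟨hle _ h1 h2, hle _ h3 h4⟩
  have hsub : {q | (f ∘ gridScaling L hδ0) q = 0} ⊆
      cellUnion {q | (f ∘ gridScaling L hδ0) q = 0} n := by
    intro q hq
    obtain ⟨⟨h1, h2⟩, h3, h4⟩ := hZ q hq
    obtain ⟨i, hi, hqi⟩ := exists_unit_interval hn0 h1 (by exact_mod_cast h2)
    obtain ⟨j, hj, hqj⟩ := exists_unit_interval hn0 h3 (by exact_mod_cast h4)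
    exact ⟨i, j, hi, hj, ⟨q, ⟨hqi, hqj⟩, hq⟩, hqi, hqj⟩
  have hMB : IsDeformationRetract M B' := by
    have := (htb.isDeformationRetract_cellUnion hZ hsub).image (gridScaling L hδ0)
    rw [image_gridScaling_cellUnion] at this
    have himage : gridScaling L hδ0 '' {q | (f ∘ gridScaling L hδ0) q = 0} = zeroSet f :=
      (gridScaling L hδ0).image_preimage (zeroSet f)
    rw [himage] at this
    rw [hMdef, hB'def]
    exact this
  have hBB : IsDeformationRetract B B' := by
    have := ((htb.hasTangentDiscs.isDeformationRetract_selected (n := n) fun q hq => by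
      simpa using hZ _ hq).image prodPlane).image (gridScaling L hδ0)
    rw [image_gridScaling_latticeUnion, image_prodPlane_latticeUnion,
      image_gridScaling_cellUnion] at this
    rw [hBdef, hB'def]
    exact this
  exact ⟨hMB, hBB, deformationRetract_invariants hMB hBB⟩
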